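/- Let $\mathbb R_+=(0,\infty)$, $L^2=L^2(\mathbb R_+;\mathbb C)$ with inner product linear in the first argument, and let $\mathcal M_{\rm finite}$ be the set of finite positive Borel measures on $\mathbb R_+$ (measures on $\mathbb R$ that do not charge $(-\infty,0]$). For $\mu\in\mathcal M_{\rm finite}$ let $h_\mu(t)=\int_0^\infty e^{-tx}\,d\mu(x)$, let $(\mathcal Lf)(x)=\int_0^\infty e^{-tx}f(t)\,dt$, and let $\Gamma_\mu$ be the (possibly unbounded) self-adjoint Hankel operator in $L^2$ associated with the closed quadratic form $Q_\mu[f]=\int_0^\infty|\mathcal Lf(x)|^2\,d\mu(x)$, with domain $\{f\in L^2: Q_\mu[f]<\infty\}$. Let $v_\mu$ be the unique element of $\overline{\operatorname{Ran}\Gamma_\mu}$ such that $\langle v_\mu,\Gamma_\mu^{1/2}g\rangle=\int_0^\infty h_\mu(t)\overline{g(t)}\,dt$ for all smooth $g$ with compact support in $\mathbb R_+$, and let $\Omega(\mu)=\sigma$ be the spectral measure of $\Gamma_\mu$ with respect to $v_\mu$, that is, the finite measure with $\langle\varphi(\Gamma_\mu)v_\mu,v_\mu\rangle=\int\varphi\,d\sigma$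 for all bounded continuous $\varphi$. Let $\mathcal M_{\rm Carleson}\subset\mathcal M_{\rm finite}$ be the set of $\mu$ for which there is a constant $C$ with $\mu((0,a))\le Ca$ for all $a>0$, and let $\mathcal M_{\rm bounded}\subset\mathcal M_{\rm finite}$ be the set of measures with bounded support. Then $\Omega$ is a well-defined map $\mathcal M_{\rm finite}\to\mathcal M_{\rm finite}$; for every $\mu\in\mathcal M_{\rm finite}$, $$\mu\in\mathcal M_{\rm Carleson}\iff\Omega(\mu)\in\mathcal M_{\rm bounded};$$ and $\Omega$ restricts to an involution on $\mathcal M_{\rm Carleson}\cap\mathcal M_{\rm bounded}$: it maps this set into itself, and $\Omega(\Omega(\mu))=\mu$ for every $\mu$ in it. -/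

import Mathlib

open MeasureTheory Set
open scoped BoundedContinuousFunction ContDiff ComplexConjugate

namespace Hankel

noncomputable section

/-! ### Unbounded operators in a complex Hilbert space -/

section Operators

variable {H : Type*} [NormedAddCommGroup H] [InnerProductSpace ℂ H]

/-- The bounded continuous function `x ↦ 1 / (x - z)` on the real line, for non-real `z`. -/
def resolventFun (z : ℂ) (hz : z.im ≠ 0) : ℝ →ᵇ ℂ :=
  BoundedContinuousFunction.ofNormedAddCommGroup (fun x : ℝ => ((x : ℂ) - z)⁻¹)
    (by
      refine Continuous.inv₀ (by fun_prop) fun x h => hz ?_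
      have := congrArg Complex.im h
      simpa using this)
    (|z.im|⁻¹)
    (by
      intro x
      rw [norm_inv]
      refine inv_anti₀ (abs_pos.mpr hz) ?_
      have := Complex.abs_im_le_norm ((x : ℂ) - z)
      simpa using this)

/-- `Φ` is the bounded continuous functional calculus `φ ↦ φ(A)` of the self-adjoint operator `A`:
a unital `*`-homomorphism from the bounded continuous functions on `ℝ` to the bounded operators
that sends `x ↦ 1 / (x - z)` to the resolvent `(A - z)⁻¹`, for every non-real `z`.
(There is at most one such `Φ`: it is determined on `C₀(ℝ)` by the Stone–Weierstrass theorem, hence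
on `φ` by `Φ φ (A - z)⁻¹ = Φ (φ · (x - z)⁻¹)`, as the range of the resolvent is dense.) -/
def IsFunctionalCalculus [CompleteSpace H] (A : H →ₗ.[ℂ] H)
    (Φ : (ℝ →ᵇ ℂ) →⋆ₐ[ℂ] (H →L[ℂ] H)) : Prop :=
  ∀ (z : ℂ) (hz : z.im ≠ 0),
    (∀ x : A.domain, Φ (resolventFun z hz) (A x - z • (x : H)) = x) ∧
    (∀ y : H, ∃ x : A.domain, (x : H) = Φ (resolventFun z hz) y ∧ A x - z • (x : H) = y)

/-- The finite measure `σ` on `ℝ` is the spectral measure of the self-adjoint operator `A` with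
respect to the vector `v`: `⟨φ(A) v, v⟩ = ∫ φ dσ` for all bounded continuous `φ`.
(Mathlib's inner product is linear in its second argument.) -/
def IsSpectralMeasure [CompleteSpace H] (A : H →ₗ.[ℂ] H) (v : H) (σ : Measure ℝ) : Prop :=
  IsFiniteMeasure σ ∧ ∃ Φ : (ℝ →ᵇ ℂ) →⋆ₐ[ℂ] (H →L[ℂ] H), IsFunctionalCalculus A Φ ∧
    ∀ φ : ℝ →ᵇ ℂ, inner ℂ v (Φ φ v) = ∫ x, φ x ∂σ

/-- `S = A ^ (1/2)`: `S` is self-adjoint, positive semi-definite and `S ∘ S = A`, as unbounded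
operators (equality of domains included). -/
def IsPosSqrt [CompleteSpace H] (S A : H →ₗ.[ℂ] H) : Prop :=
  IsSelfAdjoint S ∧ (∀ x : S.domain, 0 ≤ (inner ℂ (x : H) (S x)).re) ∧
    ∀ f w : H, (f, w) ∈ A.graph ↔ ∃ u : H, (f, u) ∈ S.graph ∧ (u, w) ∈ S.graph

end Operators

/-! ### Classes of measures

A positive measure on `ℝ₊ = (0, ∞)` is a measure on `ℝ` which does not charge `(-∞, 0]`. -/

/-- The class `𝓜`: positive measures on `(0, ∞)` whose Laplace transform is finite. -/
def classM : Set (Measure ℝ) :=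
  {μ | μ (Iic 0) = 0 ∧ ∀ t : ℝ, 0 < t → ∫⁻ x, ENNReal.ofReal (Real.exp (-t * x)) ∂μ < ⊤}

/-- Finite measures. -/
def classFinite : Set (Measure ℝ) := {μ | μ ∈ classM ∧ IsFiniteMeasure μ}

/-- Finite measures with the Carleson condition `μ((0, a)) ≤ C a` for all `a > 0`. -/
def classCarleson : Set (Measure ℝ) :=
  {μ | μ ∈ classFinite ∧ ∃ C : ℝ, ∀ a : ℝ, 0 < a → μ (Ioo 0 a) ≤ ENNReal.ofReal (C * a)}

/-- Finite measures with bounded support. -/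
def classBounded : Set (Measure ℝ) := {μ | μ ∈ classFinite ∧ Bornology.IsBounded μ.support}

/-! ### The Hankel operator `Γ_μ` -/

/-- The complex Hilbert space `L²(ℝ₊)`, `ℝ₊ = (0, ∞)`, with Lebesgue measure. -/
abbrev L2 : Type := Lp ℂ 2 (volume.restrict (Ioi (0 : ℝ)))

/-- The Laplace transform `(𝓛 f)(x) = ∫₀^∞ e^{-tx} f(t) dt` (used for `x > 0` only). -/
def laplace (f : L2) (x : ℝ) : ℂ := ∫ t in Ioi (0 : ℝ), (Real.exp (-t * x) : ℂ) * f t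

/-- The quadratic form `Q_μ[f] = ∫₀^∞ |𝓛 f(x)|² dμ(x) ∈ [0, ∞]`. -/
def Q (μ : Measure ℝ) (f : L2) : ENNReal := ∫⁻ x in Ioi (0 : ℝ), ‖laplace f x‖ₑ ^ 2 ∂μ

lemma integrable_laplace (f : L2) {x : ℝ} (hx : 0 < x) :
    Integrable (fun t => (Real.exp (-t * x) : ℂ) * f t) (volume.restrict (Ioi (0 : ℝ))) := by
  have h1 : MemLp (fun t : ℝ => (Real.exp (-t * x) : ℂ)) 2 (volume.restrict (Ioi (0 : ℝ))) := by
    rw [memLp_two_iff_integrable_sq_norm (by fun_prop)]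
    have h : IntegrableOn (fun t : ℝ => Real.exp (-(2 * x) * t)) (Ioi 0) :=
      exp_neg_integrableOn_Ioi 0 (by positivity)
    refine h.congr (Filter.Eventually.of_forall fun t => ?_)
    simp only [Complex.norm_real, Real.norm_eq_abs, sq_abs]
    rw [← Real.exp_nat_mul]
    congr 1
    push_cast
    ring
  exact h1.integrable_mul (Lp.memLp f)

lemma laplace_add (f g : L2) {x : ℝ} (hx : 0 < x) :
    laplace (f + g) x = laplace f x + laplace g x := by
  unfold laplace
  rw [← integral_add (integrable_laplace f hx) (integrable_laplace g hx)]
  refine integral_congr_ae ?_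
  filter_upwards [Lp.coeFn_add f g] with t ht
  rw [ht, Pi.add_apply, mul_add]

lemma laplace_smul (c : ℂ) (f : L2) (x : ℝ) : laplace (c • f) x = c * laplace f x := by
  unfold laplace
  rw [← integral_const_mul]
  refine integral_congr_ae ?_
  filter_upwards [Lp.coeFn_smul c f] with t ht
  rw [ht, Pi.smul_apply, smul_eq_mul]
  ring

lemma stronglyMeasurable_laplace (f : L2) : StronglyMeasurable (laplace f) := by
  unfold laplace
  refine StronglyMeasurable.integral_prod_right
    (f := fun x t : ℝ => (Real.exp (-t * x) : ℂ) * f t) ?_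
  refine StronglyMeasurable.mul ?_ ((Lp.stronglyMeasurable f).comp_measurable measurable_snd)
  exact Continuous.stronglyMeasurable (by fun_prop)

lemma Q_lt_top_iff (μ : Measure ℝ) (f : L2) :
    Q μ f < ⊤ ↔ MemLp (laplace f) 2 (μ.restrict (Ioi 0)) := by
  have hm : AEStronglyMeasurable (laplace f) (μ.restrict (Ioi 0)) :=
    (stronglyMeasurable_laplace f).aestronglyMeasurable
  rw [MemLp, and_iff_right hm,
    eLpNorm_lt_top_iff_lintegral_rpow_enorm_lt_top (by norm_num) (by norm_num)]
  simp [Q]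

/-- The form domain `Dom Q_μ = {f ∈ L² : Q_μ[f] < ⊤}`. -/
def formDomain (μ : Measure ℝ) : Submodule ℂ L2 where
  carrier := {f | Q μ f < ⊤}
  zero_mem' := by
    have h : laplace 0 = 0 := by
      funext x
      simpa using laplace_smul 0 0 x
    simp [Q, h]
  add_mem' := by
    intro f g hf hg
    simp only [mem_ofPred_eq, Q_lt_top_iff] at *
    refine (hf.add hg).ae_eq ?_
    filter_upwards [ae_restrict_mem measurableSet_Ioi] with x hx
    exact (laplace_add f g hx).symm
  smul_mem' := by
    intro c f hf
    simp only [mem_ofPred_eq, Q_lt_top_iff] at *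
    refine (hf.const_smul c).ae_eq (Filter.Eventually.of_forall fun x => ?_)
    simp [laplace_smul]

/-- The sesquilinear form `Q_μ[f, g] = ∫₀^∞ 𝓛 f(x) conj(𝓛 g(x)) dμ(x)`, for `f, g ∈ Dom Q_μ`. -/
def formPairing (μ : Measure ℝ) (f g : L2) : ℂ :=
  ∫ x in Ioi (0 : ℝ), laplace f x * conj (laplace g x) ∂μ

lemma integrable_formPairing {μ : Measure ℝ} {f g : L2} (hf : f ∈ formDomain μ)
    (hg : g ∈ formDomain μ) :
    Integrable (fun x => laplace f x * conj (laplace g x)) (μ.restrict (Ioi 0)) :=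
  MemLp.integrable_mul ((Q_lt_top_iff μ f).1 hf) ((Q_lt_top_iff μ g).1 hg).star

/-- The graph of the operator of the closed form `Q_μ`: the pairs `(f, w)` with `f ∈ Dom Q_μ` and
`Q_μ[f, g] = ⟨w, g⟩` for all `g ∈ Dom Q_μ`. -/
def hankelGraph (μ : Measure ℝ) : Submodule ℂ (L2 × L2) where
  carrier := {p | p.1 ∈ formDomain μ ∧
    ∀ g ∈ formDomain μ, formPairing μ p.1 g = inner ℂ g p.2}
  zero_mem' := by
    refine ⟨(formDomain μ).zero_mem, fun g _ => ?_⟩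
    have h : ∀ x, laplace 0 x = 0 := fun x => by simpa using laplace_smul 0 0 x
    simp [formPairing, h]
  add_mem' := by
    rintro ⟨f, w⟩ ⟨f', w'⟩ ⟨hf, h⟩ ⟨hf', h'⟩
    refine ⟨(formDomain μ).add_mem hf hf', fun g hg => ?_⟩
    simp only [Prod.mk_add_mk, inner_add_right]
    rw [← h g hg, ← h' g hg]
    simp only [formPairing]
    rw [← integral_add (integrable_formPairing hf hg) (integrable_formPairing hf' hg)]
    refine setIntegral_congr_fun measurableSet_Ioi fun x hx => ?_
    simp only [laplace_add f f' hx]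
    ring
  smul_mem' := by
    rintro c ⟨f, w⟩ ⟨hf, h⟩
    refine ⟨(formDomain μ).smul_mem c hf, fun g hg => ?_⟩
    simp only [Prod.smul_mk, inner_smul_right]
    rw [← h g hg]
    simp only [formPairing, laplace_smul]
    rw [← integral_const_mul]
    simp only [mul_assoc]

/-- The Hankel operator `Γ_μ`: the self-adjoint operator in `L²(ℝ₊)` of the closed form `Q_μ`. -/
def hankelOp (μ : Measure ℝ) : L2 →ₗ.[ℂ] L2 := (hankelGraph μ).toLinearPMap

/-! ### The distinguished cyclic element and the spectral map -/

/-- `C^∞_comp(ℝ₊)` in `L²(ℝ₊)`: classes of smooth functions with compact support in `(0, ∞)`. -/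
def testFunctions : Set L2 :=
  {G | ∃ g : ℝ → ℂ, ContDiff ℝ ∞ g ∧ HasCompactSupport g ∧ tsupport g ⊆ Ioi 0 ∧
    G =ᵐ[volume.restrict (Ioi 0)] g}

/-- The kernel function `h_μ(t) = ∫₀^∞ e^{-tx} dμ(x)`. -/
def kernelFun (μ : Measure ℝ) (t : ℝ) : ℝ := ∫ x in Ioi (0 : ℝ), Real.exp (-t * x) ∂μ

/-- `v` is the element `v_μ`: it lies in the closure of `Ran Γ_μ`, and
`⟨v, Γ_μ^{1/2} g⟩ = ∫₀^∞ h_μ(t) conj(g(t)) dt` for every `g ∈ C^∞_comp(ℝ₊)`. -/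
def IsDistinguished (μ : Measure ℝ) (v : L2) : Prop :=
  v ∈ closure (range (hankelOp μ)) ∧
    ∃ S : L2 →ₗ.[ℂ] L2, IsPosSqrt S (hankelOp μ) ∧
      ∀ g ∈ testFunctions, ∃ hg : g ∈ S.domain,
        inner ℂ (S ⟨g, hg⟩) v = ∫ t in Ioi (0 : ℝ), (kernelFun μ t : ℂ) * conj (g t)

/-- `σ` is the spectral measure of `Γ_μ` with respect to `v_μ`. -/
def IsSpectralImage (μ σ : Measure ℝ) : Prop :=
  ∃ v : L2, IsDistinguished μ v ∧ IsSpectralMeasure (hankelOp μ) v σ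

open Classical in
/-- The spectral map `Ω : μ ↦ σ`, where `σ` is the spectral measure of `Γ_μ` with respect to `v_μ`
(with the value `0` where there is no such measure). -/
def spectralMap (μ : Measure ℝ) : Measure ℝ :=
  if h : ∃ σ, IsSpectralImage μ σ then h.choose else 0

end

end Hankel

/-!
Let `L` be the Laplace transform, as a closed operator from `L²(ℝ₊)` to `L²(μ)`, so that
`Γ_μ = L* L`. Its polar decomposition gives an isometry `V : L²(μ) → L²(ℝ₊)` with
`V L = Γ_μ^(1/2)`, whose range is the closure of `Ran Γ_μ`; the element `v_μ` is `V 1`, and `V*`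
carries the spectral data of `(Γ_μ, v_μ)` to those of `(L L*, 1)` in `L²(μ)`. The operator
`G = L L*` has the kernel `1 / (x + y)`, because `𝓛` maps `t ↦ e^{-ty}` to `x ↦ 1 / (x + y)`.
Everything is read off from this picture.

*Well-definedness.* `exists_polar` builds the bounded continuous functional calculus `Φ` of `L* L`
from the closed graph of `L` alone, and with it `L (1 + Γ)^(-1/2)` and `V`; the calculus is obtained
from that of the bounded operator `(1 + L* L)⁻¹`. The positive square root is unique
(`IsPositiveCalculus.eq_sqrtOp`), which identifies `v_μ` (`IsModel.isDistinguished_iff`), and the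
spectral measure exists by the Riesz–Markov theorem and is determined by the resolvent
(`IsPositiveCalculus.exists_measure`, `measure_ext_of_resolvent`). It has no mass at `0` since `v_μ`
lies in the closure of the range.

*Carleson condition and bounded support.* If `μ` is Carleson then `L` is bounded, by a Schur test
(`lintegral_enorm_laplace_sq_le`), hence so is `Γ_μ`. Conversely, if `Ω(μ)` is carried by `[0, M]`,
then `⟨e^{-ty}, Γ^(n + 1/2) v_μ⟩` is `O(Mⁿ)`, while by positivity of the kernel it is at least a
constant times `(μ((0, a)) / (2 a))ⁿ`; so `μ((0, a)) ≤ 2 M a`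
(`IsModel.carleson_of_measure_Ioi`).

*Involution.* Let `μ` be Carleson with bounded support, `σ = Ω(μ)`, and let `X` be multiplication by
the independent variable. On `L²(μ)` the Lyapunov equation `X G + G X = ⟨1, ·⟩ 1` holds
(`IsCarleman.lyapunov`), and the spectral theorem gives an isometry `W : L²(σ) → L²(μ)` with
`W 1 = 1` and `G W = W X_σ` (`exists_transform`). Testing the Lyapunov equation on `W φ` with `φ` a
cutoff near `0` shows that `σ` is Carleson. Therefore `L²(σ)` carries the operator `G_σ` of kernel
`1 / (x + y)`, which satisfies the same equation with `X_σ`; comparing the two equations,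
`Y = X W - W G_σ` satisfies `G Y + Y X_σ = 0`, and this forces `Y = 0` because `G ≥ 0` and `X_σ ≥ 0`
is injective (`eq_zero_of_sylvester`). So `W` exchanges the roles of `X` and `G`, and its composite
with the transform of `σ` is an isometry from `L²(Ω(σ))` to `L²(μ)` which fixes `1` and intertwines
the multiplications by the independent variable; hence `Ω(σ) = μ`.
-/

namespace Hankel

noncomputable section

/-! ### The functional calculus of `A` from that of `(1 + A)⁻¹` -/

section Calculus

variable {H : Type*} [NormedAddCommGroup H] [InnerProductSpace ℂ H] [CompleteSpace H]

/-- The continuous functional calculus of `0 ≤ B ≤ 1`, with functions on `[0, 1]` rather than on the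
spectrum of `B`. -/
lemma exists_calculus_Icc (B : H →L[ℂ] H) (h0 : 0 ≤ B) (h1 : B ≤ 1) :
    ∃ Ψ : C(Icc (0 : ℝ) 1, ℂ) →⋆ₐ[ℂ] (H →L[ℂ] H),
      Ψ ⟨fun b => ((b : ℝ) : ℂ), by fun_prop⟩ = B := by
  have hsa : IsSelfAdjoint B := .of_nonneg h0
  have hn : IsStarNormal B := hsa.isStarNormal
  have hspec : ∀ z ∈ spectrum ℂ B, z.re ∈ Icc (0 : ℝ) 1 ∧ z = (z.re : ℂ) := by
    intro z hz
    have hz' := hsa.mem_spectrum_eq_re hz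
    refine ⟨?_, by simpa using hz'⟩
    have hr : z.re ∈ spectrum ℝ B := by
      rw [← spectrum.algebraMap_mem_iff ℂ]
      simpa [← hz'] using hz
    constructor
    · exact spectrum_nonneg_of_nonneg h0 hr
    · rw [← map_one (algebraMap ℝ (H →L[ℂ] H)), le_algebraMap_iff_spectrum_le (a := B) hsa] at h1
      exact h1 _ hr
  let ρ : C(spectrum ℂ B, Icc (0 : ℝ) 1) :=
    ⟨fun z => ⟨(z : ℂ).re, (hspec z z.2).1⟩, by fun_prop⟩
  refine ⟨(cfcHom hn).comp (ρ.compStarAlgHom' ℂ ℂ), ?_⟩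
  have : ρ.compStarAlgHom' ℂ ℂ ⟨fun b => ((b : ℝ) : ℂ), by fun_prop⟩
      = (ContinuousMap.id ℂ).restrict (spectrum ℂ B) := by
    ext z
    exact ((hspec z z.2).2).symm
  rw [StarAlgHom.comp_apply, this, cfcHom_id]

/-- A `*`-homomorphism from continuous functions to operators respects pointwise domination. -/
lemma norm_apply_le_of_norm_le {X : Type*} [TopologicalSpace X]
    (Ψ : C(X, ℂ) →⋆ₐ[ℂ] (H →L[ℂ] H)) {f g : C(X, ℂ)}
    (h : ∀ x, ‖f x‖ ≤ ‖g x‖) (y : H) : ‖Ψ f y‖ ≤ ‖Ψ g y‖ := by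
  let r : C(X, ℂ) := ⟨fun x => ((Real.sqrt (‖g x‖ ^ 2 - ‖f x‖ ^ 2) : ℝ) : ℂ), by fun_prop⟩
  have key : star g * g = star f * f + star r * r := by
    ext x
    have hx : 0 ≤ ‖g x‖ ^ 2 - ‖f x‖ ^ 2 := by
      have := h x
      have := norm_nonneg (f x)
      nlinarith
    have e : ∀ z : ℂ, star z * z = ((‖z‖ ^ 2 : ℝ) : ℂ) := fun z => by
      simpa using Complex.conj_mul' z
    simp only [ContinuousMap.mul_apply, ContinuousMap.star_apply, ContinuousMap.add_apply, e]
    rw [← Complex.ofReal_add]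
    congr 1
    simp only [r, ContinuousMap.coe_mk, Complex.norm_real, Real.norm_eq_abs, sq_abs,
      Real.sq_sqrt hx]
    ring
  have hn : ∀ k : C(X, ℂ), ‖Ψ k y‖ ^ 2 = (inner ℂ y (Ψ (star k * k) y)).re := by
    intro k
    rw [map_mul, map_star, ContinuousLinearMap.star_eq_adjoint]
    simp only [mul_apply_eq_comp, ContinuousLinearMap.adjoint_inner_right]
    rw [← inner_self_eq_norm_sq (𝕜 := ℂ)]
    rfl
  have : ‖Ψ g y‖ ^ 2 = ‖Ψ f y‖ ^ 2 + ‖Ψ r y‖ ^ 2 := by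
    rw [hn g, key, map_add, add_apply, inner_add_right, Complex.add_re,
      hn f, hn r]
  refine le_of_sq_le_sq ?_ (norm_nonneg _)
  nlinarith [sq_nonneg ‖Ψ r y‖]

/-- The function `b ↦ b φ(1/b - 1)` on `[0, 1]`, with value `0` at `b = 0`. If `B = (1 + A)⁻¹`, its
value at `B` is `φ(A) B`; the factor `b` makes it continuous at `0`. -/
def compressedFun (φ : ℝ →ᵇ ℂ) : C(Icc (0 : ℝ) 1, ℂ) where
  toFun b := ((b : ℝ) : ℂ) * φ ((b : ℝ)⁻¹ - 1)
  continuous_toFun := by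
    rw [continuous_iff_continuousAt]
    intro b
    by_cases hb : (b : ℝ) = 0
    · have h0 : ((b : ℝ) : ℂ) * φ ((b : ℝ)⁻¹ - 1) = 0 := by simp [hb]
      rw [ContinuousAt, h0]
      have h1 : Filter.Tendsto (fun b : Icc (0 : ℝ) 1 => (b : ℝ) * ‖φ‖) (nhds b) (nhds 0) := by
        have : Continuous (fun b : Icc (0 : ℝ) 1 => (b : ℝ) * ‖φ‖) := by fun_prop
        simpa [hb] using this.tendsto b
      refine squeeze_zero_norm (fun t => ?_) h1
      rw [norm_mul, Complex.norm_real, Real.norm_eq_abs, abs_of_nonneg t.2.1]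
      exact mul_le_mul_of_nonneg_left (φ.norm_coe_le_norm _) t.2.1
    · refine ContinuousAt.mul (by fun_prop) (φ.continuous.continuousAt.comp ?_)
      exact (continuous_subtype_val.continuousAt.inv₀ hb).sub continuousAt_const

lemma compressedFun_apply (φ : ℝ →ᵇ ℂ) (b : Icc (0 : ℝ) 1) :
    compressedFun φ b = ((b : ℝ) : ℂ) * φ ((b : ℝ)⁻¹ - 1) := rfl

/-- A bounded continuous real function, as an element of `ℝ →ᵇ ℂ`. -/
def realBCF (f : ℝ → ℝ) (hf : Continuous f) (C : ℝ) (hC : ∀ s, |f s| ≤ C) : ℝ →ᵇ ℂ :=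
  BoundedContinuousFunction.ofNormedAddCommGroup (fun s => (f s : ℂ))
    (Complex.continuous_ofReal.comp hf) C (by simpa using hC)

@[simp]
lemma realBCF_apply (f : ℝ → ℝ) (hf : Continuous f) (C : ℝ) (hC : ∀ s, |f s| ≤ C) (s : ℝ) :
    realBCF f hf C hC s = (f s : ℂ) := rfl

@[simp]
lemma star_realBCF (f : ℝ → ℝ) (hf : Continuous f) (C : ℝ) (hC : ∀ s, |f s| ≤ C) :
    star (realBCF f hf C hC) = realBCF f hf C hC := by
  ext s
  simp

/-- The real function `s ↦ 1 / (1 + s)` on `[0, ∞)`, extended by `1` to negative `s`. -/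
def beta (s : ℝ) : ℝ := (1 + max s 0)⁻¹

lemma continuous_beta : Continuous beta :=
  Continuous.inv₀ (by fun_prop) fun s => by positivity

lemma beta_pos (s : ℝ) : 0 < beta s := by
  unfold beta
  positivity

lemma beta_le_one (s : ℝ) : beta s ≤ 1 :=
  inv_le_one_of_one_le₀ (by linarith [le_max_right s 0])

lemma beta_mul {s : ℝ} (hs : 0 ≤ s) : beta s * (1 + s) = 1 := by
  rw [beta, max_eq_left hs]
  exact inv_mul_cancel₀ (by positivity)

/-- The function `beta` as an element of `ℝ →ᵇ ℂ`: the functional calculus sends it to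
`(1 + A)⁻¹`. -/
def betaFun : ℝ →ᵇ ℂ :=
  realBCF beta continuous_beta 1 fun s => by
    rw [abs_of_pos (beta_pos s)]
    exact beta_le_one s

@[simp]
lemma betaFun_apply (s : ℝ) : betaFun s = (beta s : ℂ) := rfl

/-- A positive contraction `B` with dense range is `(1 + A)⁻¹` for a positive self-adjoint `A`, and
the bounded continuous functional calculus of `A` can be built from that of `B`: the operator
`φ(A)` is the bounded extension of `B y ↦ (φ(A) B) y` from the dense range of `B`. -/
theorem exists_calculus (B : H →L[ℂ] H) (h0 : 0 ≤ B) (h1 : B ≤ 1) (hd : DenseRange B) :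
    ∃ Φ : (ℝ →ᵇ ℂ) →⋆ₐ[ℂ] (H →L[ℂ] H), Φ betaFun = B ∧
      ∀ φ : ℝ →ᵇ ℂ, (∀ s, 0 ≤ s → φ s = 0) → Φ φ = 0 := by
  obtain ⟨Ψ, hΨ⟩ := exists_calculus_Icc B h0 h1
  set ι : C(Icc (0 : ℝ) 1, ℂ) := ⟨fun b => ((b : ℝ) : ℂ), by fun_prop⟩ with hι
  have hιa : ∀ b : Icc (0 : ℝ) 1, ι b = ((b : ℝ) : ℂ) := fun b => rfl
  have hd' : DenseRange (B : H →ₗ[ℂ] H) := hd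
  have hbound : ∀ (φ : ℝ →ᵇ ℂ) (y : H),
      ‖(Ψ (compressedFun φ) : H →ₗ[ℂ] H) y‖ ≤ ‖φ‖ * ‖(B : H →ₗ[ℂ] H) y‖ := by
    intro φ y
    have := norm_apply_le_of_norm_le Ψ (f := compressedFun φ) (g := (‖φ‖ : ℂ) • ι) (fun b => by
      rw [compressedFun_apply, ContinuousMap.smul_apply, hιa, norm_smul, norm_mul, mul_comm]
      refine mul_le_mul_of_nonneg_right ?_ (norm_nonneg _)
      simpa using φ.norm_coe_le_norm _) y
    rw [map_smul, hΨ] at this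
    simpa [norm_smul] using this
  let Φ₀ : (ℝ →ᵇ ℂ) → (H →L[ℂ] H) := fun φ =>
    (Ψ (compressedFun φ) : H →ₗ[ℂ] H).extendOfNorm (B : H →ₗ[ℂ] H)
  have hΦ : ∀ φ, Φ₀ φ * B = Ψ (compressedFun φ) := fun φ => by
    ext y
    exact LinearMap.extendOfNorm_eq hd' ⟨_, hbound φ⟩ y
  have huniq : ∀ Z W : H →L[ℂ] H, Z * B = W * B → Z = W := by
    intro Z W h
    refine ContinuousLinearMap.coeFn_injective (hd.equalizer Z.continuous W.continuous ?_)
    funext y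
    exact DFunLike.congr_fun h y
  have hcomm : ∀ f, Ψ f * B = B * Ψ f := fun f => by
    rw [← hΨ, ← map_mul, ← map_mul, mul_comm]
  have hone : Φ₀ 1 = 1 := by
    apply huniq
    rw [hΦ, one_mul, ← hΨ]
    congr 1
    ext b
    simp [compressedFun_apply, hιa]
  have hadd : ∀ φ χ, Φ₀ (φ + χ) = Φ₀ φ + Φ₀ χ := by
    intro φ χ
    apply huniq
    rw [hΦ, add_mul, hΦ, hΦ, ← map_add]
    congr 1
    ext b
    simp [compressedFun_apply, mul_add]
  have hsmul : ∀ (c : ℂ) φ, Φ₀ (c • φ) = c • Φ₀ φ := by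
    intro c φ
    apply huniq
    rw [hΦ, smul_mul_assoc, hΦ, ← map_smul]
    congr 1
    ext b
    simp [compressedFun_apply, mul_left_comm]
  have hmul : ∀ φ χ, Φ₀ (φ * χ) = Φ₀ φ * Φ₀ χ := by
    intro φ χ
    apply huniq
    apply huniq
    rw [hΦ (φ * χ), mul_assoc (Φ₀ φ), hΦ χ, mul_assoc (Φ₀ φ), hcomm (compressedFun χ),
      ← mul_assoc, hΦ φ, ← hΨ, ← map_mul, ← map_mul]
    congr 1
    ext b
    simp only [ContinuousMap.mul_apply, compressedFun_apply, hιa,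
      BoundedContinuousFunction.mul_apply]
    ring
  have hBsa : star B = B := (IsSelfAdjoint.of_nonneg h0).star_eq
  have hstar : ∀ φ, Φ₀ (star φ) = star (Φ₀ φ) := by
    intro φ
    apply huniq
    -- `B` commutes with the calculus, so both sides agree after multiplication by `B` on both sides
    have : B * (Φ₀ (star φ) * B) = B * (star (Φ₀ φ) * B) := by
      rw [← mul_assoc B (star (Φ₀ φ)), hΦ, ← hcomm]
      nth_rewrite 2 [← hBsa]
      rw [← star_mul, hΦ, ← map_star]
      congr 2
      ext b
      simp [compressedFun_apply]
    have h2 := congrArg star this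
    rw [star_mul, star_mul B, hBsa] at h2
    exact star_injective (huniq _ _ h2)
  have hzero : ∀ φ : ℝ →ᵇ ℂ, (∀ s, 0 ≤ s → φ s = 0) → Φ₀ φ = 0 := by
    intro φ h
    apply huniq
    rw [hΦ, zero_mul, ← map_zero Ψ]
    congr 1
    ext b
    rw [compressedFun_apply]
    rcases eq_or_lt_of_le b.2.1 with hb | hb
    · simp [← hb]
    · rw [h _ (sub_nonneg.2 (one_le_inv_iff₀.2 ⟨hb, b.2.2⟩))]
      simp
  refine ⟨{ toFun := Φ₀, map_one' := hone, map_mul' := hmul, map_zero' := hzero 0 (by simp),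
            map_add' := hadd, commutes' := fun c => ?_, map_star' := hstar }, ?_, hzero⟩
  · rw [Algebra.algebraMap_eq_smul_one, hsmul, hone, Algebra.algebraMap_eq_smul_one]
  · change Φ₀ betaFun = B
    apply huniq
    rw [hΦ, ← hΨ, ← map_mul]
    congr 1
    ext b
    rw [compressedFun_apply, ContinuousMap.mul_apply, hιa, betaFun_apply, beta]
    rcases eq_or_lt_of_le b.2.1 with hb | hb
    · simp [← hb]
    · rw [max_eq_left (sub_nonneg.2 (one_le_inv_iff₀.2 ⟨hb, b.2.2⟩))]
      simp

end Calculus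

/-! ### Functional calculi of positive operators, and uniqueness -/

section PositiveCalculus

variable {H : Type*} [NormedAddCommGroup H] [InnerProductSpace ℂ H] [CompleteSpace H]

/-- `Φ` is the bounded continuous functional calculus of a positive self-adjoint operator `A`,
described without reference to `A`: it depends only on the values on `[0, ∞)`, and
`(1 + A)⁻¹ = Φ betaFun` has dense range. -/
structure IsPositiveCalculus (Φ : (ℝ →ᵇ ℂ) →⋆ₐ[ℂ] (H →L[ℂ] H)) : Prop where
  dense : DenseRange (Φ betaFun)
  vanish : ∀ φ : ℝ →ᵇ ℂ, (∀ s, 0 ≤ s → φ s = 0) → Φ φ = 0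

/-- `s ↦ (1 + s)^(-1/2)` on `[0, ∞)`, extended by `1` to negative `s`. -/
def cFun : ℝ →ᵇ ℂ :=
  realBCF (fun s => √(beta s)) continuous_beta.sqrt 1 fun s => by
    rw [abs_of_nonneg (Real.sqrt_nonneg _)]
    exact Real.sqrt_le_one.2 (beta_le_one s)

/-- `s ↦ (s / (1 + s))^(1/2)` on `[0, ∞)`, extended by `0` to negative `s`. -/
def dFun : ℝ →ᵇ ℂ :=
  realBCF (fun s => √(1 - beta s)) (continuous_const.sub continuous_beta).sqrt 1 fun s => by
    rw [abs_of_nonneg (Real.sqrt_nonneg _)]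
    exact Real.sqrt_le_one.2 (by linarith [beta_pos s])

@[simp] lemma cFun_apply (s : ℝ) : cFun s = (√(beta s) : ℂ) := rfl

@[simp] lemma dFun_apply (s : ℝ) : dFun s = (√(1 - beta s) : ℂ) := rfl

lemma cFun_mul_cFun : cFun * cFun = betaFun := by
  ext s
  simp only [BoundedContinuousFunction.mul_apply, cFun_apply, betaFun_apply]
  rw [← Complex.ofReal_mul, Real.mul_self_sqrt (beta_pos s).le]

lemma dFun_mul_dFun : dFun * dFun = 1 - betaFun := by
  ext s
  simp only [BoundedContinuousFunction.mul_apply, dFun_apply, betaFun_apply,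
    BoundedContinuousFunction.sub_apply, BoundedContinuousFunction.coe_one, Pi.one_apply]
  rw [← Complex.ofReal_mul, Real.mul_self_sqrt (by linarith [beta_le_one s])]
  push_cast
  ring

variable {Φ : (ℝ →ᵇ ℂ) →⋆ₐ[ℂ] (H →L[ℂ] H)}

lemma calculus_comm (Φ : (ℝ →ᵇ ℂ) →⋆ₐ[ℂ] (H →L[ℂ] H)) (φ χ : ℝ →ᵇ ℂ) (y : H) :
    Φ φ (Φ χ y) = Φ χ (Φ φ y) := by
  rw [← mul_apply_eq_comp, ← mul_apply_eq_comp, ← map_mul, ← map_mul, mul_comm]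

lemma calculus_mul (Φ : (ℝ →ᵇ ℂ) →⋆ₐ[ℂ] (H →L[ℂ] H)) (φ χ : ℝ →ᵇ ℂ) (y : H) :
    Φ φ (Φ χ y) = Φ (φ * χ) y := by
  rw [← mul_apply_eq_comp, ← map_mul]

lemma inner_calculus_left (Φ : (ℝ →ᵇ ℂ) →⋆ₐ[ℂ] (H →L[ℂ] H)) (φ : ℝ →ᵇ ℂ) (x y : H) :
    inner ℂ (Φ φ x) y = inner ℂ x (Φ (star φ) y) := by
  rw [map_star, ContinuousLinearMap.star_eq_adjoint, ContinuousLinearMap.adjoint_inner_right]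

lemma star_betaFun : star betaFun = betaFun := star_realBCF _ _ _ _

lemma star_cFun : star cFun = cFun := star_realBCF _ _ _ _

lemma star_dFun : star dFun = dFun := star_realBCF _ _ _ _

lemma calculus_nonneg (Φ : (ℝ →ᵇ ℂ) →⋆ₐ[ℂ] (H →L[ℂ] H)) {f : ℝ → ℝ}
    (hf : Continuous f) {C : ℝ} (hC : ∀ s, |f s| ≤ C) (h0 : ∀ s, 0 ≤ f s) :
    0 ≤ Φ (realBCF f hf C hC) := by
  let g : ℝ →ᵇ ℂ := realBCF (fun s => √(f s)) hf.sqrt √C fun s => by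
    rw [abs_of_nonneg (Real.sqrt_nonneg _)]
    exact Real.sqrt_le_sqrt ((le_abs_self _).trans (hC s))
  have : realBCF f hf C hC = star g * g := by
    ext s
    simp only [star_realBCF, realBCF_apply, g, BoundedContinuousFunction.mul_apply]
    rw [← Complex.ofReal_mul, Real.mul_self_sqrt (h0 s)]
  rw [this, map_mul, map_star]
  exact star_mul_self_nonneg _

lemma cFun_cFun_apply (y : H) : Φ cFun (Φ cFun y) = Φ betaFun y := by
  rw [calculus_mul, cFun_mul_cFun]

lemma dFun_dFun_apply (y : H) : Φ dFun (Φ dFun y) = y - Φ betaFun y := by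
  rw [calculus_mul, dFun_mul_dFun, map_sub, map_one]
  rfl

lemma norm_cFun_sq_add_norm_dFun_sq (y : H) :
    ‖Φ cFun y‖ ^ 2 + ‖Φ dFun y‖ ^ 2 = ‖y‖ ^ 2 := by
  have h : ∀ z : H, ‖z‖ ^ 2 = (inner ℂ z z).re := fun z =>
    (inner_self_eq_norm_sq (𝕜 := ℂ) z).symm
  rw [h, h, h, inner_calculus_left, inner_calculus_left, star_cFun, star_dFun,
    cFun_cFun_apply, dFun_dFun_apply, inner_sub_right, Complex.sub_re]
  ring

namespace IsPositiveCalculus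

lemma congr (hΦ : IsPositiveCalculus Φ) {φ χ : ℝ →ᵇ ℂ} (h : ∀ s, 0 ≤ s → φ s = χ s) :
    Φ φ = Φ χ := by
  rw [← sub_eq_zero, ← map_sub]
  exact hΦ.vanish _ fun s hs => by simp [h s hs]

lemma eq_zero_of_betaFun (hΦ : IsPositiveCalculus Φ) {y : H} (h : Φ betaFun y = 0) : y = 0 := by
  refine hΦ.dense.eq_zero_of_inner_left ℂ fun z => ?_
  rw [← inner_conj_symm, inner_calculus_left, star_betaFun, h]
  simp

lemma betaFun_injective (hΦ : IsPositiveCalculus Φ) : Function.Injective (Φ betaFun) :=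
  (injective_iff_map_eq_zero _).2 fun _ => hΦ.eq_zero_of_betaFun

lemma cFun_injective (hΦ : IsPositiveCalculus Φ) : Function.Injective (Φ cFun) :=
  (injective_iff_map_eq_zero _).2 fun y hy => hΦ.eq_zero_of_betaFun <| by
    rw [← cFun_cFun_apply, hy, map_zero]

lemma denseRange_cFun (hΦ : IsPositiveCalculus Φ) : DenseRange (Φ cFun) :=
  hΦ.dense.mono (by
    rintro _ ⟨y, rfl⟩
    exact ⟨Φ cFun y, cFun_cFun_apply y⟩)

/-- If `w = A f` then `(Φ (1 / (x - z))) (w - z f) = f`, and the range of `Φ (1 / (x - z))` is the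
domain of `A`. -/
theorem isFunctionalCalculus (hΦ : IsPositiveCalculus Φ) (A : H →ₗ.[ℂ] H)
    (hA : ∀ f w : H, (f, w) ∈ A.graph ↔ f = Φ betaFun (f + w)) : IsFunctionalCalculus A Φ := by
  intro z hz
  have hne : ∀ s : ℝ, (s : ℂ) - z ≠ 0 := fun s h => hz (by simpa using congrArg Complex.im h)
  have happ : ∀ s : ℝ, resolventFun z hz s = ((s : ℂ) - z)⁻¹ := fun s => rfl
  have key : Φ (resolventFun z hz) = Φ (betaFun * (1 + (1 + z) • resolventFun z hz)) := by
    apply hΦ.congr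
    intro s hs
    have h1 : (beta s : ℂ) * (1 + s) = 1 := by exact_mod_cast beta_mul hs
    simp only [BoundedContinuousFunction.mul_apply, BoundedContinuousFunction.add_apply,
      BoundedContinuousFunction.coe_one, Pi.one_apply, BoundedContinuousFunction.smul_apply, happ,
      betaFun_apply, smul_eq_mul]
    field_simp [hne s]
    linear_combination -h1
  have key' : ∀ y, Φ (resolventFun z hz) y = Φ betaFun (y + (1 + z) • Φ (resolventFun z hz) y) := by
    intro y
    nth_rewrite 1 [key]
    simp only [map_mul, map_add, map_one, map_smul, mul_apply_eq_comp, add_apply,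
      one_apply_eq_self, smul_apply]
  constructor
  · intro x
    have hx := (hA x (A x)).1 (A.mem_graph x)
    -- `A x - z x = (x + A x) - (1 + z) x`, and `x = (1 + A)⁻¹ (x + A x)`
    have e : A x - z • (x : H) = ((x : H) + A x) - (1 + z) • (x : H) := by
      rw [add_smul, one_smul]
      abel
    have h2 := key' ((x : H) + A x)
    rw [map_add (Φ betaFun), ← hx, map_smul (Φ betaFun), calculus_comm, ← hx] at h2
    rw [e, map_sub, map_smul, h2]
    abel
  · intro y
    set x := Φ (resolventFun z hz) y with hxdef
    have hg : (x, y + z • x) ∈ A.graph := by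
      rw [hA, hxdef]
      nth_rewrite 1 [key' y]
      congr 1
      rw [← hxdef, add_smul, one_smul]
      abel
    obtain ⟨x', h1, h2⟩ := (LinearPMap.mem_graph_iff A).1 hg
    refine ⟨x', h1, ?_⟩
    simp only at h1 h2
    rw [h1, h2]
    abel

end IsPositiveCalculus

/-- Two functional calculi of the same operator agree on the algebra generated by the resolvent
functions. -/
lemma IsFunctionalCalculus.eqOn_adjoin {A : H →ₗ.[ℂ] H} {Φ Φ' : (ℝ →ᵇ ℂ) →⋆ₐ[ℂ] (H →L[ℂ] H)}
    (h : IsFunctionalCalculus A Φ) (h' : IsFunctionalCalculus A Φ') {φ : ℝ →ᵇ ℂ}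
    (hφ : φ ∈ Algebra.adjoin ℂ {φ | ∃ z hz, φ = resolventFun z hz}) : Φ φ = Φ' φ := by
  induction hφ using Algebra.adjoin_induction with
  | mem φ hφ =>
    obtain ⟨z, hz, rfl⟩ := hφ
    ext y
    obtain ⟨x, hx, hxy⟩ := (h z hz).2 y
    rw [← hx, ← hxy, (h' z hz).1 x]
  | algebraMap r => rw [AlgHomClass.commutes Φ, AlgHomClass.commutes Φ']
  | add φ χ _ _ h1 h2 => rw [map_add, map_add, h1, h2]
  | mul φ χ _ _ h1 h2 => rw [map_mul, map_mul, h1, h2]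

/-- Finite measures are determined by the integrals of the functions in the algebra generated by
the resolvent functions `x ↦ 1 / (x - z)`. -/
lemma measure_ext_of_resolvent {σ τ : Measure ℝ} [IsFiniteMeasure σ] [IsFiniteMeasure τ]
    (h : ∀ φ ∈ Algebra.adjoin ℂ {φ | ∃ z hz, φ = resolventFun z hz},
      ∫ x, φ x ∂σ = ∫ x, φ x ∂τ) : σ = τ := by
  have hstar : ∀ φ ∈ StarAlgebra.adjoin ℂ {φ : ℝ →ᵇ ℂ | ∃ z hz, φ = resolventFun z hz},
      φ ∈ Algebra.adjoin ℂ {φ : ℝ →ᵇ ℂ | ∃ z hz, φ = resolventFun z hz} := by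
    intro φ hφ
    rw [← StarSubalgebra.mem_toSubalgebra, StarAlgebra.adjoin_toSubalgebra] at hφ
    refine Algebra.adjoin_le (Set.union_subset Algebra.subset_adjoin ?_) hφ
    rintro χ ⟨z, hz, h⟩
    refine Algebra.subset_adjoin ⟨conj z, by simpa using hz, ?_⟩
    rw [← star_star χ, h]
    ext s
    simp [resolventFun]
  refine ext_of_forall_mem_subalgebra_integral_eq_of_pseudoEMetric_complete_countable (𝕜 := ℂ)
    (A := StarAlgebra.adjoin ℂ {φ | ∃ z hz, φ = resolventFun z hz}) ?_
    (fun φ hφ => h φ (hstar φ hφ))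
  intro x y hxy
  have hI : (Complex.I).im ≠ 0 := by simp
  refine ⟨_, ⟨(resolventFun Complex.I hI).toContinuousMap, ?_, rfl⟩, ?_⟩
  · exact ⟨resolventFun Complex.I hI, StarAlgebra.subset_adjoin ℂ _ ⟨_, hI, rfl⟩, rfl⟩
  · intro h
    have h' : ((x : ℂ) - Complex.I)⁻¹ = ((y : ℂ) - Complex.I)⁻¹ := h
    rw [inv_inj, sub_left_inj] at h'
    exact hxy (by exact_mod_cast h')

end PositiveCalculus

/-! ### Spectral measures of vectors -/

section SpectralMeasure

variable {H : Type*} [NormedAddCommGroup H] [InnerProductSpace ℂ H] [CompleteSpace H]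
variable {Φ : (ℝ →ᵇ ℂ) →⋆ₐ[ℂ] (H →L[ℂ] H)}

open Filter Topology

namespace IsPositiveCalculus

lemma norm_apply_le (hΦ : IsPositiveCalculus Φ) {φ : ℝ →ᵇ ℂ} {C : ℝ}
    (h : ∀ s, 0 ≤ s → ‖φ s‖ ≤ C) (y : H) : ‖Φ φ y‖ ≤ C * ‖y‖ := by
  have hC : 0 ≤ C := (norm_nonneg _).trans (h 0 le_rfl)
  have e : Φ φ = Φ (φ.compContinuous ⟨fun s => max s 0, by fun_prop⟩) := by
    apply hΦ.congr
    intro s hs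
    simp [max_eq_left hs]
  rw [e]
  refine (ContinuousLinearMap.le_opNorm _ _).trans (mul_le_mul_of_nonneg_right ?_ (norm_nonneg _))
  refine (NonUnitalStarAlgHom.norm_apply_le Φ _).trans ?_
  rw [BoundedContinuousFunction.norm_le hC]
  intro s
  exact h _ (le_max_right _ _)

/-- Strong convergence to `0` on the closure of the range of `Φ e`, for uniformly bounded `g n` with
`g n * e` uniformly small. -/
lemma tendsto_zero (hΦ : IsPositiveCalculus Φ) {g : ℕ → ℝ →ᵇ ℂ} {e : ℝ →ᵇ ℂ}
    (hg : ∀ n s, 0 ≤ s → ‖g n s‖ ≤ 1) (hge : ∀ (n : ℕ) s, 0 ≤ s → ‖g n s * e s‖ ≤ 1 / ((n : ℝ) + 1))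
    {v : H} (hv : v ∈ closure (range (Φ e))) : Tendsto (fun n => Φ (g n) v) atTop (𝓝 0) := by
  rw [Metric.tendsto_atTop]
  intro ε hε
  obtain ⟨_, ⟨y, rfl⟩, hy⟩ := Metric.mem_closure_iff.1 hv (ε / 2) (by positivity)
  have h1 : Tendsto (fun n : ℕ => 1 / ((n : ℝ) + 1) * ‖y‖) atTop (𝓝 0) := by
    simpa using (tendsto_one_div_add_atTop_nhds_zero_nat (𝕜 := ℝ)).mul_const ‖y‖
  obtain ⟨N, hN⟩ := (h1.eventually_lt_const (by positivity : 0 < ε / 2)).exists_forall_of_atTop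
  refine ⟨N, fun n hn => ?_⟩
  rw [dist_zero_right]
  have e1 : Φ (g n) v = Φ (g n) (v - Φ e y) + Φ (g n * e) y := by
    rw [map_sub, calculus_mul, sub_add_cancel]
  rw [e1]
  calc _ ≤ ‖Φ (g n) (v - Φ e y)‖ + ‖Φ (g n * e) y‖ := norm_add_le _ _
    _ ≤ 1 * ‖v - Φ e y‖ + 1 / ((n : ℝ) + 1) * ‖y‖ :=
      add_le_add (hΦ.norm_apply_le (hg n) _) (hΦ.norm_apply_le (hge n) _)
    _ < ε / 2 + ε / 2 := by
      rw [one_mul, ← dist_eq_norm]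
      exact add_lt_add hy (hN n hn)
    _ = ε := by ring

end IsPositiveCalculus

/-- The trapezoidal cutoff, equal to `1` on `[-n, n]` and to `0` outside `[-n - 1, n + 1]`. -/
def cutoff (n : ℕ) (s : ℝ) : ℝ := max 0 (min 1 (n + 1 - |s|))

lemma continuous_cutoff (n : ℕ) : Continuous (cutoff n) := by
  unfold cutoff
  fun_prop

lemma cutoff_nonneg (n : ℕ) (s : ℝ) : 0 ≤ cutoff n s := le_max_left _ _

lemma cutoff_le_one (n : ℕ) (s : ℝ) : cutoff n s ≤ 1 := max_le zero_le_one (min_le_left _ _)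

lemma abs_cutoff_le (n : ℕ) (s : ℝ) : |cutoff n s| ≤ 1 := by
  rw [abs_of_nonneg (cutoff_nonneg n s)]
  exact cutoff_le_one n s

lemma cutoff_eq_one {n : ℕ} {s : ℝ} (h : |s| ≤ n) : cutoff n s = 1 := by
  rw [cutoff, min_eq_left (by linarith), max_eq_right zero_le_one]

lemma hasCompactSupport_cutoff (n : ℕ) : HasCompactSupport (cutoff n) := by
  refine HasCompactSupport.intro (isCompact_Icc (a := -((n : ℝ) + 1)) (b := n + 1)) fun s hs => ?_
  have : (n : ℝ) + 1 - |s| ≤ 0 := by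
    by_contra h
    exact hs (abs_le.1 (by linarith))
  rw [cutoff, max_eq_left (min_le_of_right_le this)]

lemma tendsto_cutoff (s : ℝ) : Tendsto (fun n => cutoff n s) atTop (𝓝 1) := by
  obtain ⟨N, hN⟩ := exists_nat_ge |s|
  refine tendsto_const_nhds.congr' ?_
  filter_upwards [eventually_ge_atTop N] with n hn
  exact (cutoff_eq_one (hN.trans (by exact_mod_cast hn))).symm

/-- Every vector has a finite spectral measure, carried by `[0, ∞)`. The Riesz–Markov theorem gives
the measure from the compactly supported functions; passing to bounded functions uses that the
cutoffs converge strongly to the identity, so that no mass is lost at infinity. -/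
theorem IsPositiveCalculus.exists_measure (hΦ : IsPositiveCalculus Φ) (v : H) :
    ∃ σ : Measure ℝ, IsFiniteMeasure σ ∧ σ (Iio 0) = 0 ∧
      ∀ φ : ℝ →ᵇ ℂ, inner ℂ v (Φ φ v) = ∫ x, φ x ∂σ := by
  have hb : ∀ f : CompactlySupportedContinuousMap ℝ ℝ, ∃ C, ∀ s, |f s| ≤ C := fun f => by
    simpa using f.hasCompactSupport.exists_bound_of_continuous f.continuous
  choose C hC using hb
  let ι : CompactlySupportedContinuousMap ℝ ℝ → ℝ →ᵇ ℂ := fun f =>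
    realBCF f f.continuous (C f) (hC f)
  let Λ₀ : CompactlySupportedContinuousMap ℝ ℝ →ₗ[ℝ] ℝ :=
    { toFun := fun f => (inner ℂ v (Φ (ι f) v)).re
      map_add' := fun f g => by
        have : ι (f + g) = ι f + ι g := by
          ext s
          simp [ι]
        rw [this, map_add, add_apply, inner_add_right, Complex.add_re]
      map_smul' := fun c f => by
        have : ι (c • f) = (c : ℂ) • ι f := by
          ext s
          simp [ι]
        rw [this, map_smul, smul_apply, inner_smul_right, Complex.re_ofReal_mul]
        rfl }
  let Λ := PositiveLinearMap.mk₀ Λ₀ fun f hf =>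
    ((ContinuousLinearMap.nonneg_iff_isPositive _).1 (calculus_nonneg Φ f.continuous (hC f) fun s =>
      CompactlySupportedContinuousMap.le_def.1 hf s)).re_inner_nonneg_right v
  have hΛ : ∀ f, Λ f = (inner ℂ v (Φ (ι f) v)).re := fun f => rfl
  let χ : ℕ → CompactlySupportedContinuousMap ℝ ℝ := fun n =>
    ⟨⟨cutoff n, continuous_cutoff n⟩, hasCompactSupport_cutoff n⟩
  let χ' : ℕ → ℝ →ᵇ ℂ := fun n => realBCF (cutoff n) (continuous_cutoff n) 1 (abs_cutoff_le n)
  set σ := RealRMK.rieszMeasure Λ with hσ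
  have hint : ∀ f : CompactlySupportedContinuousMap ℝ ℝ,
      ∫ x, f x ∂σ = (inner ℂ v (Φ (ι f) v)).re := fun f => by
    rw [hσ, RealRMK.integral_rieszMeasure, hΛ]
  have hfin : IsFiniteMeasure σ := by
    refine ⟨lt_of_le_of_lt ?_ (ENNReal.ofReal_lt_top (r := ‖v‖ ^ 2))⟩
    have hmono : Monotone fun n : ℕ => Icc (-(n : ℝ)) n := fun m n hmn => by
      have : (m : ℝ) ≤ n := by exact_mod_cast hmn
      exact Icc_subset_Icc (by linarith) this
    have hU : ⋃ n : ℕ, Icc (-(n : ℝ)) n = univ := by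
      refine eq_univ_of_forall fun s => ?_
      obtain ⟨N, hN⟩ := exists_nat_ge |s|
      exact mem_iUnion.2 ⟨N, abs_le.1 hN⟩
    rw [← hU]
    refine le_of_tendsto' (tendsto_measure_iUnion_atTop hmono) fun n => ?_
    refine (RealRMK.rieszMeasure_le_of_eq_one Λ (f := χ n) (fun s => cutoff_nonneg n s)
      isCompact_Icc fun s hs => cutoff_eq_one (abs_le.2 hs)).trans (ENNReal.ofReal_le_ofReal ?_)
    rw [hΛ]
    have e : Φ (ι (χ n)) = Φ (χ' n) := by congr 1
    calc _ ≤ ‖inner ℂ v (Φ (ι (χ n)) v)‖ := Complex.re_le_norm _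
      _ ≤ ‖v‖ * ‖Φ (ι (χ n)) v‖ := norm_inner_le_norm _ _
      _ ≤ ‖v‖ * (1 * ‖v‖) := by
        refine mul_le_mul_of_nonneg_left ?_ (norm_nonneg _)
        refine hΦ.norm_apply_le (fun s _ => ?_) v
        simpa [ι, χ] using abs_cutoff_le n s
      _ = ‖v‖ ^ 2 := by ring
  -- the cutoffs converge strongly to the identity
  have hlim : Tendsto (fun n => Φ (χ' n) v) atTop (𝓝 v) := by
    have h1 := hΦ.tendsto_zero (g := fun n => 1 - χ' n) (e := betaFun) (v := v) ?_ ?_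
      (by rw [hΦ.dense.closure_range]; trivial)
    · have h2 := h1.const_sub v
      simpa using h2
    · intro n s _
      simp only [BoundedContinuousFunction.sub_apply, BoundedContinuousFunction.coe_one,
        Pi.one_apply, χ', realBCF_apply]
      rw [← Complex.ofReal_one, ← Complex.ofReal_sub, Complex.norm_real, Real.norm_eq_abs,
        abs_of_nonneg (sub_nonneg.2 (cutoff_le_one n s))]
      linarith [cutoff_nonneg n s]
    · intro n s hs
      simp only [BoundedContinuousFunction.sub_apply, BoundedContinuousFunction.coe_one,
        Pi.one_apply, χ', realBCF_apply, betaFun_apply]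
      rw [← Complex.ofReal_one, ← Complex.ofReal_sub, ← Complex.ofReal_mul, Complex.norm_real,
        Real.norm_eq_abs,
        abs_of_nonneg (mul_nonneg (sub_nonneg.2 (cutoff_le_one n s)) (beta_pos s).le)]
      rcases le_total s n with h | h
      · rw [cutoff_eq_one (by rwa [abs_of_nonneg hs])]
        simp only [sub_self, zero_mul]
        positivity
      · have h3 : beta s ≤ 1 / ((n : ℝ) + 1) := by
          rw [beta, max_eq_left hs, one_div]
          exact inv_anti₀ (by positivity) (by linarith)
        have := cutoff_nonneg n s
        have := beta_pos s
        nlinarith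
  have hreal : ∀ (f : ℝ → ℝ) (hf : Continuous f) (D : ℝ) (hD : ∀ s, |f s| ≤ D),
      inner ℂ v (Φ (realBCF f hf D hD) v) = ∫ x, (f x : ℂ) ∂σ := by
    intro f hf D hD
    set F := realBCF f hf D hD
    have him : (inner ℂ v (Φ F v)).im = 0 := by
      have h1 : star F = F := star_realBCF _ _ _ _
      have h2 : conj (inner ℂ v (Φ F v)) = inner ℂ v (Φ F v) := by
        rw [inner_conj_symm, inner_calculus_left, h1]
      exact Complex.conj_eq_iff_im.1 h2
    have hre : (inner ℂ v (Φ F v)).re = ∫ x, f x ∂σ := by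
      have h1 : Tendsto (fun n => ∫ x, f x * cutoff n x ∂σ) atTop (𝓝 (∫ x, f x ∂σ)) := by
        refine tendsto_integral_of_dominated_convergence (fun _ => D)
          (fun n => (hf.mul (continuous_cutoff n)).aestronglyMeasurable) (integrable_const D)
          (fun n => Eventually.of_forall fun x => ?_) (Eventually.of_forall fun x => ?_)
        · rw [Real.norm_eq_abs, abs_mul]
          have := abs_cutoff_le n x
          have := hD x
          have := abs_nonneg (f x)
          nlinarith
        · simpa using (tendsto_cutoff x).const_mul (f x)
      have h2 : Tendsto (fun n => (inner ℂ v (Φ F (Φ (χ' n) v))).re) atTop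
          (𝓝 (inner ℂ v (Φ F v)).re) :=
        (Complex.continuous_re.tendsto _).comp
          (tendsto_const_nhds.inner (((Φ F).continuous.tendsto v).comp hlim))
      refine tendsto_nhds_unique h2 (h1.congr fun n => ?_)
      let p : CompactlySupportedContinuousMap ℝ ℝ :=
        ⟨⟨fun x => f x * cutoff n x, hf.mul (continuous_cutoff n)⟩,
          (hasCompactSupport_cutoff n).mul_left⟩
      have h3 : ι p = F * χ' n := by
        ext s
        simp [ι, p, F, χ']
      rw [calculus_mul, ← h3]
      exact hint p
    rw [integral_complex_ofReal]
    exact Complex.ext (by simpa using hre) (by simpa using him)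
  refine ⟨σ, hfin, ?_, fun φ => ?_⟩
  · -- test against `min (max (-x) 0) 1`, which vanishes on `[0, ∞)` and is positive before
    let f : ℝ → ℝ := fun x => min (max (-x) 0) 1
    have hf : Continuous f := by fun_prop
    have hf0 : ∀ s, 0 ≤ f s := fun s => le_min (le_max_right _ _) zero_le_one
    have hf1 : ∀ s, |f s| ≤ 1 := fun s => by
      rw [abs_of_nonneg (hf0 s)]
      exact min_le_right _ _
    have h1 := hreal f hf 1 hf1
    rw [hΦ.vanish, zero_apply, inner_zero_right, integral_complex_ofReal, eq_comm] at h1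
    · have h2 : ∫ x, f x ∂σ = 0 := by simpa using h1
      rw [integral_eq_zero_iff_of_nonneg hf0
        (Integrable.of_bound hf.aestronglyMeasurable 1 (Eventually.of_forall hf1))] at h2
      refine measure_mono_null (fun x hx => ?_) (ae_iff.1 h2)
      have hx' : x < 0 := hx
      exact (lt_min (lt_max_of_lt_left (by linarith)) one_pos).ne'
    · intro s hs
      simp [f, hs]
  · have hre : ∀ s, |(φ s).re| ≤ ‖φ‖ := fun s =>
      (Complex.abs_re_le_norm _).trans (φ.norm_coe_le_norm s)
    have him : ∀ s, |(φ s).im| ≤ ‖φ‖ := fun s =>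
      (Complex.abs_im_le_norm _).trans (φ.norm_coe_le_norm s)
    have e : φ = realBCF (fun s => (φ s).re) (by fun_prop) _ hre
        + Complex.I • realBCF (fun s => (φ s).im) (by fun_prop) _ him := by
      ext s
      simp [mul_comm Complex.I]
    have hi : ∀ (f : ℝ → ℝ) (hf : Continuous f) (hf' : ∀ s, |f s| ≤ ‖φ‖),
        Integrable (fun s => (f s : ℂ)) σ := fun f hf hf' =>
      (Integrable.of_bound hf.aestronglyMeasurable _ (Eventually.of_forall hf')).ofReal
    nth_rewrite 1 [e]
    rw [map_add, map_smul, add_apply, smul_apply, inner_add_right, inner_smul_right, hreal, hreal,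
      ← integral_const_mul, ← integral_add (hi _ (by fun_prop) hre)
        ((hi _ (by fun_prop) him).const_mul _)]
    refine integral_congr_ae (Eventually.of_forall fun s => ?_)
    simp only [mul_comm Complex.I]
    exact Complex.re_add_im _

end SpectralMeasure

/-! ### The positive square root -/

section SquareRoot

variable {H : Type*} [NormedAddCommGroup H] [InnerProductSpace ℂ H] [CompleteSpace H]
variable {Φ : (ℝ →ᵇ ℂ) →⋆ₐ[ℂ] (H →L[ℂ] H)}

open Filter Topology

lemma norm_calculus_sq {v : H} {σ : Measure ℝ}
    (hσ : ∀ φ : ℝ →ᵇ ℂ, inner ℂ v (Φ φ v) = ∫ x, φ x ∂σ) (φ : ℝ →ᵇ ℂ) :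
    ‖Φ φ v‖ ^ 2 = ∫ x, ‖φ x‖ ^ 2 ∂σ := by
  have h1 : ((‖Φ φ v‖ ^ 2 : ℝ) : ℂ) = ∫ x, ((‖φ x‖ ^ 2 : ℝ) : ℂ) ∂σ := by
    have h2 : inner ℂ (Φ φ v) (Φ φ v) = ((‖Φ φ v‖ ^ 2 : ℝ) : ℂ) := by
      rw [inner_self_eq_norm_sq_to_K]
      norm_cast
    rw [← h2, inner_calculus_left, calculus_mul, hσ]
    refine integral_congr_ae (Eventually.of_forall fun x => ?_)
    simpa using Complex.conj_mul' (φ x)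
  rw [integral_complex_ofReal] at h1
  exact_mod_cast h1

lemma calculus_congr_ae {v : H} {σ : Measure ℝ}
    (hσ : ∀ φ : ℝ →ᵇ ℂ, inner ℂ v (Φ φ v) = ∫ x, φ x ∂σ) {φ χ : ℝ →ᵇ ℂ}
    (h : ∀ᵐ x ∂σ, φ x = χ x) : Φ φ v = Φ χ v := by
  rw [← sub_eq_zero, ← sub_apply, ← map_sub, ← norm_eq_zero, ← sq_eq_zero_iff,
    norm_calculus_sq hσ]
  refine integral_eq_zero_of_ae ?_
  filter_upwards [h] with x hx
  simp [hx]

lemma calculus_congr_of_measure {v : H} {σ : Measure ℝ} {M : ℝ}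
    (hσ : ∀ φ : ℝ →ᵇ ℂ, inner ℂ v (Φ φ v) = ∫ x, φ x ∂σ) (h0 : σ (Iio 0) = 0) (hM : σ (Ioi M) = 0)
    {φ χ : ℝ →ᵇ ℂ} (h : ∀ s, 0 ≤ s → s ≤ M → φ s = χ s) : Φ φ v = Φ χ v := by
  refine calculus_congr_ae hσ ?_
  filter_upwards [measure_eq_zero_iff_ae_notMem.1 h0, measure_eq_zero_iff_ae_notMem.1 hM]
    with x h1 h2
  exact h x (not_lt.1 h1) (not_lt.1 h2)

/-- The spectral measure of a vector in the closure of the range of the square root of `A` has no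
atom at `0`. -/
lemma IsPositiveCalculus.measure_singleton_zero (hΦ : IsPositiveCalculus Φ) {v : H} {σ : Measure ℝ}
    [IsFiniteMeasure σ] (hσ : ∀ φ : ℝ →ᵇ ℂ, inner ℂ v (Φ φ v) = ∫ x, φ x ∂σ)
    (hv : v ∈ closure (range (Φ dFun))) : σ {0} = 0 := by
  let g : ℕ → ℝ → ℝ := fun n s => max 0 (1 - ((n : ℝ) + 1) ^ 2 * |s|)
  have hg0 : ∀ n s, 0 ≤ g n s := fun n s => le_max_left _ _
  have hg1 : ∀ n s, g n s ≤ 1 := fun n s =>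
    max_le zero_le_one (sub_le_self _ (by positivity))
  have hg : ∀ n s, |g n s| ≤ 1 := fun n s => by
    rw [abs_of_nonneg (hg0 n s)]
    exact hg1 n s
  have hgc : ∀ n, Continuous (g n) := fun n => by fun_prop
  have hlim := hΦ.tendsto_zero (g := fun n => realBCF (g n) (hgc n) 1 (hg n)) (e := dFun)
    (fun n s _ => by simpa using hg n s) (fun n s hs => by
      rw [realBCF_apply, dFun_apply, ← Complex.ofReal_mul, Complex.norm_real, Real.norm_eq_abs,
        abs_of_nonneg (mul_nonneg (hg0 n s) (Real.sqrt_nonneg _))]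
      rcases le_total (((n : ℝ) + 1) ^ 2 * s) 1 with h | h
      · have h1 : 1 - beta s ≤ (1 / ((n : ℝ) + 1)) ^ 2 := by
          have h2 : 1 - beta s ≤ s := by
            have := beta_mul hs
            nlinarith [beta_le_one s]
          refine h2.trans ?_
          rw [div_pow, one_pow, le_div_iff₀ (by positivity)]
          linarith
        calc g n s * √(1 - beta s) ≤ 1 * √((1 / ((n : ℝ) + 1)) ^ 2) :=
              mul_le_mul (hg1 n s) (Real.sqrt_le_sqrt h1) (Real.sqrt_nonneg _) zero_le_one
          _ = 1 / ((n : ℝ) + 1) := by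
              rw [one_mul, Real.sqrt_sq (by positivity)]
      · have : g n s = 0 := max_eq_left (by
          rw [abs_of_nonneg hs]
          linarith)
        rw [this, zero_mul]
        positivity) hv
  have h2 : Tendsto (fun n => ∫ x, g n x ∂σ) atTop (𝓝 0) := by
    have h3 := (Complex.continuous_re.tendsto _).comp
      ((tendsto_const_nhds (x := v)).inner (𝕜 := ℂ) hlim)
    rw [inner_zero_right, Complex.zero_re] at h3
    refine h3.congr fun n => ?_
    simp only [Function.comp_apply, hσ, realBCF_apply, integral_complex_ofReal, Complex.ofReal_re]
  have h3 : σ.real {0} ≤ 0 := by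
    refine ge_of_tendsto' h2 fun n => ?_
    calc σ.real {0} = ∫ x in {0}, g n x ∂σ := by
          rw [integral_singleton]
          simp [g]
      _ ≤ ∫ x, g n x ∂σ := setIntegral_le_integral
          (Integrable.of_bound (hgc n).aestronglyMeasurable 1 (Eventually.of_forall (hg n)))
          (Eventually.of_forall (hg0 n))
  exact (measureReal_eq_zero_iff).1 (le_antisymm h3 measureReal_nonneg)

/-- The square root of the operator with functional calculus `Φ`: its graph is
`{(C k, D k)}` with `C = (1 + A)^(-1/2)` and `D = A^(1/2) (1 + A)^(-1/2)`. -/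
def sqrtOp (Φ : (ℝ →ᵇ ℂ) →⋆ₐ[ℂ] (H →L[ℂ] H)) : H →ₗ.[ℂ] H :=
  (LinearMap.range ((Φ cFun : H →ₗ[ℂ] H).prod (Φ dFun : H →ₗ[ℂ] H))).toLinearPMap

namespace IsPositiveCalculus

lemma mem_graph_sqrtOp (hΦ : IsPositiveCalculus Φ) {f w : H} :
    (f, w) ∈ (sqrtOp Φ).graph ↔ ∃ k, Φ cFun k = f ∧ Φ dFun k = w := by
  rw [sqrtOp, Submodule.toLinearPMap_graph_eq]
  · simp [Prod.ext_iff]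
  · rintro _ ⟨k, rfl⟩ hk
    have : k = 0 := (injective_iff_map_eq_zero _).1 hΦ.cFun_injective k hk
    simp [this]

/-- The graph `{(C k, D k)}` is also given by the equation `C w = D f`, since `C² + D² = 1`. -/
lemma mem_graph_sqrtOp_iff (hΦ : IsPositiveCalculus Φ) {f w : H} :
    (f, w) ∈ (sqrtOp Φ).graph ↔ Φ cFun w = Φ dFun f := by
  rw [hΦ.mem_graph_sqrtOp]
  constructor
  · rintro ⟨k, rfl, rfl⟩
    exact calculus_comm _ _ _ _
  · intro h
    refine ⟨Φ cFun f + Φ dFun w, ?_, ?_⟩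
    · rw [map_add, cFun_cFun_apply, calculus_comm, h, dFun_dFun_apply]
      abel
    · rw [map_add, calculus_comm, ← h, cFun_cFun_apply, dFun_dFun_apply]
      abel

lemma dense_domain_sqrtOp (hΦ : IsPositiveCalculus Φ) : Dense ((sqrtOp Φ).domain : Set H) := by
  refine hΦ.denseRange_cFun.mono ?_
  rintro _ ⟨k, rfl⟩
  exact LinearPMap.mem_domain_of_mem_graph (hΦ.mem_graph_sqrtOp.2 ⟨k, rfl, rfl⟩)

lemma isSelfAdjoint_sqrtOp (hΦ : IsPositiveCalculus Φ) : IsSelfAdjoint (sqrtOp Φ) := by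
  rw [LinearPMap.isSelfAdjoint_def]
  apply LinearPMap.eq_of_eq_graph
  rw [LinearPMap.adjoint_graph_eq_graph_adjoint hΦ.dense_domain_sqrtOp]
  ext ⟨f, w⟩
  rw [Submodule.mem_adjoint_iff, hΦ.mem_graph_sqrtOp_iff]
  constructor
  · intro h
    refine ext_inner_left ℂ fun k => ?_
    have := h _ _ (hΦ.mem_graph_sqrtOp.2 ⟨k, rfl, rfl⟩)
    simp only at this
    rw [inner_calculus_left, inner_calculus_left, star_cFun, star_dFun,
      sub_eq_zero] at this
    exact this.symm
  · intro h a b hab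
    obtain ⟨k, rfl, rfl⟩ := hΦ.mem_graph_sqrtOp.1 hab
    simp only
    rw [inner_calculus_left, inner_calculus_left, star_cFun, star_dFun, h,
      sub_self]

end IsPositiveCalculus

lemma cFun_mul_dFun_nonneg (Φ : (ℝ →ᵇ ℂ) →⋆ₐ[ℂ] (H →L[ℂ] H)) : 0 ≤ Φ (cFun * dFun) := by
  rw [map_mul]
  refine (commute_iff_mul_nonneg ?_ ?_).1 ?_
  · exact calculus_nonneg Φ _ _ fun s => Real.sqrt_nonneg _
  · exact calculus_nonneg Φ _ _ fun s => Real.sqrt_nonneg _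
  · rw [Commute, SemiconjBy, ← map_mul, ← map_mul, mul_comm]

namespace IsPositiveCalculus

/-- The equation `f = (1 + A)⁻¹ (f + w)` expresses `w = A f`. -/
theorem isPosSqrt_sqrtOp (hΦ : IsPositiveCalculus Φ) {A : H →ₗ.[ℂ] H}
    (hA : ∀ f w : H, (f, w) ∈ A.graph ↔ f = Φ betaFun (f + w)) : IsPosSqrt (sqrtOp Φ) A := by
  refine ⟨hΦ.isSelfAdjoint_sqrtOp, fun x => ?_, fun f w => ?_⟩
  · obtain ⟨k, hk, hk'⟩ := hΦ.mem_graph_sqrtOp.1 ((sqrtOp Φ).mem_graph x)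
    rw [← hk, ← hk', inner_calculus_left, star_cFun, calculus_mul]
    exact (ContinuousLinearMap.nonneg_iff_isPositive _).1 (cFun_mul_dFun_nonneg Φ)
      |>.re_inner_nonneg_right k
  · rw [hA]
    constructor
    · intro h
      refine ⟨Φ cFun (Φ dFun (f + w)), ?_, ?_⟩
      · rw [hΦ.mem_graph_sqrtOp_iff, cFun_cFun_apply, calculus_comm, ← h]
      · rw [hΦ.mem_graph_sqrtOp_iff, calculus_comm Φ dFun, dFun_dFun_apply, ← h]
        simp
    · rintro ⟨u, h1, h2⟩
      rw [hΦ.mem_graph_sqrtOp_iff] at h1 h2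
      rw [map_add, ← cFun_cFun_apply w, h2, calculus_comm, h1, dFun_dFun_apply]
      abel

/-- The positive square root is unique: `S (1 + A)⁻¹` is a bounded positive operator with square
`A (1 + A)⁻²`. -/
theorem eq_sqrtOp (hΦ : IsPositiveCalculus Φ) {A S : H →ₗ.[ℂ] H}
    (hA : ∀ f w : H, (f, w) ∈ A.graph ↔ f = Φ betaFun (f + w)) (hS : IsPosSqrt S A) :
    S = sqrtOp Φ := by
  obtain ⟨hsa, hpos, hsq⟩ := hS
  have hgraph : S.graph = S.graph.adjoint := by
    rw [← LinearPMap.adjoint_graph_eq_graph_adjoint hsa.dense_domain,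
      LinearPMap.isSelfAdjoint_def.1 hsa]
  have hsymm : ∀ {a b a' b' : H}, (a, b) ∈ S.graph → (a', b') ∈ S.graph →
      inner ℂ b a' = inner ℂ a b' := by
    intro a b a' b' h h'
    rw [hgraph, Submodule.mem_adjoint_iff] at h'
    exact sub_eq_zero.1 (h' a b h)
  have hpos' : ∀ {a b : H}, (a, b) ∈ S.graph → 0 ≤ (inner ℂ a b).re := by
    intro a b h
    obtain ⟨x, h1, h2⟩ := (LinearPMap.mem_graph_iff S).1 h
    simp only at h1 h2
    rw [← h1, ← h2]
    exact hpos x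
  have hex : ∀ k, ∃ u, (Φ betaFun k, u) ∈ S.graph ∧ (u, k - Φ betaFun k) ∈ S.graph := by
    intro k
    rw [← hsq, hA]
    simp
  choose E hE1 hE2 using hex
  have hEE : ∀ k l, inner ℂ (E k) (E l) = inner ℂ (Φ betaFun k) (l - Φ betaFun l) := fun k l =>
    hsymm (hE1 k) (hE2 l)
  -- `E k = S (1 + A)⁻¹ k`
  let E₀ : H →ₗ[ℂ] H :=
    { toFun := E
      map_add' := fun k l => by
        refine S.mem_graph_snd_inj (hE1 (k + l)) (S.graph.add_mem (hE1 k) (hE1 l)) ?_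
        exact map_add _ _ _
      map_smul' := fun c k => by
        refine S.mem_graph_snd_inj (hE1 (c • k)) (S.graph.smul_mem c (hE1 k)) ?_
        exact map_smul _ _ _ }
  have hB : ∀ k : H, ‖Φ betaFun k‖ ≤ 1 * ‖k‖ := hΦ.norm_apply_le fun s _ => by
    rw [betaFun_apply, Complex.norm_real, Real.norm_eq_abs, abs_of_pos (beta_pos s)]
    exact beta_le_one s
  have hB' : ∀ k : H, ‖Φ (1 - betaFun) k‖ ≤ 1 * ‖k‖ := hΦ.norm_apply_le fun s _ => by
    have e : (1 - betaFun) s = ((1 - beta s : ℝ) : ℂ) := by simp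
    rw [e, Complex.norm_real, Real.norm_eq_abs, abs_of_nonneg (by linarith [beta_le_one s])]
    linarith [beta_pos s]
  let E₁ : H →L[ℂ] H := E₀.mkContinuous 1 fun k => by
    change ‖E k‖ ≤ 1 * ‖k‖
    refine le_of_sq_le_sq ?_ (by positivity)
    have h1 : ‖E k‖ ^ 2 = (inner ℂ (E k) (E k)).re := (inner_self_eq_norm_sq (𝕜 := ℂ) _).symm
    rw [h1, hEE]
    have h2 : k - Φ betaFun k = Φ (1 - betaFun) k := by
      rw [map_sub, map_one]
      rfl
    calc _ ≤ ‖inner ℂ (Φ betaFun k) (k - Φ betaFun k)‖ := Complex.re_le_norm _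
      _ ≤ ‖Φ betaFun k‖ * ‖k - Φ betaFun k‖ := norm_inner_le_norm _ _
      _ ≤ (1 * ‖k‖) * (1 * ‖k‖) := by
        rw [h2]
        exact mul_le_mul (hB k) (hB' k) (norm_nonneg _) (by positivity)
      _ = _ := by ring
  have hE₁ : ∀ k, E₁ k = E k := fun k => rfl
  have hEpos : 0 ≤ E₁ := by
    rw [ContinuousLinearMap.nonneg_iff_isPositive, ContinuousLinearMap.isPositive_iff_complex]
    intro k
    have h1 : inner ℂ (E k) (Φ betaFun k) = inner ℂ (Φ betaFun k) (E k) := hsymm (hE1 k) (hE1 k)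
    have h2 : inner ℂ (k - Φ betaFun k) (E k) = inner ℂ (E k) (k - Φ betaFun k) :=
      hsymm (hE2 k) (hE2 k)
    have h3 : inner ℂ (E₁ k) k
        = inner ℂ (E k) (Φ betaFun k) + inner ℂ (E k) (k - Φ betaFun k) := by
      rw [hE₁, ← inner_add_right, add_sub_cancel]
    constructor
    · rw [h3]
      rw [RCLike.re_eq_complex_re]
      refine Complex.conj_eq_iff_re.1 ?_
      rw [map_add, inner_conj_symm, inner_conj_symm, h1, h2]
    · rw [h3, h1]
      rw [map_add]
      exact add_nonneg (hpos' (hE1 k)) (hpos' (hE2 k))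
  have hEsq : E₁ * E₁ = Φ (cFun * dFun) * Φ (cFun * dFun) := by
    refine ContinuousLinearMap.ext fun k => ext_inner_left ℂ fun l => ?_
    have h1 : (E₁).adjoint = E₁ := by
      rw [← ContinuousLinearMap.star_eq_adjoint]
      exact (IsSelfAdjoint.of_nonneg hEpos).star_eq
    have h2 : inner ℂ l (E₁ (E₁ k)) = inner ℂ (E₁ l) (E₁ k) := by
      nth_rewrite 1 [← h1]
      rw [ContinuousLinearMap.adjoint_inner_right]
    rw [mul_apply_eq_comp, h2, hE₁, hE₁, hEE, inner_calculus_left, star_betaFun,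
      ← map_mul, mul_mul_mul_comm, cFun_mul_cFun, dFun_mul_dFun, map_mul, map_sub Φ, map_one Φ,
      mul_apply_eq_comp, sub_apply, one_apply_eq_self, map_sub]
  have hEeq : E₁ = Φ (cFun * dFun) := by
    rw [← CFC.sqrt_unique hEsq, CFC.sqrt_unique rfl (cFun_mul_dFun_nonneg Φ)]
  have hsub : ∀ k, (Φ cFun k, Φ dFun k) ∈ S.graph := by
    intro k
    have hcl : IsClosed {k | (Φ cFun k, Φ dFun k) ∈ S.graph} :=
      hsa.isClosed.preimage (by fun_prop : Continuous fun k => (Φ cFun k, Φ dFun k))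
    refine hΦ.denseRange_cFun.induction_on k hcl fun l => ?_
    have := hE1 l
    rw [← hE₁, hEeq, mul_comm, ← calculus_mul, ← cFun_cFun_apply] at this
    exact this
  apply LinearPMap.eq_of_eq_graph
  ext ⟨f, w⟩
  constructor
  · intro h
    rw [hΦ.mem_graph_sqrtOp_iff]
    refine ext_inner_left ℂ fun k => ?_
    have := hsymm (hsub k) h
    rw [inner_calculus_left, inner_calculus_left, star_cFun, star_dFun] at this
    exact this.symm
  · intro h
    obtain ⟨k, rfl, rfl⟩ := hΦ.mem_graph_sqrtOp.1 h
    exact hsub k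

end IsPositiveCalculus
end SquareRoot

/-! ### Polar decomposition of a closed operator -/

section Polar

lemma norm_eq_of_denseRange {H K E : Type*} [NormedAddCommGroup H] [NormedSpace ℂ H]
    [NormedAddCommGroup K] [NormedSpace ℂ K] {e : E → H} {F : H →L[ℂ] K}
    (he : DenseRange e) (h : ∀ x, ‖F (e x)‖ = ‖e x‖) (y : H) : ‖F y‖ = ‖y‖ :=
  he.induction_on y (isClosed_eq (by fun_prop) (by fun_prop)) h

variable {H K G : Type*} [NormedAddCommGroup H] [InnerProductSpace ℂ H] [CompleteSpace H]
  [NormedAddCommGroup K] [InnerProductSpace ℂ K]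
  [NormedAddCommGroup G] [InnerProductSpace ℂ G] [CompleteSpace G]

open ContinuousLinearMap

lemma denseRange_adjoint {J : G →L[ℂ] H} (hJ : Function.Injective J) : DenseRange J.adjoint := by
  have h : (LinearMap.range (J.adjoint : H →ₗ[ℂ] G)).topologicalClosure = ⊤ := by
    rw [Submodule.topologicalClosure_eq_top_iff, Submodule.eq_bot_iff]
    intro p hp
    rw [Submodule.mem_orthogonal] at hp
    refine (injective_iff_map_eq_zero J).1 hJ p (ext_inner_left ℂ fun x => ?_)
    rw [inner_zero_right, ← adjoint_inner_left]
    exact hp _ ⟨x, rfl⟩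
  rw [← Submodule.dense_iff_topologicalClosure_eq_top] at h
  exact h

/-- Polar decomposition of a closed densely defined operator `L`, given by its graph
`{(J p, T p) : p ∈ G}`. With `A = L* L` and `C = (1 + A)^(-1/2)`, `D = A^(1/2) (1 + A)^(-1/2)`,
`R = L C`, the isometry `V` is the adjoint of the partial isometry of the polar decomposition of
`L`. -/
theorem exists_polar {J : G →L[ℂ] H} {T : G →L[ℂ] K}
    (hJT : ∀ p q, inner ℂ (J p) (J q) + inner ℂ (T p) (T q) = inner ℂ p q)
    (hJ : Function.Injective J) (hJd : DenseRange J) (hTd : DenseRange T) :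
    ∃ (Φ : (ℝ →ᵇ ℂ) →⋆ₐ[ℂ] (H →L[ℂ] H)) (R : H →L[ℂ] K) (V : K →L[ℂ] H),
      IsPositiveCalculus Φ ∧ Φ betaFun = J ∘L J.adjoint ∧
      (∀ k, ∃ p, J p = Φ cFun k ∧ T p = R k) ∧ (∀ p, ∃ k, J p = Φ cFun k ∧ T p = R k) ∧
      DenseRange R ∧ (∀ u, ‖V u‖ = ‖u‖) ∧ ∀ k, V (R k) = Φ dFun k := by
  have hsq : ∀ p, ‖J p‖ ^ 2 + ‖T p‖ ^ 2 = ‖p‖ ^ 2 := fun p => by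
    have := congrArg Complex.re (hJT p p)
    rw [Complex.add_re] at this
    rw [← inner_self_eq_norm_sq (𝕜 := ℂ), ← inner_self_eq_norm_sq (𝕜 := ℂ) (T p),
      ← inner_self_eq_norm_sq (𝕜 := ℂ) p]
    exact this
  have hJle : ‖J‖ ≤ 1 := J.opNorm_le_bound zero_le_one fun p => by
    rw [one_mul]
    refine le_of_sq_le_sq ?_ (norm_nonneg _)
    nlinarith [hsq p, sq_nonneg ‖T p‖]
  have hB0 : 0 ≤ J ∘L J.adjoint := by
    rw [nonneg_iff_isPositive]
    exact isPositive_self_comp_adjoint J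
  have hB1 : J ∘L J.adjoint ≤ 1 := by
    rw [le_def, isPositive_iff_complex]
    intro x
    have h1 : inner ℂ ((1 - J ∘L J.adjoint) x) x = ((‖x‖ ^ 2 - ‖J.adjoint x‖ ^ 2 : ℝ) : ℂ) := by
      rw [sub_apply, inner_sub_left, one_apply_eq_self, comp_apply, ← adjoint_inner_right,
        inner_self_eq_norm_sq_to_K, inner_self_eq_norm_sq_to_K]
      push_cast
      rfl
    rw [h1]
    have h2 : ‖J.adjoint x‖ ≤ ‖x‖ := by
      refine (le_opNorm _ _).trans ?_
      rw [LinearIsometryEquiv.norm_map]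
      exact mul_le_of_le_one_left (norm_nonneg _) hJle
    constructor
    · rw [RCLike.re_eq_complex_re, Complex.ofReal_re]
    · rw [RCLike.re_eq_complex_re, Complex.ofReal_re]
      nlinarith [norm_nonneg (J.adjoint x)]
  have hadj : DenseRange J.adjoint := denseRange_adjoint hJ
  have hBd : DenseRange (J ∘L J.adjoint) := by
    rw [coe_comp]
    exact hJd.comp hadj J.continuous
  obtain ⟨Φ, hβ, hvan⟩ := exists_calculus _ hB0 hB1 hBd
  have hΦ : IsPositiveCalculus Φ := ⟨by rwa [hβ], hvan⟩
  have hnorm : ∀ x, ‖J.adjoint x‖ = ‖Φ cFun x‖ := fun x => by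
    rw [← sq_eq_sq₀ (norm_nonneg _) (norm_nonneg _), ← inner_self_eq_norm_sq (𝕜 := ℂ),
      ← inner_self_eq_norm_sq (𝕜 := ℂ) (Φ cFun x), adjoint_inner_left, inner_calculus_left,
      star_cFun, cFun_cFun_apply, hβ]
    rfl
  have hCd : DenseRange (Φ cFun : H →ₗ[ℂ] H) := hΦ.denseRange_cFun
  -- `J* = W C` is the polar decomposition of `J*`, with `W` unitary
  let W : H →L[ℂ] G := (J.adjoint : H →ₗ[ℂ] G).extendOfNorm (Φ cFun : H →ₗ[ℂ] H)
  have hW : ∀ x, W (Φ cFun x) = J.adjoint x := fun x =>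
    LinearMap.extendOfNorm_eq hCd ⟨1, fun y => by
      rw [one_mul]
      exact (hnorm y).le⟩ x
  have hWn : ∀ x, ‖W x‖ = ‖x‖ := norm_eq_of_denseRange hΦ.denseRange_cFun fun x => by
    rw [hW, hnorm]
  have hJW : ∀ k, J (W k) = Φ cFun k := fun k => by
    refine hΦ.denseRange_cFun.induction_on k (isClosed_eq (by fun_prop) (by fun_prop)) fun x => ?_
    rw [hW, cFun_cFun_apply, hβ]
    rfl
  have hWs : Function.Surjective W := by
    have hiso : Isometry W := AddMonoidHomClass.isometry_of_norm W hWn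
    have hcl : IsClosed (range W) := hiso.isClosedEmbedding.isClosed_range
    have hd : Dense (range W) := hadj.mono (by
      rintro _ ⟨x, rfl⟩
      exact ⟨_, hW x⟩)
    exact range_eq_univ.1 (hcl.closure_eq ▸ hd.closure_eq)
  let R : H →L[ℂ] K := T ∘L W
  have hRd : DenseRange R := hTd.comp hWs.denseRange T.continuous
  have hRn : ∀ k, ‖R k‖ = ‖Φ dFun k‖ := fun k => by
    rw [← sq_eq_sq₀ (norm_nonneg _) (norm_nonneg _)]
    have h1 := hsq (W k)
    have h2 := norm_cFun_sq_add_norm_dFun_sq (Φ := Φ) k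
    rw [hJW, hWn] at h1
    change ‖T (W k)‖ ^ 2 = _
    linarith
  have hRd' : DenseRange (R : H →ₗ[ℂ] K) := hRd
  let V : K →L[ℂ] H := (Φ dFun : H →ₗ[ℂ] H).extendOfNorm (R : H →ₗ[ℂ] K)
  have hV : ∀ k, V (R k) = Φ dFun k := fun k =>
    LinearMap.extendOfNorm_eq hRd' ⟨1, fun y => by
      rw [one_mul]
      exact (hRn y).ge⟩ k
  refine ⟨Φ, R, V, hΦ, hβ, fun k => ⟨W k, hJW k, rfl⟩, fun p => ?_, hRd, ?_, hV⟩
  · obtain ⟨k, rfl⟩ := hWs p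
    exact ⟨k, hJW k, rfl⟩
  · exact norm_eq_of_denseRange hRd fun k => by rw [hV, hRn]

end Polar

/-! ### The Laplace transform on `L²(ℝ₊)` -/

section LaplaceTransform

open Filter Topology

lemma memLp_exp {x : ℝ} (hx : 0 < x) :
    MemLp (fun t : ℝ => (Real.exp (-t * x) : ℂ)) 2 (volume.restrict (Ioi (0 : ℝ))) := by
  rw [memLp_two_iff_integrable_sq_norm (by fun_prop)]
  have h : IntegrableOn (fun t : ℝ => Real.exp (-(2 * x) * t)) (Ioi 0) :=
    exp_neg_integrableOn_Ioi 0 (by positivity)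
  refine h.congr (Filter.Eventually.of_forall fun t => ?_)
  simp only [Complex.norm_real, Real.norm_eq_abs, sq_abs]
  rw [← Real.exp_nat_mul]
  congr 1
  push_cast
  ring

/-- The exponential `t ↦ e^{-tx}` as an element of `L²(ℝ₊)`. -/
def expL2 (x : ℝ) (hx : 0 < x) : L2 := (memLp_exp hx).toLp _

lemma laplace_eq_inner (f : L2) {x : ℝ} (hx : 0 < x) : laplace f x = inner ℂ (expL2 x hx) f := by
  rw [laplace, L2.inner_def]
  refine integral_congr_ae ?_
  filter_upwards [(memLp_exp hx).coeFn_toLp] with t ht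
  rw [expL2, ht, RCLike.inner_apply, Complex.conj_ofReal, mul_comm]

lemma laplace_expL2 {a x : ℝ} (ha : 0 < a) (hx : 0 < x) :
    laplace (expL2 a ha) x = (((a + x)⁻¹ : ℝ) : ℂ) := by
  have h1 : ∫ t in Ioi (0 : ℝ), Real.exp (-(a + x) * t) = (a + x)⁻¹ := by
    rw [integral_exp_mul_Ioi (by linarith)]
    rw [mul_zero, Real.exp_zero, neg_div_neg_eq, one_div]
  rw [laplace, ← h1, ← integral_complex_ofReal]
  refine integral_congr_ae ?_
  filter_upwards [(memLp_exp ha).coeFn_toLp] with t ht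
  rw [expL2, ht, ← Complex.ofReal_mul, ← Real.exp_add]
  congr 2
  ring

lemma ae_pos {μ : Measure ℝ} (h : μ (Iic 0) = 0) : ∀ᵐ x ∂μ, 0 < x := by
  filter_upwards [measure_eq_zero_iff_ae_notMem.1 h] with x hx
  exact not_le.1 hx

lemma restrict_Ioi {μ : Measure ℝ} (h : μ (Iic 0) = 0) : μ.restrict (Ioi 0) = μ :=
  Measure.restrict_eq_self_of_ae_mem (ae_pos h)

lemma mem_formDomain {μ : Measure ℝ} (h : μ (Iic 0) = 0) {f : L2} :
    f ∈ formDomain μ ↔ MemLp (laplace f) 2 μ := by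
  change Q μ f < ⊤ ↔ _
  rw [Q_lt_top_iff, restrict_Ioi h]

lemma expL2_mem_formDomain {μ : Measure ℝ} [IsFiniteMeasure μ] (h : μ (Iic 0) = 0) {a : ℝ}
    (ha : 0 < a) : expL2 a ha ∈ formDomain μ := by
  rw [mem_formDomain h]
  refine MemLp.of_bound (stronglyMeasurable_laplace _).aestronglyMeasurable a⁻¹ ?_
  filter_upwards [ae_pos h] with x hx
  rw [laplace_expL2 ha hx, Complex.norm_real, Real.norm_eq_abs, abs_of_pos (by positivity)]
  exact inv_anti₀ ha (by linarith)

lemma integrable_testFunction {g : L2} (hg : g ∈ testFunctions) :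
    Integrable g (volume.restrict (Ioi (0 : ℝ))) := by
  obtain ⟨g₀, h1, h2, -, h4⟩ := hg
  exact ((h1.continuous.integrable_of_hasCompactSupport h2).integrableOn).congr h4.symm

lemma norm_laplace_le {g : L2} (hg : Integrable g (volume.restrict (Ioi (0 : ℝ)))) {x : ℝ}
    (hx : 0 < x) : ‖laplace g x‖ ≤ ∫ t in Ioi (0 : ℝ), ‖g t‖ := by
  rw [laplace]
  refine norm_integral_le_of_norm_le hg.norm ?_
  filter_upwards [ae_restrict_mem measurableSet_Ioi] with t ht
  rw [norm_mul, Complex.norm_real, Real.norm_eq_abs, abs_of_pos (Real.exp_pos _)]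
  refine mul_le_of_le_one_left (norm_nonneg _) (Real.exp_le_one_iff.2 ?_)
  have : 0 < t * x := mul_pos ht hx
  linarith

lemma testFunction_mem_formDomain {μ : Measure ℝ} [IsFiniteMeasure μ] (h : μ (Iic 0) = 0) {g : L2}
    (hg : g ∈ testFunctions) : g ∈ formDomain μ := by
  rw [mem_formDomain h]
  refine MemLp.of_bound (stronglyMeasurable_laplace _).aestronglyMeasurable
    (∫ t in Ioi (0 : ℝ), ‖g t‖) ?_
  filter_upwards [ae_pos h] with x hx
  exact norm_laplace_le (integrable_testFunction hg) hx

/-- Fubini: the adjoint of the Laplace transform is again a Laplace transform. -/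
lemma integral_mul_conj_laplace {μ : Measure ℝ} [IsFiniteMeasure μ] (h : μ (Iic 0) = 0) {g : L2}
    (hg : Integrable g (volume.restrict (Ioi (0 : ℝ)))) {u : ℝ → ℂ} (hu : Integrable u μ) :
    ∫ x, u x * conj (laplace g x) ∂μ
      = ∫ t in Ioi (0 : ℝ), (∫ x, (Real.exp (-t * x) : ℂ) * u x ∂μ) * conj (g t) := by
  have e1 : ∀ x, u x * conj (laplace g x)
      = ∫ t in Ioi (0 : ℝ), (Real.exp (-t * x) : ℂ) * (u x * conj (g t)) := fun x => by
    rw [laplace, ← integral_conj, ← integral_const_mul]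
    refine integral_congr_ae (Eventually.of_forall fun t => ?_)
    simp only [map_mul, Complex.conj_ofReal]
    ring
  simp_rw [e1]
  rw [integral_integral_swap]
  · refine integral_congr_ae (Eventually.of_forall fun t => ?_)
    simp only
    rw [← integral_mul_const]
    refine integral_congr_ae (Eventually.of_forall fun x => ?_)
    simp only
    ring
  · have h1 : Integrable (fun z : ℝ × ℝ => u z.1 * conj (g z.2))
        (μ.prod (volume.restrict (Ioi (0 : ℝ)))) :=
      hu.mul_prod (f := u) (g := fun t => conj (g t))
        ((LinearIsometryEquiv.integrable_comp_iff Complex.conjLIE).2 hg)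
    refine h1.mono ((Continuous.aestronglyMeasurable (by fun_prop)).mul h1.1) ?_
    filter_upwards [Measure.quasiMeasurePreserving_fst.ae (ae_pos h),
      Measure.quasiMeasurePreserving_snd.ae (ae_restrict_mem measurableSet_Ioi)] with z hz1 hz2
    simp only [Function.uncurry]
    rw [norm_mul, Complex.norm_real, Real.norm_eq_abs, abs_of_pos (Real.exp_pos _)]
    refine mul_le_of_le_one_left (norm_nonneg _) (Real.exp_le_one_iff.2 ?_)
    have : 0 < z.2 * z.1 := mul_pos hz2 hz1
    linarith

lemma continuousOn_integral_exp_mul {μ : Measure ℝ} (h : μ (Iic 0) = 0) {u : ℝ → ℂ}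
    (hu : Integrable u μ) :
    ContinuousOn (fun t : ℝ => ∫ x, (Real.exp (-t * x) : ℂ) * u x ∂μ) (Ioi 0) := by
  refine continuousOn_of_dominated (bound := fun x => ‖u x‖)
    (fun t _ => (Continuous.aestronglyMeasurable (by fun_prop)).mul hu.1) (fun t ht => ?_) hu.norm
    (Eventually.of_forall fun x => by fun_prop)
  filter_upwards [ae_pos h] with x hx
  rw [norm_mul, Complex.norm_real, Real.norm_eq_abs, abs_of_pos (Real.exp_pos _)]
  refine mul_le_of_le_one_left (norm_nonneg _) (Real.exp_le_one_iff.2 ?_)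
  have : 0 < t * x := mul_pos ht hx
  linarith

/-- Uniqueness for the Laplace transform of the complex measure `u dμ`, from the Weierstrass
approximation theorem in the variable `e^{-x}`. -/
lemma ae_eq_zero_of_integral_exp_mul_eq_zero {μ : Measure ℝ} (h : μ (Iic 0) = 0) {u : ℝ → ℂ}
    (hu : Integrable u μ) (h0 : ∀ t : ℝ, 0 < t → ∫ x, (Real.exp (-t * x) : ℂ) * u x ∂μ = 0) :
    ∀ᵐ x ∂μ, u x = 0 := by
  set w : ℝ → ℂ := fun x => (Real.exp (-x) : ℂ) * u x with hw
  have hmem : ∀ᵐ x ∂μ, Real.exp (-x) ∈ Icc (0 : ℝ) 1 := by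
    filter_upwards [ae_pos h] with x hx
    exact ⟨(Real.exp_pos _).le, Real.exp_le_one_iff.2 (by linarith)⟩
  have hbdd : ∀ {k : ℝ → ℝ} (_ : Continuous k) (C : ℝ) (_ : ∀ y ∈ Icc (0 : ℝ) 1, |k y| ≤ C)
      {F : ℝ → ℂ} (_ : Integrable F μ), Integrable (fun x => (k (Real.exp (-x)) : ℂ) * F x) μ := by
    intro k hk C hC F hF
    refine hF.bdd_mul (c := C) (Continuous.aestronglyMeasurable (by fun_prop)) ?_
    filter_upwards [hmem] with x hx
    simpa using hC _ hx
  have hwi : Integrable w μ :=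
    hbdd continuous_id 1 (fun y hy => (abs_of_nonneg hy.1).trans_le hy.2) hu
  have hpi : ∀ p : Polynomial ℝ,
      Integrable (fun x => ((p.eval (Real.exp (-x)) : ℝ) : ℂ) * w x) μ := by
    intro p
    obtain ⟨C, hC⟩ := isCompact_Icc.exists_bound_of_continuousOn (s := Icc (0 : ℝ) 1)
      p.continuous.continuousOn
    exact hbdd p.continuous C (fun y hy => hC y hy) hwi
  have hpoly : ∀ p : Polynomial ℝ, ∫ x, ((p.eval (Real.exp (-x)) : ℝ) : ℂ) * w x ∂μ = 0 := by
    intro p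
    induction p using Polynomial.induction_on' with
    | add p q hp hq =>
      simp only [Polynomial.eval_add, Complex.ofReal_add, add_mul]
      rw [integral_add (hpi p) (hpi q), hp, hq, add_zero]
    | monomial n a =>
      have e : ∀ x, (((Polynomial.monomial n a).eval (Real.exp (-x)) : ℝ) : ℂ) * w x
          = (a : ℂ) * ((Real.exp (-((n : ℝ) + 1) * x) : ℂ) * u x) := by
        intro x
        have : Real.exp (-((n : ℝ) + 1) * x) = Real.exp (-x) ^ n * Real.exp (-x) := by
          rw [← Real.exp_nat_mul, ← Real.exp_add]
          congr 1
          ring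
        rw [this, hw, Polynomial.eval_monomial]
        push_cast
        ring
      simp_rw [e]
      rw [integral_const_mul, h0 _ (by positivity), mul_zero]
  have hcont : ∀ k : ℝ → ℝ, Continuous k → ∫ x, (k (Real.exp (-x)) : ℂ) * w x ∂μ = 0 := by
    intro k hk
    rw [← norm_le_zero_iff]
    refine le_of_forall_pos_le_add fun ε hε => ?_
    rw [zero_add]
    set M := ∫ x, ‖w x‖ ∂μ
    have hM : 0 ≤ M := integral_nonneg fun _ => norm_nonneg _
    obtain ⟨p, hp⟩ := exists_polynomial_near_of_continuousOn 0 1 k hk.continuousOn (ε / (M + 1))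
      (by positivity)
    have hki : Integrable (fun x => (k (Real.exp (-x)) : ℂ) * w x) μ := by
      obtain ⟨C, hC⟩ := isCompact_Icc.exists_bound_of_continuousOn (s := Icc (0 : ℝ) 1)
        hk.continuousOn
      exact hbdd hk C (fun y hy => hC y hy) hwi
    have e : ∫ x, (k (Real.exp (-x)) : ℂ) * w x ∂μ
        = ∫ x, ((k (Real.exp (-x)) - p.eval (Real.exp (-x)) : ℝ) : ℂ) * w x ∂μ := by
      simp only [Complex.ofReal_sub, sub_mul]
      rw [integral_sub hki (hpi p), hpoly, sub_zero]
    rw [e]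
    calc _ ≤ ∫ x, ε / (M + 1) * ‖w x‖ ∂μ := by
          refine norm_integral_le_of_norm_le (hwi.norm.const_mul _) ?_
          filter_upwards [hmem] with x hx
          rw [norm_mul, Complex.norm_real, Real.norm_eq_abs, abs_sub_comm]
          exact mul_le_mul_of_nonneg_right (hp _ hx).le (norm_nonneg _)
      _ = ε * (M / (M + 1)) := by
          rw [integral_const_mul]
          ring
      _ ≤ ε * 1 := by
          refine mul_le_mul_of_nonneg_left ?_ hε.le
          exact (div_le_one (by positivity)).2 (by linarith)
      _ = ε := mul_one ε
  have hz := (isOpen_Ioi (a := (0 : ℝ))).ae_eq_zero_of_integral_contDiff_smul_eq_zero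
    (hwi.locallyIntegrable.locallyIntegrableOn _) (fun g hg hgs hgt => by
      have hg0 : g 0 = 0 := image_eq_zero_of_notMem_tsupport fun h => lt_irrefl (0 : ℝ) (hgt h)
      -- `y ↦ g (-log y)` is continuous, also at `0`, because `g` has compact support in `(0, ∞)`
      have hk : Continuous fun y => g (-Real.log y) := by
        rw [continuous_iff_continuousAt]
        intro y
        by_cases hy : y = 0
        · subst hy
          rw [continuousAt_iff_punctured_nhds, Real.log_zero, neg_zero, hg0]
          have h1 : Tendsto (fun y => -Real.log y) (𝓝[≠] 0) atTop :=
            tendsto_neg_atBot_atTop.comp Real.tendsto_log_nhdsNE_zero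
          have h2 : ∀ᶠ y in atTop, g y = 0 := by
            have h3 := hasCompactSupport_iff_eventuallyEq.1 hgs
            rw [coclosedCompact_eq_cocompact] at h3
            exact atTop_le_cocompact h3
          refine tendsto_const_nhds.congr' ?_
          filter_upwards [h1.eventually h2] with y hy
          exact hy.symm
        · exact hg.continuous.continuousAt.comp (Real.continuousAt_log hy).neg
      have := hcont _ hk
      simpa [Real.log_exp] using this)
  filter_upwards [hz, ae_pos h] with x hx hx0
  have h1 := hx hx0
  rw [hw] at h1
  exact (mul_eq_zero.1 h1).resolve_left (by simp)

end LaplaceTransform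

/-! ### The polar decomposition of the Laplace transform -/

section Model

open Filter Topology

/-- The graph of the Laplace transform as an operator from `L²(ℝ₊)` to `L²(μ)`. -/
def graphSpace (μ : Measure ℝ) (h : μ (Iic 0) = 0) : Submodule ℂ (WithLp 2 (L2 × Lp ℂ 2 μ)) where
  carrier := {p | laplace p.fst =ᵐ[μ] p.snd}
  zero_mem' := by
    filter_upwards [Lp.coeFn_zero ℂ 2 μ] with x hx
    have : laplace 0 x = 0 := by simpa using laplace_smul 0 0 x
    change laplace 0 x = (0 : Lp ℂ 2 μ) x
    rw [this, hx]
    rfl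
  add_mem' := by
    intro p q hp hq
    have hp' : laplace p.fst =ᵐ[μ] p.snd := hp
    have hq' : laplace q.fst =ᵐ[μ] q.snd := hq
    change laplace (p.fst + q.fst) =ᵐ[μ] (p.snd + q.snd : Lp ℂ 2 μ)
    filter_upwards [hp', hq', Lp.coeFn_add p.snd q.snd, ae_pos h] with x h1 h2 h3 h4
    rw [h3, laplace_add _ _ h4, h1, h2, Pi.add_apply]
  smul_mem' := by
    intro c p hp
    have hp' : laplace p.fst =ᵐ[μ] p.snd := hp
    change laplace (c • p.fst) =ᵐ[μ] (c • p.snd : Lp ℂ 2 μ)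
    filter_upwards [hp', Lp.coeFn_smul c p.snd] with x h1 h2
    rw [h2, laplace_smul, h1, Pi.smul_apply, smul_eq_mul]

lemma isClosed_graphSpace {μ : Measure ℝ} (h : μ (Iic 0) = 0) :
    IsClosed (graphSpace μ h : Set (WithLp 2 (L2 × Lp ℂ 2 μ))) := by
  refine IsSeqClosed.isClosed fun p q hp hpq => ?_
  have h1 : Tendsto (fun n => (p n).fst) atTop (𝓝 q.fst) :=
    ((WithLp.fstL 2 ℂ L2 (Lp ℂ 2 μ)).continuous.tendsto q).comp hpq
  have h2 : Tendsto (fun n => (p n).snd) atTop (𝓝 q.snd) :=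
    ((WithLp.sndL 2 ℂ L2 (Lp ℂ 2 μ)).continuous.tendsto q).comp hpq
  obtain ⟨ns, hns, hae⟩ := (tendstoInMeasure_of_tendsto_Lp h2).exists_seq_tendsto_ae
  have hp' : ∀ᵐ x ∂μ, ∀ n, laplace (p n).fst x = (p n).snd x := ae_all_iff.2 fun n => hp n
  filter_upwards [hae, hp', ae_pos h] with x h3 h4 hx
  refine tendsto_nhds_unique ?_ h3
  have h5 : Tendsto (fun i => (p (ns i)).fst) atTop (𝓝 q.fst) := h1.comp hns.tendsto_atTop
  rw [laplace_eq_inner _ hx]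
  refine ((tendsto_const_nhds (x := expL2 x hx)).inner h5).congr fun i => ?_
  rw [← laplace_eq_inner _ hx, h4]

/-- A smooth compactly supported real function on `(0, ∞)` gives a test function. -/
lemma exists_testFunction {g : ℝ → ℝ} (hg : ContDiff ℝ ∞ g) (hs : HasCompactSupport g)
    (ht : tsupport g ⊆ Ioi 0) :
    ∃ G ∈ testFunctions, G =ᵐ[volume.restrict (Ioi (0 : ℝ))] fun t => (g t : ℂ) := by
  have h1 : ContDiff ℝ ∞ fun t => (g t : ℂ) := Complex.ofRealCLM.contDiff.comp hg
  have h2 : HasCompactSupport fun t => (g t : ℂ) := hs.comp_left (g := Complex.ofReal) rfl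
  have h3 : tsupport (fun t => (g t : ℂ)) ⊆ Ioi 0 :=
    (closure_mono (Function.support_comp_subset (g := Complex.ofReal) rfl g)).trans ht
  have h4 : MemLp (fun t => (g t : ℂ)) 2 (volume.restrict (Ioi (0 : ℝ))) :=
    h1.continuous.memLp_of_hasCompactSupport h2
  exact ⟨h4.toLp _, ⟨_, h1, h2, h3, h4.coeFn_toLp⟩, h4.coeFn_toLp⟩

lemma ae_eq_zero_of_forall_testFunction {F : ℝ → ℂ}
    (hF : LocallyIntegrableOn F (Ioi 0) (volume.restrict (Ioi (0 : ℝ))))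
    (h : ∀ g ∈ testFunctions, ∫ t in Ioi (0 : ℝ), F t * conj (g t) = 0) :
    F =ᵐ[volume.restrict (Ioi (0 : ℝ))] 0 := by
  have h1 := (isOpen_Ioi (a := (0 : ℝ))).ae_eq_zero_of_integral_contDiff_smul_eq_zero hF
    fun g hg hs ht => by
      obtain ⟨G, hG, hGe⟩ := exists_testFunction hg hs ht
      rw [← h G hG]
      refine integral_congr_ae ?_
      filter_upwards [hGe] with t ht
      rw [ht, Complex.conj_ofReal, mul_comm]
      exact Complex.real_smul
  filter_upwards [h1, ae_restrict_mem measurableSet_Ioi] with t h2 h3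
  exact h2 h3

/-- A model of the Hankel operator `Γ = L* L`, where `L` is the Laplace transform from `L²(ℝ₊)` to
`L²(μ)`: the functional calculus `Φ` of `Γ`, the operator `R = L (1 + Γ)^(-1/2)`, and the isometry
`V` for which `V L = Γ^(1/2)`. The equation `w = Γ f` is written as `f = (1 + Γ)⁻¹ (f + w)`. -/
structure IsModel (μ : Measure ℝ) (Φ : (ℝ →ᵇ ℂ) →⋆ₐ[ℂ] (L2 →L[ℂ] L2)) (R : L2 →L[ℂ] Lp ℂ 2 μ)
    (V : Lp ℂ 2 μ →L[ℂ] L2) : Prop where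
  calculus : IsPositiveCalculus Φ
  form : ∀ f w : L2, (f, w) ∈ hankelGraph μ ↔ f = Φ betaFun (f + w)
  graph : ∀ f w : L2, (f, w) ∈ (hankelOp μ).graph ↔ f = Φ betaFun (f + w)
  laplace_ae : ∀ k, laplace (Φ cFun k) =ᵐ[μ] R k
  mem_formDomain : ∀ f, f ∈ formDomain μ ↔ ∃ k, Φ cFun k = f
  dense : DenseRange R
  norm_V : ∀ u, ‖V u‖ = ‖u‖
  V_R : ∀ k, V (R k) = Φ dFun k

lemma exists_graphSpace_of_mem {μ : Measure ℝ} (h : μ (Iic 0) = 0) {f : L2}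
    (hf : f ∈ formDomain μ) : ∃ p : graphSpace μ h, p.1.fst = f := by
  have h1 := (mem_formDomain h).1 hf
  exact ⟨⟨WithLp.toLp 2 (f, h1.toLp _), h1.coeFn_toLp.symm⟩, rfl⟩

lemma eq_zero_of_forall_inner_testFunction {f : L2}
    (h : ∀ g ∈ testFunctions, inner ℂ g f = 0) : f = 0 := by
  rw [Lp.eq_zero_iff_ae_eq_zero]
  refine ae_eq_zero_of_forall_testFunction
    (((Lp.memLp f).locallyIntegrable one_le_two).locallyIntegrableOn _) fun g hg => ?_
  rw [← h g hg, L2.inner_def]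
  rfl

/-- If `u ∈ L²(μ)` is orthogonal to the Laplace transforms of all test functions, then `u = 0`. -/
lemma eq_zero_of_forall_laplace_testFunction {μ : Measure ℝ} [IsFiniteMeasure μ]
    (h : μ (Iic 0) = 0) {u : Lp ℂ 2 μ}
    (hu : ∀ g ∈ testFunctions, ∫ x, u x * conj (laplace g x) ∂μ = 0) : u = 0 := by
  have hui : Integrable u μ := (Lp.memLp u).integrable one_le_two
  have hc := continuousOn_integral_exp_mul h hui
  have h1 : (fun t : ℝ => ∫ x, (Real.exp (-t * x) : ℂ) * u x ∂μ)
      =ᵐ[volume.restrict (Ioi (0 : ℝ))] 0 := by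
    refine ae_eq_zero_of_forall_testFunction ?_ fun g hg => ?_
    · exact (hc.locallyIntegrableOn measurableSet_Ioi).mono_measure Measure.restrict_le_self
    · rw [← integral_mul_conj_laplace h (integrable_testFunction hg) hui]
      exact hu g hg
  have h2 := Measure.eqOn_open_of_ae_eq h1 isOpen_Ioi hc continuousOn_const
  rw [Lp.eq_zero_iff_ae_eq_zero]
  exact ae_eq_zero_of_integral_exp_mul_eq_zero h hui fun t ht => h2 ht

/-- The Hankel operator has a model. -/
theorem exists_model (μ : Measure ℝ) [IsFiniteMeasure μ] (h : μ (Iic 0) = 0) :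
    ∃ Φ R V, IsModel μ Φ R V := by
  have : CompleteSpace (graphSpace μ h) := (isClosed_graphSpace h).completeSpace_coe
  let J : graphSpace μ h →L[ℂ] L2 := WithLp.fstL 2 ℂ L2 (Lp ℂ 2 μ) ∘L (graphSpace μ h).subtypeL
  let T : graphSpace μ h →L[ℂ] Lp ℂ 2 μ :=
    WithLp.sndL 2 ℂ L2 (Lp ℂ 2 μ) ∘L (graphSpace μ h).subtypeL
  have hJa : ∀ p, J p = p.1.fst := fun p => rfl
  have hTa : ∀ p, T p = p.1.snd := fun p => rfl
  have hJT : ∀ p q, inner ℂ (J p) (J q) + inner ℂ (T p) (T q) = inner ℂ p q := fun p q =>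
    (WithLp.prod_inner_apply (𝕜 := ℂ) p.1 q.1).symm
  have hlap : ∀ p, laplace (J p) =ᵐ[μ] T p := fun p => p.2
  have hJ : Function.Injective J := by
    rw [injective_iff_map_eq_zero]
    intro p hp
    have h1 : T p = 0 := by
      rw [Lp.eq_zero_iff_ae_eq_zero]
      filter_upwards [hlap p] with x hx
      rw [← hx, hp]
      simpa using laplace_smul 0 0 x
    have h2 := hJT p p
    rw [hp, h1, inner_zero_left, inner_zero_left, add_zero] at h2
    exact inner_self_eq_zero.1 h2.symm
  have hmem : ∀ f, f ∈ formDomain μ ↔ ∃ p, J p = f := by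
    intro f
    refine ⟨exists_graphSpace_of_mem h, ?_⟩
    rintro ⟨p, rfl⟩
    rw [mem_formDomain h]
    exact (memLp_congr_ae (hlap p)).2 (Lp.memLp _)
  have hJd : DenseRange J := by
    have h1 : (LinearMap.range (J : graphSpace μ h →ₗ[ℂ] L2)).topologicalClosure = ⊤ := by
      rw [Submodule.topologicalClosure_eq_top_iff, Submodule.eq_bot_iff]
      intro f hf
      rw [Submodule.mem_orthogonal] at hf
      refine eq_zero_of_forall_inner_testFunction fun g hg => hf g ?_
      exact (hmem g).1 (testFunction_mem_formDomain h hg)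
    rw [← Submodule.dense_iff_topologicalClosure_eq_top] at h1
    exact h1
  have hTd : DenseRange T := by
    have h1 : (LinearMap.range (T : graphSpace μ h →ₗ[ℂ] Lp ℂ 2 μ)).topologicalClosure = ⊤ := by
      rw [Submodule.topologicalClosure_eq_top_iff, Submodule.eq_bot_iff]
      intro u hu
      rw [Submodule.mem_orthogonal] at hu
      refine eq_zero_of_forall_laplace_testFunction h fun g hg => ?_
      obtain ⟨p, hp⟩ := (hmem g).1 (testFunction_mem_formDomain h hg)
      rw [← hu (T p) ⟨p, rfl⟩, L2.inner_def]
      refine integral_congr_ae ?_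
      filter_upwards [hlap p] with x hx
      rw [← hx, hp]
      rfl
    rw [← Submodule.dense_iff_topologicalClosure_eq_top] at h1
    exact h1
  obtain ⟨Φ, R, V, hΦ, hβ, hR1, hR2, hRd, hV, hVR⟩ := exists_polar hJT hJ hJd hTd
  have hgraph : ∀ f w : L2, (f, w) ∈ hankelGraph μ ↔ f = Φ betaFun (f + w) := by
    intro f w
    have hform : ∀ p q, formPairing μ (J p) (J q) = inner ℂ (T q) (T p) := by
      intro p q
      rw [formPairing, restrict_Ioi h, L2.inner_def]
      refine integral_congr_ae ?_
      filter_upwards [hlap p, hlap q] with x h1 h2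
      rw [← h1, ← h2]
      rfl
    have hiff : ∀ p, (∀ g ∈ formDomain μ, formPairing μ (J p) g = inner ℂ g w)
        ↔ p = J.adjoint (J p + w) := by
      intro p
      constructor
      · intro h1
        refine ext_inner_left ℂ fun q => ?_
        rw [ContinuousLinearMap.adjoint_inner_right, inner_add_right, ← hJT q p, ← hform,
          h1 _ ((hmem _).2 ⟨q, rfl⟩)]
      · intro h1 g hg
        obtain ⟨q, rfl⟩ := (hmem g).1 hg
        have h2 := congrArg (inner ℂ q) h1
        rw [ContinuousLinearMap.adjoint_inner_right, inner_add_right, ← hJT q p,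
          add_right_inj] at h2
        rw [hform, h2]
    rw [hβ]
    constructor
    · rintro ⟨h1, h2⟩
      obtain ⟨p, rfl⟩ := (hmem f).1 h1
      exact congrArg J ((hiff p).1 h2)
    · intro h1
      have h2 : f = J (J.adjoint (f + w)) := h1
      refine ⟨(hmem f).2 ⟨_, h2.symm⟩, ?_⟩
      have h3 := (hiff (J.adjoint (f + w))).2 (by rw [← h2])
      rwa [← h2] at h3
  refine ⟨Φ, R, V, hΦ, hgraph, fun f w => ?_, fun k => ?_, fun f => ?_, hRd, hV, hVR⟩
  · rw [hankelOp, Submodule.toLinearPMap_graph_eq]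
    · exact hgraph f w
    · rintro ⟨f', w'⟩ h1 h2
      have h2' : f' = 0 := h2
      rw [h2', hgraph, zero_add, eq_comm] at h1
      exact hΦ.eq_zero_of_betaFun h1
  · obtain ⟨p, h1, h2⟩ := hR1 k
    rw [← h1, ← h2]
    exact hlap p
  · rw [hmem]
    constructor
    · rintro ⟨p, rfl⟩
      obtain ⟨k, hk, -⟩ := hR2 p
      exact ⟨k, hk.symm⟩
    · rintro ⟨k, rfl⟩
      obtain ⟨p, hp, -⟩ := hR1 k
      exact ⟨p, hp⟩

end Model

/-! ### The distinguished element and its spectral measure -/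

section Distinguished

open Filter Topology

/-- The constant function `1` in `L²(μ)`. -/
def one2 (μ : Measure ℝ) [IsFiniteMeasure μ] : Lp ℂ 2 μ := Lp.const 2 μ (1 : ℂ)

lemma coeFn_one2 (μ : Measure ℝ) [IsFiniteMeasure μ] : one2 μ =ᵐ[μ] fun _ => (1 : ℂ) :=
  Lp.coeFn_const _ _ _

lemma inner_one2 {μ : Measure ℝ} [IsFiniteMeasure μ] (u : Lp ℂ 2 μ) :
    inner ℂ (one2 μ) u = ∫ x, u x ∂μ := by
  rw [L2.inner_def]
  refine integral_congr_ae ?_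
  filter_upwards [coeFn_one2 μ] with x hx
  rw [hx, RCLike.inner_apply, map_one, mul_one]

namespace IsModel

variable {μ : Measure ℝ} {Φ : (ℝ →ᵇ ℂ) →⋆ₐ[ℂ] (L2 →L[ℂ] L2)} {R : L2 →L[ℂ] Lp ℂ 2 μ}
  {V : Lp ℂ 2 μ →L[ℂ] L2}

lemma inner_V (m : IsModel μ Φ R V) (u w : Lp ℂ 2 μ) : inner ℂ (V u) (V w) = inner ℂ u w :=
  (LinearMap.norm_map_iff_inner_map_map V).1 m.norm_V u w

lemma V_mem_closure (m : IsModel μ Φ R V) (u : Lp ℂ 2 μ) : V u ∈ closure (range (Φ dFun)) := by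
  refine m.dense.induction_on (p := fun u => V u ∈ closure (range (Φ dFun))) u
    (isClosed_closure.preimage V.continuous) fun k => ?_
  rw [m.V_R]
  exact subset_closure ⟨k, rfl⟩

lemma closure_subset_range_V (m : IsModel μ Φ R V) :
    closure (range (Φ dFun)) ⊆ range V := by
  have hiso : Isometry V := AddMonoidHomClass.isometry_of_norm V m.norm_V
  refine closure_minimal ?_ hiso.isClosedEmbedding.isClosed_range
  rintro _ ⟨k, rfl⟩
  exact ⟨R k, m.V_R k⟩

lemma mem_range_hankelOp (m : IsModel μ Φ R V) {w : L2} :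
    w ∈ range (hankelOp μ) ↔ ∃ k, Φ dFun (Φ dFun k) = w := by
  constructor
  · rintro ⟨x, rfl⟩
    have h := (m.graph x (hankelOp μ x)).1 ((hankelOp μ).mem_graph x)
    refine ⟨x + hankelOp μ x, ?_⟩
    rw [dFun_dFun_apply, ← h]
    abel
  · rintro ⟨k, rfl⟩
    rw [dFun_dFun_apply]
    obtain ⟨x, -, hx⟩ := (LinearPMap.mem_graph_iff _).1
      ((m.graph (Φ betaFun k) (k - Φ betaFun k)).2 (by simp))
    exact ⟨x, hx⟩

/-- `Ran Γ` and `Ran Γ^(1/2)` have the same closure. -/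
lemma closure_range_hankelOp (m : IsModel μ Φ R V) :
    closure (range (hankelOp μ)) = closure (range (Φ dFun)) := by
  apply subset_antisymm
  · refine closure_mono ?_
    intro w hw
    obtain ⟨k, rfl⟩ := m.mem_range_hankelOp.1 hw
    exact ⟨_, rfl⟩
  · refine closure_minimal ?_ isClosed_closure
    rintro _ ⟨k, rfl⟩
    let N : Submodule ℂ L2 := LinearMap.range (Φ (dFun * dFun) : L2 →ₗ[ℂ] L2)
    have hN : (N : Set L2) ⊆ range (hankelOp μ) := by
      rintro _ ⟨l, rfl⟩
      refine m.mem_range_hankelOp.2 ⟨l, ?_⟩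
      rw [calculus_mul]
      rfl
    have h1 : Φ dFun k ∈ Nᗮᗮ := by
      rw [Submodule.mem_orthogonal]
      intro x hx
      rw [Submodule.mem_orthogonal] at hx
      have h2 : Φ dFun (Φ dFun x) = 0 := by
        refine ext_inner_left ℂ fun y => ?_
        rw [inner_zero_right, ← hx _ ⟨y, rfl⟩]
        change _ = inner ℂ (Φ (dFun * dFun) y) x
        rw [← calculus_mul, inner_calculus_left, inner_calculus_left, star_dFun]
      have h3 : Φ dFun x = 0 := by
        rw [← inner_self_eq_zero (𝕜 := ℂ), inner_calculus_left, star_dFun, h2,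
          inner_zero_right]
      rw [← star_dFun, ← inner_calculus_left, h3, inner_zero_left]
    rw [Submodule.orthogonal_orthogonal_eq_closure] at h1
    exact closure_mono hN h1

/-- If `g = C k` then `R k = 𝓛 g`, so the pairing of `h_μ` with `g` is `⟨1, 𝓛 g⟩` in `L²(μ)`. -/
lemma inner_R_one (m : IsModel μ Φ R V) [IsFiniteMeasure μ] (h : μ (Iic 0) = 0) {g k : L2}
    (hg : g ∈ testFunctions) (hk : Φ cFun k = g) :
    inner ℂ (R k) (one2 μ) = ∫ t in Ioi (0 : ℝ), (kernelFun μ t : ℂ) * conj (g t) := by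
  have h1 := integral_mul_conj_laplace h (integrable_testFunction hg) (u := fun _ => (1 : ℂ))
    (integrable_const 1)
  have h2 : ∀ t, ∫ x, (Real.exp (-t * x) : ℂ) * 1 ∂μ = (kernelFun μ t : ℂ) := by
    intro t
    rw [kernelFun, restrict_Ioi h, ← integral_complex_ofReal]
    simp only [mul_one]
  simp_rw [h2] at h1
  rw [← h1, L2.inner_def]
  refine integral_congr_ae ?_
  filter_upwards [m.laplace_ae k, coeFn_one2 μ] with x h3 h4
  rw [h4, ← h3, hk]
  rfl

/-- The image of `1 ∈ L²(μ)` under `V` is the distinguished element. -/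
theorem isDistinguished_iff (m : IsModel μ Φ R V) [IsFiniteMeasure μ] (h : μ (Iic 0) = 0) {v : L2} :
    IsDistinguished μ v ↔ v = V (one2 μ) := by
  have hinner : ∀ {g k : L2}, g ∈ testFunctions → Φ cFun k = g →
      inner ℂ (Φ dFun k) (V (one2 μ))
        = ∫ t in Ioi (0 : ℝ), (kernelFun μ t : ℂ) * conj (g t) := by
    intro g k hg hk
    rw [← m.V_R, m.inner_V, m.inner_R_one h hg hk]
  constructor
  · rintro ⟨h1, S, hS, hv⟩
    rw [m.calculus.eq_sqrtOp m.graph hS] at hv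
    obtain ⟨u, rfl⟩ := m.closure_subset_range_V (m.closure_range_hankelOp ▸ h1)
    congr 1
    rw [← sub_eq_zero]
    refine eq_zero_of_forall_laplace_testFunction h fun g hg => ?_
    obtain ⟨hgS, hg'⟩ := hv g hg
    obtain ⟨k, hk, hk'⟩ := m.calculus.mem_graph_sqrtOp.1 ((sqrtOp Φ).mem_graph ⟨g, hgS⟩)
    simp only at hk
    rw [← hk', ← hinner hg hk, ← sub_eq_zero, ← inner_sub_right, ← map_sub, ← m.V_R, m.inner_V,
      L2.inner_def] at hg'
    rw [← hg']
    refine integral_congr_ae ?_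
    filter_upwards [m.laplace_ae k] with x hx
    rw [← hx, hk]
    rfl
  · rintro rfl
    refine ⟨m.closure_range_hankelOp ▸ m.V_mem_closure _, sqrtOp Φ,
      m.calculus.isPosSqrt_sqrtOp m.graph, fun g hg => ?_⟩
    obtain ⟨k, hk⟩ := (m.mem_formDomain g).1 (testFunction_mem_formDomain h hg)
    obtain ⟨x, hx, hx'⟩ := (LinearPMap.mem_graph_iff _).1
      (m.calculus.mem_graph_sqrtOp.2 ⟨k, rfl, rfl⟩)
    simp only at hx hx'
    have hxg : (x : L2) = g := hx.trans hk
    subst hxg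
    exact ⟨x.2, by rw [Subtype.coe_eta, hx', hinner hg hk]⟩

theorem isSpectralImage_iff (m : IsModel μ Φ R V) [IsFiniteMeasure μ] (h : μ (Iic 0) = 0)
    {σ : Measure ℝ} :
    IsSpectralImage μ σ ↔ IsFiniteMeasure σ ∧
      ∀ φ : ℝ →ᵇ ℂ, inner ℂ (V (one2 μ)) (Φ φ (V (one2 μ))) = ∫ x, φ x ∂σ := by
  have hfc : IsFunctionalCalculus (hankelOp μ) Φ := m.calculus.isFunctionalCalculus _ m.graph
  constructor
  · rintro ⟨v, hv, hσ, Φ', hΦ', hσ'⟩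
    rw [m.isDistinguished_iff h] at hv
    subst hv
    obtain ⟨τ, hτ, -, hτ'⟩ := m.calculus.exists_measure (V (one2 μ))
    have : σ = τ := measure_ext_of_resolvent fun φ hφ => by
      rw [← hσ', ← hτ', hfc.eqOn_adjoin hΦ' hφ]
    subst this
    exact ⟨hσ, hτ'⟩
  · rintro ⟨h1, h2⟩
    exact ⟨_, (m.isDistinguished_iff h).2 rfl, h1, Φ, hfc, h2⟩

end IsModel

/-- A finite measure has exactly one spectral image; it is finite, and does not charge `(-∞, 0]`
because `Γ` is positive and `v_μ` lies in the closure of its range. -/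
theorem exists_spectralImage (μ : Measure ℝ) (hμ : μ ∈ classFinite) :
    ∃ σ ∈ classFinite, ∀ τ, IsSpectralImage μ τ ↔ τ = σ := by
  have hfin : IsFiniteMeasure μ := hμ.2
  have h : μ (Iic 0) = 0 := hμ.1.1
  obtain ⟨Φ, R, V, m⟩ := exists_model μ h
  obtain ⟨σ, hσ, hσ0, hσ'⟩ := m.calculus.exists_measure (V (one2 μ))
  have h0 : σ (Iic 0) = 0 := by
    have h1 := m.calculus.measure_singleton_zero hσ' (m.V_mem_closure _)
    rw [← Iio_union_right]
    exact measure_union_null hσ0 h1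
  refine ⟨σ, ⟨⟨h0, fun t ht => ?_⟩, hσ⟩, fun τ => ?_⟩
  · calc ∫⁻ x, ENNReal.ofReal (Real.exp (-t * x)) ∂σ ≤ ∫⁻ _, 1 ∂σ := by
          refine lintegral_mono_ae ?_
          filter_upwards [ae_pos h0] with x hx
          refine ENNReal.ofReal_le_one.2 (Real.exp_le_one_iff.2 ?_)
          have := mul_pos ht hx
          linarith
      _ < ⊤ := by simp
  · rw [m.isSpectralImage_iff h]
    constructor
    · rintro ⟨h1, h2⟩
      exact measure_ext_of_resolvent fun φ _ => by rw [← h2, ← hσ']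
    · rintro rfl
      exact ⟨hσ, hσ'⟩

/-- The spectral map is well defined on finite measures. -/
theorem spectralMap_mem_and_iff {μ : Measure ℝ} (hμ : μ ∈ classFinite) :
    spectralMap μ ∈ classFinite ∧ ∀ σ, IsSpectralImage μ σ ↔ σ = spectralMap μ := by
  obtain ⟨σ, hσ, hiff⟩ := exists_spectralImage μ hμ
  have hex : ∃ σ, IsSpectralImage μ σ := ⟨σ, (hiff σ).2 rfl⟩
  have : spectralMap μ = σ := by
    rw [spectralMap, dif_pos hex]
    exact (hiff _).1 hex.choose_spec
  rw [this]
  exact ⟨hσ, hiff⟩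

end Distinguished

/-! ### The Carleson embedding -/

section Carleson

open Filter Topology

/-- The Carleson condition for intervals `(0, a)` gives `μ ≤ C · volume` on all initial segments of
`(0, ∞)`: open, half-closed, or the half-line itself. -/
lemma measure_le_of_carleson {μ : Measure ℝ} {C : ℝ} (hC : 0 < C)
    (hμ : ∀ a : ℝ, 0 < a → μ (Ioo 0 a) ≤ ENNReal.ofReal (C * a)) {D : Set ℝ} (hD : D ⊆ Ioi 0)
    (hdown : ∀ x ∈ D, Ioc 0 x ⊆ D) : μ D ≤ ENNReal.ofReal C * volume D := by
  rcases D.eq_empty_or_nonempty with rfl | ⟨x₀, hx₀⟩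
  · simp
  by_cases hb : BddAbove D
  · set a := sSup D
    have ha : 0 < a := (hD hx₀).trans_le (le_csSup hb hx₀)
    have h1 : D ⊆ Ioc 0 a := fun x hx => ⟨hD hx, le_csSup hb hx⟩
    have h2 : Ioo 0 a ⊆ D := fun x hx => by
      obtain ⟨y, hy, hxy⟩ := exists_lt_of_lt_csSup ⟨x₀, hx₀⟩ hx.2
      exact hdown y hy ⟨hx.1, hxy.le⟩
    have h3 : μ (Ioc 0 a) ≤ ENNReal.ofReal (C * a) := by
      have h4 : Tendsto (fun b : ℝ => ENNReal.ofReal (C * b)) (𝓝[>] a)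
          (𝓝 (ENNReal.ofReal (C * a))) :=
        ((ENNReal.continuous_ofReal.comp (continuous_const.mul continuous_id)).tendsto a).mono_left
          nhdsWithin_le_nhds
      refine ge_of_tendsto h4 ?_
      filter_upwards [self_mem_nhdsWithin] with b hb
      exact (measure_mono (Ioc_subset_Ioo_right hb)).trans (hμ b (ha.trans hb))
    calc μ D ≤ ENNReal.ofReal (C * a) := (measure_mono h1).trans h3
      _ = ENNReal.ofReal C * volume (Ioo 0 a) := by
          rw [Real.volume_Ioo, sub_zero, ENNReal.ofReal_mul hC.le]
      _ ≤ _ := by gcongr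
  · have h1 : D = Ioi 0 := by
      refine subset_antisymm hD fun x hx => ?_
      obtain ⟨y, hy, hxy⟩ := not_bddAbove_iff.1 hb x
      exact hdown y hy ⟨hx, hxy.le⟩
    rw [h1, Real.volume_Ioi, ENNReal.mul_top (by simpa using hC)]
    exact le_top

/-- Under the Carleson condition, integrals of decreasing functions are dominated by the Lebesgue
integral (layer cake). -/
lemma lintegral_le_of_carleson {μ : Measure ℝ} {C : ℝ} (hC : 0 < C)
    (hμ : ∀ a : ℝ, 0 < a → μ (Ioo 0 a) ≤ ENNReal.ofReal (C * a)) {f : ℝ → ℝ}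
    (hf : AntitoneOn f (Ioi 0)) (hf0 : ∀ x, 0 < x → 0 ≤ f x) (hm : Measurable f) :
    ∫⁻ x in Ioi (0 : ℝ), ENNReal.ofReal (f x) ∂μ
      ≤ ENNReal.ofReal C * ∫⁻ x in Ioi (0 : ℝ), ENNReal.ofReal (f x) := by
  have h0 : ∀ ν : Measure ℝ, 0 ≤ᵐ[ν.restrict (Ioi 0)] f := fun ν => by
    filter_upwards [ae_restrict_mem measurableSet_Ioi] with x hx
    exact hf0 x hx
  rw [lintegral_eq_lintegral_meas_lt _ (h0 μ) hm.aemeasurable,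
    lintegral_eq_lintegral_meas_lt _ (h0 volume) hm.aemeasurable,
    ← lintegral_const_mul' _ _ ENNReal.ofReal_ne_top]
  refine lintegral_mono fun s => ?_
  have hms : MeasurableSet {a | s < f a} := measurableSet_lt measurable_const hm
  rw [Measure.restrict_apply hms, Measure.restrict_apply hms]
  refine measure_le_of_carleson hC hμ inter_subset_right fun x hx y hy => ?_
  exact ⟨lt_of_lt_of_le hx.1 (hf hy.1 hx.2 hy.2), hy.1⟩

/-- `∫₀^∞ x^(-1/2) e^{-tx} dx = Γ(1/2) t^(-1/2)`. -/
lemma lintegral_rpow_mul_exp {t : ℝ} (ht : 0 < t) :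
    ∫⁻ x in Ioi (0 : ℝ), ENNReal.ofReal (x ^ (-(1 / 2) : ℝ) * Real.exp (-t * x))
      = ENNReal.ofReal (Real.Gamma (1 / 2) * t ^ (-(1 / 2) : ℝ)) := by
  have h1 : ∫ x in Ioi (0 : ℝ), x ^ (-(1 / 2) : ℝ) * Real.exp (-t * x)
      = Real.Gamma (1 / 2) * t ^ (-(1 / 2) : ℝ) := by
    have := Real.integral_rpow_mul_exp_neg_mul_Ioi (a := 1 / 2) (by norm_num) ht
    rw [show (1 / 2 - 1 : ℝ) = -(1 / 2) by norm_num] at this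
    simp only [neg_mul]
    rw [this, mul_comm, one_div t, Real.inv_rpow ht.le, Real.rpow_neg ht.le]
  have h2 : 0 < Real.Gamma (1 / 2) * t ^ (-(1 / 2) : ℝ) :=
    mul_pos (Real.Gamma_pos_of_pos (by norm_num)) (Real.rpow_pos_of_pos ht _)
  rw [← h1, ofReal_integral_eq_lintegral_ofReal]
  · exact not_imp_comm.1 integral_undef (by rw [h1]; exact h2.ne')
  · filter_upwards [ae_restrict_mem measurableSet_Ioi] with x hx
    have : (0 : ℝ) < x := hx
    positivity

/-- The Cauchy-Schwarz inequality with the weight `t^(1/2)`. -/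
lemma enorm_laplace_sq_le (f : L2) {x : ℝ} (hx : 0 < x) :
    ‖laplace f x‖ₑ ^ 2 ≤ ENNReal.ofReal (Real.Gamma (1 / 2) * x ^ (-(1 / 2) : ℝ)) *
      ∫⁻ t in Ioi (0 : ℝ), ENNReal.ofReal (t ^ (1 / 2 : ℝ) * Real.exp (-t * x)) * ‖f t‖ₑ ^ 2 := by
  set A : ℝ → ENNReal := fun t => ENNReal.ofReal √(t ^ (-(1 / 2) : ℝ) * Real.exp (-x * t))
  set B : ℝ → ENNReal := fun t => ENNReal.ofReal √(t ^ (1 / 2 : ℝ) * Real.exp (-t * x)) * ‖f t‖ₑ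
  have hA : AEMeasurable A (volume.restrict (Ioi (0 : ℝ))) := by fun_prop
  have hB : AEMeasurable B (volume.restrict (Ioi (0 : ℝ))) :=
    AEMeasurable.mul (by fun_prop) (Lp.aestronglyMeasurable f).enorm
  have h1 : ‖laplace f x‖ₑ ≤ ∫⁻ t in Ioi (0 : ℝ), (A * B) t := by
    refine (enorm_integral_le_lintegral_enorm _).trans (lintegral_mono_ae ?_)
    filter_upwards [ae_restrict_mem measurableSet_Ioi] with t ht
    have ht' : (0 : ℝ) < t := ht
    have e : √(t ^ (-(1 / 2) : ℝ) * Real.exp (-x * t)) * √(t ^ (1 / 2 : ℝ) * Real.exp (-t * x))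
        = Real.exp (-t * x) := by
      rw [← Real.sqrt_mul (by positivity), mul_mul_mul_comm, ← Real.rpow_add ht',
        show (-(1 / 2) + 1 / 2 : ℝ) = 0 by norm_num, Real.rpow_zero, one_mul,
        show -x * t = -t * x by ring, Real.sqrt_mul_self (Real.exp_pos _).le]
    rw [Pi.mul_apply, ← mul_assoc, ← ENNReal.ofReal_mul (Real.sqrt_nonneg _), e, enorm_mul]
    gcongr
    rw [← ofReal_norm, Complex.norm_real, Real.norm_eq_abs, abs_of_pos (Real.exp_pos _)]
  have h2 := ENNReal.lintegral_mul_le_Lp_mul_Lq (volume.restrict (Ioi (0 : ℝ)))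
    Real.HolderConjugate.two_two hA hB
  have h3 := pow_le_pow_left' (h1.trans h2) 2
  have h4 : ∀ c : ENNReal, (c ^ (1 / 2 : ℝ)) ^ 2 = c := fun c => by
    rw [← ENNReal.rpow_natCast, ← ENNReal.rpow_mul]
    norm_num
  rw [mul_pow, h4, h4] at h3
  refine h3.trans (le_of_eq ?_)
  congr 1
  · rw [← lintegral_rpow_mul_exp hx]
    refine setLIntegral_congr_fun measurableSet_Ioi fun t ht => ?_
    have ht' : (0 : ℝ) < t := ht
    simp only [A]
    rw [ENNReal.rpow_two, ← ENNReal.ofReal_pow (Real.sqrt_nonneg _), Real.sq_sqrt (by positivity)]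
  · refine setLIntegral_congr_fun measurableSet_Ioi fun t ht => ?_
    have ht' : (0 : ℝ) < t := ht
    simp only [B]
    rw [ENNReal.rpow_two, mul_pow, ← ENNReal.ofReal_pow (Real.sqrt_nonneg _),
      Real.sq_sqrt (by positivity)]

/-- The Carleson embedding: the Laplace transform is bounded from `L²(ℝ₊)` to `L²(μ)` (Schur
test). -/
theorem lintegral_enorm_laplace_sq_le {μ : Measure ℝ} [IsFiniteMeasure μ] {C : ℝ} (hC : 0 < C)
    (h : μ (Iic 0) = 0) (hμ : ∀ a : ℝ, 0 < a → μ (Ioo 0 a) ≤ ENNReal.ofReal (C * a)) (f : L2) :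
    ∫⁻ x, ‖laplace f x‖ₑ ^ 2 ∂μ
      ≤ ENNReal.ofReal (C * Real.Gamma (1 / 2) ^ 2) * ∫⁻ t in Ioi (0 : ℝ), ‖f t‖ₑ ^ 2 := by
  have hΓ : 0 < Real.Gamma (1 / 2) := Real.Gamma_pos_of_pos (by norm_num)
  have hfm : AEMeasurable (fun t => ‖f t‖ₑ) (volume.restrict (Ioi (0 : ℝ))) :=
    (Lp.aestronglyMeasurable f).enorm
  set F : ℝ → ℝ → ENNReal := fun x t =>
    ENNReal.ofReal (Real.Gamma (1 / 2) * x ^ (-(1 / 2) : ℝ)) *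
      (ENNReal.ofReal (t ^ (1 / 2 : ℝ) * Real.exp (-t * x)) * ‖f t‖ₑ ^ 2)
  calc ∫⁻ x, ‖laplace f x‖ₑ ^ 2 ∂μ ≤ ∫⁻ x, (∫⁻ t in Ioi (0 : ℝ), F x t) ∂μ := by
        refine lintegral_mono_ae ?_
        filter_upwards [ae_pos h] with x hx
        rw [lintegral_const_mul' _ _ ENNReal.ofReal_ne_top]
        exact enorm_laplace_sq_le f hx
    _ = ∫⁻ t in Ioi (0 : ℝ), ∫⁻ x, F x t ∂μ := by
        refine lintegral_lintegral_swap ?_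
        have h1 : Measurable fun z : ℝ × ℝ =>
            ENNReal.ofReal (Real.Gamma (1 / 2) * z.1 ^ (-(1 / 2) : ℝ)) := by fun_prop
        have h2 : Measurable fun z : ℝ × ℝ =>
            ENNReal.ofReal (z.2 ^ (1 / 2 : ℝ) * Real.exp (-z.2 * z.1)) := by fun_prop
        exact h1.aemeasurable.mul (h2.aemeasurable.mul ((hfm.comp_snd (μ := μ)).pow_const 2))
    _ ≤ ∫⁻ t in Ioi (0 : ℝ), ENNReal.ofReal (C * Real.Gamma (1 / 2) ^ 2) * ‖f t‖ₑ ^ 2 := by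
        refine lintegral_mono_ae ?_
        filter_upwards [ae_restrict_mem measurableSet_Ioi] with t ht
        have ht' : (0 : ℝ) < t := ht
        have hanti : AntitoneOn (fun x : ℝ => x ^ (-(1 / 2) : ℝ) * Real.exp (-t * x)) (Ioi 0) := by
          intro x hx y hy hxy
          have hx' : (0 : ℝ) < x := hx
          have h1 : y ^ (-(1 / 2) : ℝ) ≤ x ^ (-(1 / 2) : ℝ) :=
            Real.rpow_le_rpow_of_nonpos hx' hxy (by norm_num)
          have h2 : Real.exp (-t * y) ≤ Real.exp (-t * x) := by
            apply Real.exp_le_exp.2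
            nlinarith
          exact mul_le_mul h1 h2 (Real.exp_pos _).le (by positivity)
        have h3 := lintegral_le_of_carleson hC hμ hanti (fun x hx => by positivity) (by fun_prop)
        rw [restrict_Ioi h, lintegral_rpow_mul_exp ht'] at h3
        have h4 : ∀ᵐ x ∂μ, F x t = (ENNReal.ofReal (Real.Gamma (1 / 2) * t ^ (1 / 2 : ℝ)) *
            ‖f t‖ₑ ^ 2) * ENNReal.ofReal (x ^ (-(1 / 2) : ℝ) * Real.exp (-t * x)) := by
          filter_upwards [ae_pos h] with x hx
          simp only [F]
          rw [mul_right_comm, ← mul_assoc, ← ENNReal.ofReal_mul (by positivity),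
            ← ENNReal.ofReal_mul (by positivity)]
          congr 2
          ring
        rw [lintegral_congr_ae h4, lintegral_const_mul' _ _ (by finiteness)]
        calc _ ≤ (ENNReal.ofReal (Real.Gamma (1 / 2) * t ^ (1 / 2 : ℝ)) * ‖f t‖ₑ ^ 2) *
              (ENNReal.ofReal C * ENNReal.ofReal (Real.Gamma (1 / 2) * t ^ (-(1 / 2) : ℝ))) := by
                gcongr
          _ = _ := by
            rw [mul_right_comm, ← ENNReal.ofReal_mul hC.le, ← ENNReal.ofReal_mul (by positivity)]
            congr 2
            have h5 : t ^ (1 / 2 : ℝ) * t ^ (-(1 / 2) : ℝ) = 1 := by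
              rw [← Real.rpow_add ht']
              norm_num
            linear_combination (Real.Gamma (1 / 2) ^ 2 * C) * h5
    _ = _ := lintegral_const_mul' _ _ ENNReal.ofReal_ne_top

end Carleson

/-! ### The Carleson condition and the support of the spectral measure -/

section SupportBound

open Filter Topology

lemma enorm_sq_eq_lintegral {μ : Measure ℝ} (u : Lp ℂ 2 μ) :
    ‖u‖ₑ ^ 2 = ∫⁻ x, ‖u x‖ₑ ^ 2 ∂μ := by
  have := eLpNorm_nnreal_pow_eq_lintegral (μ := μ) (f := u) (p := 2) two_ne_zero
  simp only [ENNReal.coe_ofNat, NNReal.coe_ofNat, ENNReal.rpow_two] at this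
  rw [Lp.enorm_def, this]

lemma isBounded_support_iff {σ : Measure ℝ} (h : σ (Iic 0) = 0) :
    Bornology.IsBounded σ.support ↔ ∃ M, 0 < M ∧ σ (Ioi M) = 0 := by
  constructor
  · intro hb
    obtain ⟨M, hM⟩ := hb.bddAbove
    refine ⟨max M 1, by positivity, measure_mono_null (t := σ.supportᶜ) (fun x hx hx' => ?_)
      (Measure.measure_compl_support (μ := σ))⟩
    have h1 : M < x := (le_max_left M 1).trans_lt hx
    exact h1.not_ge (hM hx')
  · rintro ⟨M, -, hM⟩
    refine (Metric.isBounded_Icc 0 M).subset (Measure.support_subset_of_isClosed isClosed_Icc ?_)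
    filter_upwards [ae_pos h, measure_eq_zero_iff_ae_notMem.1 hM] with x h1 h2
    exact ⟨h1.le, not_lt.1 h2⟩

lemma norm_realBCF_le (f : ℝ → ℝ) (hf : Continuous f) (C : ℝ) (hC : ∀ s, |f s| ≤ C) (s : ℝ) :
    ‖realBCF f hf C hC s‖ ≤ C := by
  simpa using hC s

/-- `s ↦ s^(n + 1/2)` on `[0, M]`, extended by constants. -/
def halfPowFun (M : ℝ) (n : ℕ) : ℝ →ᵇ ℂ :=
  realBCF (fun s => (min (max s 0) M) ^ n * √(min (max s 0) M)) (by fun_prop) (|M| ^ n * √|M|)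
    fun s => by
      have h1 : |min (max s 0) M| ≤ |M| := by
        rcases le_total (max s 0) M with h | h
        · rw [min_eq_left h, abs_of_nonneg (le_max_right _ _)]
          exact h.trans (le_abs_self _)
        · rw [min_eq_right h]
      rw [abs_mul, abs_pow, abs_of_nonneg (Real.sqrt_nonneg _)]
      exact mul_le_mul (pow_le_pow_left₀ (abs_nonneg _) h1 n)
        (Real.sqrt_le_sqrt ((le_abs_self _).trans h1)) (Real.sqrt_nonneg _) (by positivity)

lemma halfPowFun_apply {M : ℝ} (n : ℕ) {s : ℝ} (h0 : 0 ≤ s) (h1 : s ≤ M) :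
    halfPowFun M n s = ((s ^ n * √s : ℝ) : ℂ) := by
  rw [halfPowFun, realBCF_apply, max_eq_left h0, min_eq_left h1]

namespace IsModel

variable {μ : Measure ℝ} {Φ : (ℝ →ᵇ ℂ) →⋆ₐ[ℂ] (L2 →L[ℂ] L2)} {R : L2 →L[ℂ] Lp ℂ 2 μ}
  {V : Lp ℂ 2 μ →L[ℂ] L2}

lemma norm_R (m : IsModel μ Φ R V) (k : L2) : ‖R k‖ = ‖Φ dFun k‖ := by
  rw [← m.V_R, m.norm_V]

/-- For a Carleson measure the form is bounded, in particular everywhere defined. -/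
lemma exists_norm_R_le [IsFiniteMeasure μ] (m : IsModel μ Φ R V) (h : μ (Iic 0) = 0) {C : ℝ}
    (hμ : ∀ a : ℝ, 0 < a → μ (Ioo 0 a) ≤ ENNReal.ofReal (C * a)) :
    ∃ M : ℝ, 0 < M ∧ (∀ f : L2, f ∈ formDomain μ) ∧ ∀ k, ‖R k‖ ^ 2 ≤ M * ‖Φ cFun k‖ ^ 2 := by
  have hC : 0 < max C 1 := by positivity
  have hμ' : ∀ a : ℝ, 0 < a → μ (Ioo 0 a) ≤ ENNReal.ofReal (max C 1 * a) := fun a ha =>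
    (hμ a ha).trans (ENNReal.ofReal_le_ofReal
      (mul_le_mul_of_nonneg_right (le_max_left _ _) ha.le))
  have hM : 0 < max C 1 * Real.Gamma (1 / 2) ^ 2 :=
    mul_pos hC (pow_pos (Real.Gamma_pos_of_pos (by norm_num)) 2)
  have key := lintegral_enorm_laplace_sq_le hC h hμ'
  refine ⟨_, hM, fun f => ?_, fun k => ?_⟩
  · change Q μ f < ⊤
    rw [Q, restrict_Ioi h]
    refine (key f).trans_lt ?_
    rw [← enorm_sq_eq_lintegral]
    finiteness
  · have h1 : ‖R k‖ₑ ^ 2 ≤ ENNReal.ofReal (max C 1 * Real.Gamma (1 / 2) ^ 2) *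
        ‖Φ cFun k‖ₑ ^ 2 := by
      rw [enorm_sq_eq_lintegral, enorm_sq_eq_lintegral]
      refine le_trans (le_of_eq (lintegral_congr_ae ?_)) (key (Φ cFun k))
      filter_upwards [m.laplace_ae k] with x hx
      rw [hx]
    rw [← ofReal_norm, ← ofReal_norm, ← ENNReal.ofReal_pow (norm_nonneg _),
      ← ENNReal.ofReal_pow (norm_nonneg _), ← ENNReal.ofReal_mul hM.le,
      ENNReal.ofReal_le_ofReal_iff (by positivity)] at h1
    exact h1

/-- If `Γ` is bounded by `M`, then its spectral measures are carried by `[0, M]`. -/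
lemma measure_Ioi_eq_zero (m : IsModel μ Φ R V) {M : ℝ}
    (hM : ∀ k, ‖R k‖ ^ 2 ≤ M * ‖Φ cFun k‖ ^ 2) {v : L2} {σ : Measure ℝ} [IsFiniteMeasure σ]
    (h0 : σ (Iic 0) = 0) (hσ : ∀ φ : ℝ →ᵇ ℂ, inner ℂ v (Φ φ v) = ∫ x, φ x ∂σ) :
    σ (Ioi M) = 0 := by
  let p : ℝ → ℝ := fun s => min 1 (max 0 (s - M))
  have hp0 : ∀ s, 0 ≤ p s := fun s => le_min zero_le_one (le_max_left _ _)
  let φ : ℝ →ᵇ ℂ := realBCF p (by fun_prop) 1 fun s => by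
    rw [abs_of_nonneg (hp0 s)]
    exact min_le_left _ _
  have hint : ∀ χ : ℝ →ᵇ ℂ, Integrable (fun x => ‖χ x‖ ^ 2) σ := fun χ => by
    refine Integrable.of_bound (by fun_prop) (‖χ‖ ^ 2) (Eventually.of_forall fun x => ?_)
    rw [norm_pow, norm_norm]
    exact pow_le_pow_left₀ (norm_nonneg _) (χ.norm_coe_le_norm x) 2
  have h1 := hM (Φ (cFun * φ) v)
  rw [m.norm_R, calculus_mul, calculus_mul, norm_calculus_sq hσ, norm_calculus_sq hσ,
    ← integral_const_mul, ← sub_nonpos, ← integral_sub (hint _) ((hint _).const_mul M)] at h1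
  have hval : ∀ᵐ s ∂σ, ‖(dFun * (cFun * φ)) s‖ ^ 2 - M * ‖(cFun * (cFun * φ)) s‖ ^ 2
      = (s - M) * (beta s * p s) ^ 2 := by
    filter_upwards [ae_pos h0] with s hs
    simp only [BoundedContinuousFunction.mul_apply, dFun_apply, cFun_apply, norm_mul,
      Complex.norm_real, Real.norm_eq_abs, mul_pow, sq_abs, φ, realBCF_apply]
    rw [Real.sq_sqrt (by linarith [beta_le_one s]), Real.sq_sqrt (beta_pos s).le]
    have := beta_mul hs.le
    linear_combination (-beta s * p s ^ 2) * this
  rw [integral_congr_ae hval] at h1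
  have hnn : ∀ s, 0 ≤ (s - M) * (beta s * p s) ^ 2 := fun s => by
    rcases le_total s M with h | h
    · have : p s = 0 := by
        simp [p, h]
      simp [this]
    · exact mul_nonneg (by linarith) (sq_nonneg _)
  have h2 := (integral_eq_zero_iff_of_nonneg hnn
    (((hint _).sub ((hint _).const_mul M)).congr hval)).1 (le_antisymm h1 (integral_nonneg hnn))
  rw [measure_eq_zero_iff_ae_notMem]
  filter_upwards [h2] with s hs hsM
  have hsM' : M < s := hsM
  have hps : 0 < p s := lt_min one_pos (lt_max_of_lt_right (by linarith))
  have := beta_pos s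
  have h3 : 0 < (s - M) * (beta s * p s) ^ 2 := mul_pos (by linarith) (by positivity)
  exact h3.ne' hs

/-- If `w = Γ f` then `𝓛 w` is obtained from `𝓛 f` by the integral operator on `L²(μ)` with kernel
`1 / (y + x)`. -/
lemma laplace_eq_integral [IsFiniteMeasure μ] (m : IsModel μ Φ R V) (h : μ (Iic 0) = 0)
    {f w : L2} (hfw : f = Φ betaFun (f + w)) {y : ℝ} (hy : 0 < y) :
    Integrable (fun x => laplace f x * (((y + x)⁻¹ : ℝ) : ℂ)) μ ∧
    laplace w y = ∫ x, laplace f x * (((y + x)⁻¹ : ℝ) : ℂ) ∂μ := by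
  have h1 := (m.form f w).2 hfw
  have h2 := expL2_mem_formDomain h hy
  have h3 : ∀ᵐ x ∂μ, laplace f x * conj (laplace (expL2 y hy) x)
      = laplace f x * (((y + x)⁻¹ : ℝ) : ℂ) := by
    filter_upwards [ae_pos h] with x hx
    rw [laplace_expL2 hy hx, Complex.conj_ofReal]
  have h4 := integrable_formPairing h1.1 h2
  rw [restrict_Ioi h] at h4
  refine ⟨h4.congr h3, ?_⟩
  rw [laplace_eq_inner _ hy, ← h1.2 _ h2, formPairing, restrict_Ioi h]
  exact integral_congr_ae h3

/-- A spectral measure of bounded support forces the Carleson condition: the iterates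
`Γⁿ h_μ` grow at most like `Mⁿ`, while the positivity of the kernel `1 / (x + y)` of `L L*` forces
them to grow at least like `(μ((0, a)) / (2 a))ⁿ`. -/
theorem carleson_of_measure_Ioi [IsFiniteMeasure μ] (m : IsModel μ Φ R V) (h : μ (Iic 0) = 0)
    {σ : Measure ℝ} [IsFiniteMeasure σ] (h0 : σ (Iic 0) = 0)
    (hσ : ∀ φ : ℝ →ᵇ ℂ, inner ℂ (V (one2 μ)) (Φ φ (V (one2 μ))) = ∫ x, φ x ∂σ)
    {M : ℝ} (hM0 : 0 < M) (hM : σ (Ioi M) = 0) {a : ℝ} (ha : 0 < a) :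
    μ (Ioo 0 a) ≤ ENNReal.ofReal (2 * M * a) := by
  set v := V (one2 μ) with hv
  have h0' : σ (Iio 0) = 0 := measure_mono_null Iio_subset_Iic_self h0
  set c := μ.real (Ioo 0 a)
  have hc : 0 ≤ c := measureReal_nonneg
  let g : ℕ → L2 := fun n => Φ (halfPowFun M n) v
  have hstep : ∀ n, g n = Φ betaFun (g n + g (n + 1)) := by
    intro n
    have : Φ betaFun (g n + g (n + 1))
        = Φ (betaFun * (halfPowFun M n + halfPowFun M (n + 1))) v := by
      rw [← calculus_mul, map_add Φ, add_apply]
    rw [this]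
    refine calculus_congr_of_measure hσ h0' hM fun s hs hsM => ?_
    rw [BoundedContinuousFunction.mul_apply, BoundedContinuousFunction.add_apply,
      halfPowFun_apply _ hs hsM, halfPowFun_apply _ hs hsM, betaFun_apply]
    rw [← Complex.ofReal_add, ← Complex.ofReal_mul]
    congr 1
    have := beta_mul hs
    linear_combination (-(s ^ n * √s)) * this
  have hzero : ∀ y (hy : 0 < y), laplace (g 0) y = ∫ x, (((y + x)⁻¹ : ℝ) : ℂ) ∂μ := by
    intro y hy
    obtain ⟨k, hk⟩ := (m.mem_formDomain _).1 (expL2_mem_formDomain h hy)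
    have h1 : Φ cFun (g 0) = Φ dFun v := by
      change Φ cFun (Φ (halfPowFun M 0) v) = _
      rw [calculus_mul]
      refine calculus_congr_of_measure hσ h0' hM fun s hs hsM => ?_
      rw [BoundedContinuousFunction.mul_apply, halfPowFun_apply _ hs hsM, cFun_apply, dFun_apply,
        pow_zero, one_mul, ← Complex.ofReal_mul, ← Real.sqrt_mul (beta_pos s).le]
      congr 2
      linarith [beta_mul hs]
    rw [laplace_eq_inner _ hy, ← hk, inner_calculus_left, star_cFun, h1,
      ← star_dFun, ← inner_calculus_left, ← m.V_R, hv, m.inner_V, L2.inner_def]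
    refine integral_congr_ae ?_
    filter_upwards [m.laplace_ae k, coeFn_one2 μ, ae_pos h] with x hx1 hx2 hx
    rw [hx2, ← hx1, hk, laplace_expL2 hy hx, RCLike.inner_apply, Complex.conj_ofReal, one_mul]
  -- on `(0, a)` the kernel is at least `1 / (a + y)`, and `1 / (a + x)` is at least `1 / (2 a)`
  have hlow : ∀ n, ∀ y, 0 < y → (laplace (g n) y).im = 0 ∧
      c ^ (n + 1) / (2 * a) ^ n * (a + y)⁻¹ ≤ (laplace (g n) y).re := by
    intro n
    induction n with
    | zero =>
      intro y hy
      rw [hzero y hy, integral_complex_ofReal]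
      refine ⟨Complex.ofReal_im _, ?_⟩
      rw [Complex.ofReal_re, zero_add, pow_one, pow_zero, div_one]
      have hi : Integrable (fun x => (y + x)⁻¹) μ := by
        refine Integrable.of_bound (by fun_prop) y⁻¹ ?_
        filter_upwards [ae_pos h] with x hx
        rw [Real.norm_eq_abs, abs_of_pos (by positivity)]
        exact inv_anti₀ hy (by linarith)
      calc c * (a + y)⁻¹ = ∫ x in Ioo 0 a, (a + y)⁻¹ ∂μ := by
            rw [setIntegral_const, smul_eq_mul]
        _ ≤ ∫ x in Ioo 0 a, (y + x)⁻¹ ∂μ := by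
            refine setIntegral_mono_on (integrable_const _) hi.integrableOn measurableSet_Ioo
              fun x hx => ?_
            exact inv_anti₀ (by linarith [hx.1]) (by linarith [hx.2])
        _ ≤ ∫ x, (y + x)⁻¹ ∂μ := by
            refine setIntegral_le_integral hi ?_
            filter_upwards [ae_pos h] with x hx
            simp only [Pi.zero_apply]
            positivity
    | succ n ih =>
      intro y hy
      obtain ⟨hi, he⟩ := m.laplace_eq_integral h (hstep n) hy
      have hre : ∀ᵐ x ∂μ, laplace (g n) x * (((y + x)⁻¹ : ℝ) : ℂ)
          = (((laplace (g n) x).re * (y + x)⁻¹ : ℝ) : ℂ) := by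
        filter_upwards [ae_pos h] with x hx
        rw [Complex.ofReal_mul]
        congr 1
        exact Complex.ext rfl (by simpa using (ih x hx).1)
      have hi' : Integrable (fun x => (laplace (g n) x).re * (y + x)⁻¹) μ := by
        refine hi.re.congr ?_
        filter_upwards [hre] with x hx
        rw [hx]
        exact Complex.ofReal_re _
      rw [he, integral_congr_ae hre, integral_complex_ofReal]
      refine ⟨Complex.ofReal_im _, ?_⟩
      rw [Complex.ofReal_re]
      have hK : 0 ≤ c ^ (n + 1) / (2 * a) ^ n := by positivity
      calc c ^ (n + 1 + 1) / (2 * a) ^ (n + 1) * (a + y)⁻¹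
          = ∫ x in Ioo 0 a, c ^ (n + 1) / (2 * a) ^ n * (2 * a)⁻¹ * (a + y)⁻¹ ∂μ := by
            rw [setIntegral_const, smul_eq_mul]
            change _ = c * _
            field_simp
            ring
        _ ≤ ∫ x in Ioo 0 a, (laplace (g n) x).re * (y + x)⁻¹ ∂μ := by
            refine setIntegral_mono_on (integrable_const _) hi'.integrableOn measurableSet_Ioo
              fun x hx => ?_
            have h1 := (ih x hx.1).2
            have h2 : (2 * a)⁻¹ ≤ (a + x)⁻¹ :=
              inv_anti₀ (by linarith [hx.1]) (by linarith [hx.2])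
            have h3 : (a + y)⁻¹ ≤ (y + x)⁻¹ :=
              inv_anti₀ (by linarith [hx.1]) (by linarith [hx.2])
            refine mul_le_mul ((mul_le_mul_of_nonneg_left h2 hK).trans h1) h3 (by positivity) ?_
            refine le_trans ?_ h1
            have := hx.1
            positivity
        _ ≤ ∫ x, (laplace (g n) x).re * (y + x)⁻¹ ∂μ := by
            refine setIntegral_le_integral hi' ?_
            filter_upwards [ae_pos h] with x hx
            simp only [Pi.zero_apply]
            refine mul_nonneg (le_trans ?_ (ih x hx).2) (by positivity)
            positivity
  -- `‖Γ^(n + 1/2) v‖ ≤ M^(n + 1/2) ‖v‖`, paired with `t ↦ e^{-ta}`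
  have hup : ∀ n, (c / (2 * a)) ^ (n + 1) ≤ (‖expL2 a ha‖ * √|M| * ‖v‖) * M ^ n := by
    intro n
    have h1 := (hlow n a ha).2
    have h2 : ‖laplace (g n) a‖ ≤ ‖expL2 a ha‖ * ((|M| ^ n * √|M|) * ‖v‖) := by
      rw [laplace_eq_inner _ ha]
      refine (norm_inner_le_norm _ _).trans (mul_le_mul_of_nonneg_left ?_ (norm_nonneg _))
      exact m.calculus.norm_apply_le (fun s _ => norm_realBCF_le _ _ _ _ s) v
    have h3 := h1.trans ((Complex.re_le_norm _).trans h2)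
    rw [abs_of_pos hM0] at h3 ⊢
    refine le_trans (le_of_eq ?_) (h3.trans (le_of_eq ?_))
    · rw [div_pow, pow_succ (2 * a), ← two_mul]
      field_simp
    · ring
  have hfin : c ≤ 2 * M * a := by
    by_contra hcon
    push Not at hcon
    have hq : 1 < c / (2 * a) / M := by
      rw [div_div, one_lt_div (by positivity)]
      linarith
    have h1 := tendsto_pow_atTop_atTop_of_one_lt hq
    have hc0 : 0 < c / (2 * a) := by
      have : 0 < c := lt_trans (by positivity) hcon
      positivity
    obtain ⟨n, hn⟩ := (h1.eventually_gt_atTop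
      ((‖expL2 a ha‖ * √|M| * ‖v‖) / (c / (2 * a)))).exists
    rw [div_lt_iff₀ hc0, div_pow, div_mul_eq_mul_div, ← pow_succ, lt_div_iff₀ (by positivity)] at hn
    exact hn.not_ge (hup n)
  rw [← ofReal_measureReal (measure_ne_top μ _)]
  exact ENNReal.ofReal_le_ofReal hfin

end IsModel

/-- The Carleson condition for `μ` is equivalent to boundedness of the support of the spectral
image. -/
theorem mem_classCarleson_iff {μ : Measure ℝ} (hμ : μ ∈ classFinite) :
    μ ∈ classCarleson ↔ spectralMap μ ∈ classBounded := by
  have hfin : IsFiniteMeasure μ := hμ.2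
  have h : μ (Iic 0) = 0 := hμ.1.1
  obtain ⟨hσ, hiff⟩ := spectralMap_mem_and_iff hμ
  have hσfin : IsFiniteMeasure (spectralMap μ) := hσ.2
  have h0 : spectralMap μ (Iic 0) = 0 := hσ.1.1
  obtain ⟨Φ, R, V, m⟩ := exists_model μ h
  have hσ' := ((m.isSpectralImage_iff h).1 ((hiff _).2 rfl)).2
  constructor
  · rintro ⟨-, C, hC⟩
    obtain ⟨M, hM, -, hMR⟩ := m.exists_norm_R_le h hC
    exact ⟨hσ, (isBounded_support_iff h0).2 ⟨M, hM, m.measure_Ioi_eq_zero hMR h0 hσ'⟩⟩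
  · rintro ⟨-, hb⟩
    obtain ⟨M, hM0, hM⟩ := (isBounded_support_iff h0).1 hb
    exact ⟨hμ, 2 * M, fun a ha => m.carleson_of_measure_Ioi h h0 hσ' hM0 hM ha⟩

end SupportBound

/-! ### Multiplication operators and the kernel `1 / (x + y)` -/

section Multiplication

open Filter Topology

/-- `s ↦ s` on `[0, M]`, extended by constants. -/
def clipFun (M : ℝ) : ℝ →ᵇ ℂ :=
  realBCF (fun s => min (max s 0) M) (by fun_prop) |M| fun s => by
    rcases le_total (max s 0) M with h | h
    · rw [min_eq_left h, abs_of_nonneg (le_max_right _ _)]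
      exact h.trans (le_abs_self _)
    · rw [min_eq_right h]

lemma clipFun_apply {M s : ℝ} (h0 : 0 ≤ s) (h1 : s ≤ M) : clipFun M s = s := by
  rw [clipFun, realBCF_apply, max_eq_left h0, min_eq_left h1]

lemma clipFun_ae {μ : Measure ℝ} {M : ℝ} (h : μ (Iic 0) = 0) (hM : μ (Ioi M) = 0) :
    ∀ᵐ x ∂μ, clipFun M x = x := by
  filter_upwards [ae_pos h, measure_eq_zero_iff_ae_notMem.1 hM] with x h1 h2
  exact clipFun_apply h1.le (not_lt.1 h2)

variable {μ : Measure ℝ} [IsFiniteMeasure μ]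

/-- Multiplication by a bounded continuous function on `L²(μ)`. -/
def mulOp (μ : Measure ℝ) [IsFiniteMeasure μ] (φ : ℝ →ᵇ ℂ) : Lp ℂ 2 μ →L[ℂ] Lp ℂ 2 μ :=
  (ContinuousLinearMap.mul ℂ ℂ).holderL μ ⊤ 2 2 (BoundedContinuousFunction.toLp ⊤ μ ℂ φ)

lemma coeFn_mulOp (φ : ℝ →ᵇ ℂ) (u : Lp ℂ 2 μ) : mulOp μ φ u =ᵐ[μ] fun x => φ x * u x := by
  filter_upwards [(ContinuousLinearMap.mul ℂ ℂ).coeFn_holder (r := 2)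
    (BoundedContinuousFunction.toLp ⊤ μ ℂ φ) u,
    BoundedContinuousFunction.coeFn_toLp ⊤ μ ℂ φ] with x h1 h2
  rw [← h2]
  exact h1

lemma mulOp_congr_ae {φ χ : ℝ →ᵇ ℂ} (h : ∀ᵐ x ∂μ, φ x = χ x) : mulOp μ φ = mulOp μ χ := by
  ext u
  filter_upwards [coeFn_mulOp φ u, coeFn_mulOp χ u, h] with x h1 h2 h3
  rw [h1, h2, h3]

lemma mulOp_mul (φ χ : ℝ →ᵇ ℂ) : mulOp μ (φ * χ) = mulOp μ φ * mulOp μ χ := by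
  ext u
  filter_upwards [coeFn_mulOp (φ * χ) u, coeFn_mulOp φ (mulOp μ χ u), coeFn_mulOp χ u]
    with x h1 h2 h3
  rw [h1, mul_apply_eq_comp, h2, h3, BoundedContinuousFunction.mul_apply, mul_assoc]

lemma mulOp_one : mulOp μ 1 = 1 := by
  ext u
  filter_upwards [coeFn_mulOp 1 u] with x h1
  rw [h1]
  simp

lemma mulOp_add (φ χ : ℝ →ᵇ ℂ) : mulOp μ (φ + χ) = mulOp μ φ + mulOp μ χ := by
  simp only [mulOp, map_add]

lemma mulOp_smul (c : ℂ) (φ : ℝ →ᵇ ℂ) : mulOp μ (c • φ) = c • mulOp μ φ := by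
  simp only [mulOp, map_smul]

lemma inner_mulOp_left (φ : ℝ →ᵇ ℂ) (u w : Lp ℂ 2 μ) :
    inner ℂ (mulOp μ φ u) w = inner ℂ u (mulOp μ (star φ) w) := by
  rw [L2.inner_def, L2.inner_def]
  refine integral_congr_ae ?_
  filter_upwards [coeFn_mulOp φ u, coeFn_mulOp (star φ) w] with x h1 h2
  rw [h1, h2, RCLike.inner_apply, RCLike.inner_apply, map_mul]
  simp only [BoundedContinuousFunction.star_apply]
  change _ = conj (φ x) * _ * _
  ring

lemma mulOp_toLp (φ χ : ℝ →ᵇ ℂ) : mulOp μ φ (BoundedContinuousFunction.toLp 2 μ ℂ χ)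
    = BoundedContinuousFunction.toLp 2 μ ℂ (φ * χ) := by
  ext1
  filter_upwards [coeFn_mulOp φ (BoundedContinuousFunction.toLp 2 μ ℂ χ),
    BoundedContinuousFunction.coeFn_toLp 2 μ ℂ χ,
    BoundedContinuousFunction.coeFn_toLp 2 μ ℂ (φ * χ)] with x h1 h2 h3
  rw [h1, h2, h3]
  rfl

lemma toLp_one : BoundedContinuousFunction.toLp 2 μ ℂ (1 : ℝ →ᵇ ℂ) = one2 μ := by
  ext1
  filter_upwards [coeFn_one2 μ, BoundedContinuousFunction.coeFn_toLp 2 μ ℂ (1 : ℝ →ᵇ ℂ)]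
    with x h1 h2
  rw [h1, h2]
  rfl

lemma inner_one2_mulOp (φ : ℝ →ᵇ ℂ) : inner ℂ (one2 μ) (mulOp μ φ (one2 μ)) = ∫ x, φ x ∂μ := by
  rw [inner_one2]
  refine integral_congr_ae ?_
  filter_upwards [coeFn_mulOp φ (one2 μ), coeFn_one2 μ] with x h1 h2
  rw [h1, h2, mul_one]

lemma norm_toLp_sq (φ : ℝ →ᵇ ℂ) :
    ‖BoundedContinuousFunction.toLp 2 μ ℂ φ‖ ^ 2 = ∫ x, ‖φ x‖ ^ 2 ∂μ := by
  have h1 : ((‖BoundedContinuousFunction.toLp 2 μ ℂ φ‖ ^ 2 : ℝ) : ℂ)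
      = ((∫ x, ‖φ x‖ ^ 2 ∂μ : ℝ) : ℂ) := by
    rw [← integral_complex_ofReal]
    have h2 : inner ℂ (BoundedContinuousFunction.toLp 2 μ ℂ φ)
        (BoundedContinuousFunction.toLp 2 μ ℂ φ)
        = ((‖BoundedContinuousFunction.toLp 2 μ ℂ φ‖ ^ 2 : ℝ) : ℂ) := by
      rw [inner_self_eq_norm_sq_to_K]
      norm_cast
    rw [← h2, L2.inner_def]
    refine integral_congr_ae ?_
    filter_upwards [BoundedContinuousFunction.coeFn_toLp 2 μ ℂ φ] with x hx
    rw [hx, inner_self_eq_norm_sq_to_K]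
    norm_cast
  exact_mod_cast h1

/-- `G` is the integral operator with kernel `1 / (x + y)` on `L²(μ)`. -/
def IsCarleman (μ : Measure ℝ) (G : Lp ℂ 2 μ →L[ℂ] Lp ℂ 2 μ) : Prop :=
  ∀ u : Lp ℂ 2 μ, G u =ᵐ[μ] fun x => ∫ y, (((x + y)⁻¹ : ℝ) : ℂ) * u y ∂μ

/-- The Lyapunov equation `X G + G X = ⟨1, ·⟩ 1`, where `X` is multiplication by `x` and `G` has
the kernel `1 / (x + y)`. -/
lemma IsCarleman.lyapunov {G : Lp ℂ 2 μ →L[ℂ] Lp ℂ 2 μ} (hG : IsCarleman μ G) {M : ℝ}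
    (h : μ (Iic 0) = 0) (hM : μ (Ioi M) = 0) (u : Lp ℂ 2 μ) :
    mulOp μ (clipFun M) (G u) + G (mulOp μ (clipFun M) u) = inner ℂ (one2 μ) u • one2 μ := by
  have hui : Integrable u μ := (Lp.memLp u).integrable one_le_two
  have hXui : Integrable (mulOp μ (clipFun M) u) μ := (Lp.memLp _).integrable one_le_two
  ext1
  filter_upwards [Lp.coeFn_add (mulOp μ (clipFun M) (G u)) (G (mulOp μ (clipFun M) u)),
    coeFn_mulOp (clipFun M) (G u), hG u, hG (mulOp μ (clipFun M) u), clipFun_ae h hM,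
    Lp.coeFn_smul (inner ℂ (one2 μ) u) (one2 μ), coeFn_one2 μ, ae_pos h]
    with x h1 h2 h3 h4 h5 h6 h7 hx
  have hbd : ∀ {F : ℝ → ℂ}, Integrable F μ →
      Integrable (fun y => (((x + y)⁻¹ : ℝ) : ℂ) * F y) μ := fun hF => by
    refine hF.bdd_mul (c := x⁻¹) (Measurable.aestronglyMeasurable (by fun_prop)) ?_
    filter_upwards [ae_pos h] with y hy
    rw [Complex.norm_real, Real.norm_eq_abs, abs_of_pos (by positivity)]
    exact inv_anti₀ hx (by linarith)
  rw [h1, Pi.add_apply, h2, h3, h4, h5, h6, Pi.smul_apply, h7, smul_eq_mul, mul_one, inner_one2,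
    ← integral_const_mul, ← integral_add ((hbd hui).const_mul _) (hbd hXui)]
  refine integral_congr_ae ?_
  filter_upwards [coeFn_mulOp (clipFun M) u, clipFun_ae h hM, ae_pos h] with y h8 h9 hy
  rw [h8, h9]
  have hne : ((x : ℂ) + y) ≠ 0 := by
    have : (x + y : ℝ) ≠ 0 := by positivity
    exact_mod_cast this
  push_cast
  field_simp

end Multiplication

/-! ### The spectral representation of the operator with kernel `1 / (x + y)` -/

section Transform

open Filter Topology ContinuousLinearMap

/-- For a Carleson measure `μ` with spectral image `σ`, the operator `G = L L*` on `L²(μ)` has the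
kernel `1 / (x + y)`, and `φ ↦ φ(G) 1` is an isometry from `L²(σ)` which intertwines `G` with
multiplication by the independent variable. -/
theorem exists_transform {μ : Measure ℝ} (hμ : μ ∈ classCarleson) {σ : Measure ℝ}
    (hσs : σ = spectralMap μ) [IsFiniteMeasure μ] [IsFiniteMeasure σ] :
    ∃ (M : ℝ) (G : Lp ℂ 2 μ →L[ℂ] Lp ℂ 2 μ) (W : Lp ℂ 2 σ →L[ℂ] Lp ℂ 2 μ),
      0 < M ∧ σ (Ioi M) = 0 ∧ 0 ≤ G ∧ IsCarleman μ G ∧ (∀ f, ‖W f‖ = ‖f‖) ∧ W (one2 σ) = one2 μ ∧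
      ∀ f, G (W f) = W (mulOp σ (clipFun M) f) := by
  obtain ⟨hμf, C, hC⟩ := hμ
  have h : μ (Iic 0) = 0 := hμf.1.1
  obtain ⟨hσ, hiff⟩ := spectralMap_mem_and_iff hμf
  rw [← hσs] at hσ hiff
  have h0 : σ (Iic 0) = 0 := hσ.1.1
  have h0' : σ (Iio 0) = 0 := measure_mono_null Iio_subset_Iic_self h0
  obtain ⟨Φ, R, V, m⟩ := exists_model μ h
  obtain ⟨M, hM, hdom, hMR⟩ := m.exists_norm_R_le h hC
  set v := V (one2 μ) with hv
  have hσ' : ∀ φ : ℝ →ᵇ ℂ, inner ℂ v (Φ φ v) = ∫ x, φ x ∂σ :=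
    ((m.isSpectralImage_iff h).1 ((hiff _).2 rfl)).2
  have hσM : σ (Ioi M) = 0 := m.measure_Ioi_eq_zero hMR h0 hσ'
  have hCs : Function.Surjective (Φ cFun) := fun f => (m.mem_formDomain f).1 (hdom f)
  -- the bounded operator `L`
  let L : L2 →L[ℂ] Lp ℂ 2 μ := (R : L2 →ₗ[ℂ] Lp ℂ 2 μ).extendOfNorm (Φ cFun : L2 →ₗ[ℂ] L2)
  have hL : ∀ k, L (Φ cFun k) = R k := fun k =>
    LinearMap.extendOfNorm_eq hCs.denseRange ⟨√M, fun y => by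
      refine le_of_sq_le_sq ?_ (by positivity)
      rw [mul_pow, Real.sq_sqrt hM.le]
      exact hMR y⟩ k
  have hLae : ∀ f, laplace f =ᵐ[μ] L f := fun f => by
    obtain ⟨k, rfl⟩ := hCs f
    rw [hL]
    exact m.laplace_ae k
  let G : Lp ℂ 2 μ →L[ℂ] Lp ℂ 2 μ := L ∘L L.adjoint
  have hG0 : 0 ≤ G := by
    rw [nonneg_iff_isPositive]
    exact isPositive_self_comp_adjoint L
  have hGk : IsCarleman μ G := by
    intro u
    filter_upwards [hLae (L.adjoint u), ae_pos h] with x hx hx0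
    change L (L.adjoint u) x = _
    rw [← hx, laplace_eq_inner _ hx0, adjoint_inner_right, L2.inner_def]
    refine integral_congr_ae ?_
    filter_upwards [hLae (expL2 x hx0), ae_pos h] with y hy hy0
    rw [← hy, laplace_expL2 hx0 hy0, RCLike.inner_apply, Complex.conj_ofReal, mul_comm]
  have hVV : ∀ u, V.adjoint (V u) = u := fun u => ext_inner_left ℂ fun w => by
    rw [adjoint_inner_right, m.inner_V]
  -- `V L` is the bounded self-adjoint operator `Γ^(1/2)`
  have hVL : ∀ k, V (L (Φ cFun k)) = Φ dFun k := fun k => by rw [hL, m.V_R]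
  have hSsa : ∀ f, L.adjoint (V.adjoint f) = V (L f) := by
    intro f
    refine ext_inner_left ℂ fun g => ?_
    obtain ⟨k, rfl⟩ := hCs f
    obtain ⟨l, rfl⟩ := hCs g
    rw [adjoint_inner_right, adjoint_inner_right, hVL, hVL, inner_calculus_left,
      inner_calculus_left, star_cFun, star_dFun, calculus_comm]
  have hGV : ∀ φ : ℝ →ᵇ ℂ, G (V.adjoint (Φ φ v)) = V.adjoint (Φ (clipFun M * φ) v) := by
    intro φ
    change L (L.adjoint (V.adjoint (Φ φ v))) = _
    obtain ⟨k, hk⟩ := hCs (Φ φ v)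
    obtain ⟨l, hl⟩ := hCs (Φ dFun k)
    rw [hSsa, ← hk, hVL, ← hl, hL, ← hVV (R l), m.V_R]
    congr 1
    apply m.calculus.betaFun_injective
    rw [← cFun_cFun_apply, calculus_comm Φ cFun dFun, hl, calculus_comm Φ cFun dFun,
      calculus_comm Φ cFun dFun, hk, calculus_mul, calculus_mul, calculus_mul]
    refine calculus_congr_of_measure hσ' h0' hσM fun s hs hsM => ?_
    rw [← mul_assoc, dFun_mul_dFun]
    simp only [BoundedContinuousFunction.mul_apply, BoundedContinuousFunction.sub_apply,
      BoundedContinuousFunction.coe_one, Pi.one_apply, betaFun_apply, clipFun_apply hs hsM]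
    have h1 : (beta s : ℂ) * (1 + s) = 1 := by exact_mod_cast beta_mul hs
    linear_combination (-φ s) * h1
  have hrange : ∀ φ : ℝ →ᵇ ℂ, Φ φ v ∈ range V := by
    intro φ
    refine m.closure_subset_range_V ?_
    refine map_mem_closure (Φ φ).continuous (m.V_mem_closure (one2 μ)) ?_
    rintro _ ⟨k, rfl⟩
    exact ⟨Φ φ k, calculus_comm _ _ _ _⟩
  have hnorm : ∀ φ : ℝ →ᵇ ℂ,
      ‖V.adjoint (Φ φ v)‖ = ‖BoundedContinuousFunction.toLp 2 σ ℂ φ‖ := by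
    intro φ
    obtain ⟨u, hu⟩ := hrange φ
    rw [← sq_eq_sq₀ (norm_nonneg _) (norm_nonneg _), norm_toLp_sq, ← norm_calculus_sq hσ', ← hu,
      hVV, m.norm_V]
  let T : (ℝ →ᵇ ℂ) →ₗ[ℂ] Lp ℂ 2 μ :=
    { toFun := fun φ => V.adjoint (Φ φ v)
      map_add' := fun φ χ => by rw [map_add Φ, add_apply, map_add]
      map_smul' := fun c φ => by rw [map_smul Φ, smul_apply, map_smul]; rfl }
  let e : (ℝ →ᵇ ℂ) →L[ℂ] Lp ℂ 2 σ := BoundedContinuousFunction.toLp 2 σ ℂ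
  let W : Lp ℂ 2 σ →L[ℂ] Lp ℂ 2 μ := T.extendOfNorm (e : (ℝ →ᵇ ℂ) →ₗ[ℂ] Lp ℂ 2 σ)
  have hd : DenseRange (BoundedContinuousFunction.toLp 2 σ ℂ : (ℝ →ᵇ ℂ) →L[ℂ] Lp ℂ 2 σ) :=
    BoundedContinuousFunction.toLp_denseRange ℂ σ ℂ (by norm_num)
  have hW : ∀ φ, W (BoundedContinuousFunction.toLp 2 σ ℂ φ) = V.adjoint (Φ φ v) := fun φ =>
    LinearMap.extendOfNorm_eq (f := T) (e := (e : (ℝ →ᵇ ℂ) →ₗ[ℂ] Lp ℂ 2 σ)) hd ⟨1, fun χ => by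
        rw [one_mul]
        exact (hnorm χ).le⟩ φ
  refine ⟨M, G, W, hM, hσM, hG0, hGk, norm_eq_of_denseRange hd fun φ => by rw [hW, hnorm], ?_,
    fun f => ?_⟩
  · rw [← toLp_one, hW, map_one, one_apply_eq_self, hv, hVV]
  · refine hd.induction_on f (isClosed_eq (by fun_prop) (by fun_prop)) fun φ => ?_
    rw [hW, hGV, mulOp_toLp, hW]

end Transform

/-! ### The involution -/

section Involution

open Filter Topology ContinuousLinearMap

/-- Uniqueness for the homogeneous Sylvester equation `G Y + Y D = 0` with `G ≥ 0` and `D ≥ 0`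
injective. Indeed `Y* Y D = -Y* G Y` is self-adjoint, so `Y* Y` and `D` commute and their product
is both nonnegative and nonpositive. -/
lemma eq_zero_of_sylvester {H K : Type*} [NormedAddCommGroup H] [InnerProductSpace ℂ H]
    [CompleteSpace H] [NormedAddCommGroup K] [InnerProductSpace ℂ K] [CompleteSpace K]
    {G : H →L[ℂ] H} {D : K →L[ℂ] K} {Y : K →L[ℂ] H} (hG : 0 ≤ G) (hD : 0 ≤ D)
    (hinj : ∀ x, D x = 0 → x = 0) (h : ∀ x, G (Y x) + Y (D x) = 0) : Y = 0 := by
  have hZ : 0 ≤ Y.adjoint ∘L Y := by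
    rw [nonneg_iff_isPositive]
    exact isPositive_adjoint_comp_self Y
  have hP : 0 ≤ Y.adjoint ∘L G ∘L Y := by
    rw [nonneg_iff_isPositive] at hG ⊢
    exact hG.adjoint_conj Y
  have hZD : (Y.adjoint ∘L Y) * D = -(Y.adjoint ∘L G ∘L Y) := by
    ext x
    change Y.adjoint (Y (D x)) = -Y.adjoint (G (Y x))
    rw [eq_neg_of_add_eq_zero_right (h x), map_neg]
  have hsa : IsSelfAdjoint ((Y.adjoint ∘L Y) * D) := by
    rw [hZD]
    exact hP.isSelfAdjoint.neg
  have hc : Commute (Y.adjoint ∘L Y) D := (hZ.isSelfAdjoint.commute_iff hD.isSelfAdjoint).2 hsa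
  have h0 : (Y.adjoint ∘L Y) * D = 0 :=
    le_antisymm (by rw [hZD]; exact neg_nonpos.2 hP) (hc.mul_nonneg hZ hD)
  ext x
  have h1 : D ((Y.adjoint ∘L Y) x) = 0 := by
    have := congrArg (fun T => T x) (hc.eq.symm.trans h0)
    exact this
  have h2 : inner ℂ (Y x) (Y x) = (0 : ℂ) := by
    rw [← adjoint_inner_right]
    change inner ℂ x ((Y.adjoint ∘L Y) x) = 0
    rw [hinj _ h1, inner_zero_right]
  exact inner_self_eq_zero.1 h2

lemma mulOp_clipFun_nonneg (μ : Measure ℝ) [IsFiniteMeasure μ] {M : ℝ} (hM : 0 ≤ M) :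
    0 ≤ mulOp μ (clipFun M) := by
  let r : ℝ →ᵇ ℂ := realBCF (fun s => √(min (max s 0) M)) (by fun_prop) √M fun s => by
    rw [abs_of_nonneg (Real.sqrt_nonneg _)]
    exact Real.sqrt_le_sqrt (min_le_right _ _)
  have hr : clipFun M = r * r := by
    ext s
    rw [BoundedContinuousFunction.mul_apply, realBCF_apply, clipFun, realBCF_apply,
      ← Complex.ofReal_mul, Real.mul_self_sqrt (le_min (le_max_right _ _) hM)]
  have hra : (mulOp μ r).adjoint = mulOp μ r := by
    refine (eq_adjoint_iff _ _).2 (fun u w => ?_) |>.symm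
    rw [inner_mulOp_left, star_realBCF]
  rw [nonneg_iff_isPositive, hr, mulOp_mul]
  have := isPositive_adjoint_comp_self (mulOp μ r)
  rwa [hra] at this

/-- The Lyapunov equation tested on the transform of a cutoff at height `a` bounds
`(∫ φ dσ)²` by a constant times `a ∫ φ dσ`, which is the Carleson condition. -/
lemma spectralMap_carleson {μ : Measure ℝ} (hμ : μ ∈ classCarleson ∩ classBounded) :
    spectralMap μ ∈ classCarleson := by
  have hfin : IsFiniteMeasure μ := hμ.2.1.2
  have h : μ (Iic 0) = 0 := hμ.2.1.1.1
  obtain ⟨N, hN0, hN⟩ := (isBounded_support_iff h).1 hμ.2.2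
  have hσ := (spectralMap_mem_and_iff hμ.2.1).1
  refine ⟨hσ, ?_⟩
  generalize hσs : spectralMap μ = σ at hσ
  have hσfin : IsFiniteMeasure σ := hσ.2
  have h0 : σ (Iic 0) = 0 := hσ.1.1
  obtain ⟨M, G, W, hM0, hM, hG, hGk, hW, hW1, hGW⟩ := exists_transform hμ.1 hσs.symm
  refine ⟨4 * ‖mulOp μ (clipFun N)‖, fun a ha => ?_⟩
  have hcut : ∀ s : ℝ, |min 1 (max 0 (2 - s / a))| ≤ 1 := fun s => by
    rw [abs_of_nonneg (le_min zero_le_one (le_max_left _ _))]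
    exact min_le_left _ _
  -- `φ` is `1` on `(0, a]` and vanishes on `[2 a, ∞)`
  let φ : ℝ →ᵇ ℂ := realBCF (fun s => min 1 (max 0 (2 - s / a))) (by fun_prop) 1 hcut
  set I : ℝ := ∫ s, min 1 (max 0 (2 - s / a)) ∂σ with hI
  have hint : Integrable (fun s : ℝ => min 1 (max 0 (2 - s / a))) σ :=
    Integrable.of_bound (Continuous.aestronglyMeasurable (by fun_prop)) 1
      (Eventually.of_forall hcut)
  have hnn : ∀ s : ℝ, 0 ≤ min 1 (max 0 (2 - s / a)) := fun s =>
    le_min zero_le_one (le_max_left _ _)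
  have hI0 : 0 ≤ I := integral_nonneg hnn
  set u := BoundedContinuousFunction.toLp 2 σ ℂ φ with hu
  have hun : ‖u‖ ^ 2 ≤ I := by
    rw [hu, norm_toLp_sq]
    refine integral_mono_of_nonneg (Eventually.of_forall fun s => by positivity) hint
      (Eventually.of_forall fun s => ?_)
    change ‖φ s‖ ^ 2 ≤ _
    rw [realBCF_apply, Complex.norm_real, Real.norm_eq_abs, sq_abs]
    exact pow_le_of_le_one (hnn s) (min_le_left _ _) two_ne_zero
  have hDu : ‖G (W u)‖ ≤ 2 * a * ‖u‖ := by
    rw [hGW, hW]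
    refine Lp.norm_le_mul_norm_of_ae_le_mul ?_
    filter_upwards [coeFn_mulOp (clipFun M) u, BoundedContinuousFunction.coeFn_toLp 2 σ ℂ φ,
      clipFun_ae h0 hM, ae_pos h0] with s h1 h2 h3 h4
    rw [h1, h3, norm_mul, Complex.norm_real, Real.norm_eq_abs, abs_of_pos h4]
    rcases le_or_gt s (2 * a) with hs | hs
    · gcongr
    · have : u s = 0 := by
        rw [hu, h2, realBCF_apply, max_eq_left, min_eq_right zero_le_one, Complex.ofReal_zero]
        rw [sub_nonpos, le_div_iff₀ ha]
        exact hs.le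
      rw [this, norm_zero, mul_zero, mul_zero]
  have h1u : inner ℂ (one2 μ) (W u) = (I : ℂ) := by
    have hiso : inner ℂ (W (one2 σ)) (W u) = inner ℂ (one2 σ) u :=
      LinearIsometry.inner_map_map ⟨W.toLinearMap, hW⟩ _ _
    rw [← hW1, hiso, inner_one2, hI, ← integral_complex_ofReal]
    refine integral_congr_ae ?_
    filter_upwards [BoundedContinuousFunction.coeFn_toLp 2 σ ℂ φ] with s hs
    rw [hu, hs]
    rfl
  have hGs : ∀ x y, inner ℂ (G x) y = inner ℂ x (G y) :=
    ((nonneg_iff_isPositive _).1 hG).isSymmetric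
  have hkey : I ^ 2 ≤ 4 * ‖mulOp μ (clipFun N)‖ * a * I := by
    have h1 : ((I ^ 2 : ℝ) : ℂ) = inner ℂ (W u) (mulOp μ (clipFun N) (G (W u)))
        + inner ℂ (G (W u)) (mulOp μ (clipFun N) (W u)) := by
      rw [hGs, ← inner_add_right, hGk.lyapunov h hN, inner_smul_right, h1u,
        ← inner_conj_symm, h1u, Complex.conj_ofReal]
      push_cast
      ring
    have h2 : I ^ 2 ≤ ‖W u‖ * (‖mulOp μ (clipFun N)‖ * ‖G (W u)‖)
        + ‖G (W u)‖ * (‖mulOp μ (clipFun N)‖ * ‖W u‖) := by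
      calc I ^ 2 = ‖((I ^ 2 : ℝ) : ℂ)‖ := by
            rw [Complex.norm_real, Real.norm_eq_abs, abs_of_nonneg (sq_nonneg I)]
        _ ≤ _ := by
            rw [h1]
            refine (norm_add_le _ _).trans (add_le_add ?_ ?_)
            · exact (norm_inner_le_norm _ _).trans (by gcongr; exact le_opNorm _ _)
            · exact (norm_inner_le_norm _ _).trans (by gcongr; exact le_opNorm _ _)
    rw [hW] at h2
    calc I ^ 2 ≤ 2 * ‖mulOp μ (clipFun N)‖ * ‖u‖ * ‖G (W u)‖ := h2.trans_eq (by ring)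
      _ ≤ 2 * ‖mulOp μ (clipFun N)‖ * ‖u‖ * (2 * a * ‖u‖) := by gcongr
      _ = 4 * ‖mulOp μ (clipFun N)‖ * a * ‖u‖ ^ 2 := by ring
      _ ≤ _ := by gcongr
  have hIle : I ≤ 4 * ‖mulOp μ (clipFun N)‖ * a := by
    rcases hI0.eq_or_lt with h1 | h1
    · rw [← h1]
      positivity
    · rw [sq] at hkey
      exact le_of_mul_le_mul_right hkey h1
  calc σ (Ioo 0 a) = ∫⁻ s, (Ioo 0 a).indicator 1 s ∂σ :=
        (lintegral_indicator_one measurableSet_Ioo).symm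
    _ ≤ ∫⁻ s, ENNReal.ofReal (min 1 (max 0 (2 - s / a))) ∂σ := by
        refine lintegral_mono fun s => ?_
        refine indicator_apply_le' (fun hs => ?_) fun _ => zero_le
        have : s / a < 1 := (div_lt_one ha).2 hs.2
        rw [min_eq_left (le_max_of_le_right (by linarith)), ENNReal.ofReal_one]
        exact le_rfl
    _ = ENNReal.ofReal I :=
        (ofReal_integral_eq_lintegral_ofReal hint (Eventually.of_forall hnn)).symm
    _ ≤ _ := ENNReal.ofReal_le_ofReal hIle

/-- An isometry which fixes the constant `1` and intertwines multiplications by the independent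
variable identifies the two measures. -/
lemma measure_eq_of_intertwining {μ τ : Measure ℝ} [IsFiniteMeasure μ] [IsFiniteMeasure τ]
    {U : Lp ℂ 2 τ →L[ℂ] Lp ℂ 2 μ} {N M : ℝ} (hμ : ∀ᵐ x ∂μ, clipFun N x = x)
    (hτ : ∀ᵐ x ∂τ, clipFun M x = x) (hU : ∀ f, ‖U f‖ = ‖f‖) (hU1 : U (one2 τ) = one2 μ)
    (h : ∀ f, mulOp μ (clipFun N) (U f) = U (mulOp τ (clipFun M) f)) : τ = μ := by
  have hinv : ∀ {ν : Measure ℝ} [IsFiniteMeasure ν] {K : ℝ}, (∀ᵐ x ∂ν, clipFun K x = x) →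
      ∀ (z : ℂ) (hz : z.im ≠ 0),
        mulOp ν (resolventFun z hz) * (mulOp ν (clipFun K) - z • 1) = 1 ∧
        (mulOp ν (clipFun K) - z • 1) * mulOp ν (resolventFun z hz) = 1 := by
    intro ν _ K hK z hz
    have h1 : mulOp ν (clipFun K) - z • 1 = mulOp ν (clipFun K + (-z) • 1) := by
      rw [mulOp_add, mulOp_smul, mulOp_one, neg_smul, sub_eq_add_neg]
    have h2 : mulOp ν (resolventFun z hz * (clipFun K + (-z) • 1)) = 1 := by
      rw [← mulOp_one]
      refine mulOp_congr_ae ?_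
      filter_upwards [hK] with x hx
      have hne : (x : ℂ) - z ≠ 0 := fun h0 => hz (by simpa using congrArg Complex.im h0)
      change ((x : ℂ) - z)⁻¹ * (clipFun K x + -z * 1) = 1
      rw [hx, mul_one, ← sub_eq_add_neg, inv_mul_cancel₀ hne]
    rw [h1, ← mulOp_mul, ← mulOp_mul, mul_comm (clipFun K + _), h2]
    exact ⟨rfl, rfl⟩
  have hint : ∀ φ ∈ Algebra.adjoin ℂ {φ : ℝ →ᵇ ℂ | ∃ z hz, φ = resolventFun z hz},
      ∀ f, mulOp μ φ (U f) = U (mulOp τ φ f) := by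
    intro φ hφ
    induction hφ using Algebra.adjoin_induction with
    | mem φ hφ =>
      obtain ⟨z, hz, rfl⟩ := hφ
      intro f
      obtain ⟨g, rfl⟩ : ∃ g, f = (mulOp τ (clipFun M) - z • 1) g :=
        ⟨mulOp τ (resolventFun z hz) f, (congrArg (fun T => T f) (hinv hτ z hz).2).symm⟩
      have h1 : U ((mulOp τ (clipFun M) - z • 1) g) = (mulOp μ (clipFun N) - z • 1) (U g) := by
        change U (mulOp τ (clipFun M) g - z • g) = mulOp μ (clipFun N) (U g) - z • U g
        rw [map_sub, h, map_smul]
      rw [h1]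
      have h2 := congrArg (fun T => T (U g)) (hinv hμ z hz).1
      have h3 := congrArg (fun T => T g) (hinv hτ z hz).1
      exact h2.trans (congrArg U h3).symm
    | algebraMap c =>
      intro f
      rw [Algebra.algebraMap_eq_smul_one, mulOp_smul, mulOp_smul, mulOp_one, mulOp_one]
      exact (map_smul U c f).symm
    | add φ χ _ _ h1 h2 =>
      intro f
      rw [mulOp_add, mulOp_add, add_apply, add_apply, map_add, h1, h2]
    | mul φ χ _ _ h1 h2 =>
      intro f
      rw [mulOp_mul, mulOp_mul, mul_apply_eq_comp, mul_apply_eq_comp, h2, h1]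
  refine measure_ext_of_resolvent fun φ hφ => ?_
  rw [← inner_one2_mulOp, ← inner_one2_mulOp, ← hU1, hint φ hφ]
  exact (LinearIsometry.inner_map_map ⟨U.toLinearMap, hU⟩ _ _).symm

/-- The transform `W` also intertwines multiplication by `x` on `L²(μ)` with the operator of kernel
`1 / (x + y)` on `L²(σ)`, so that composing it with the transform of `σ` diagonalises
multiplication by `x` on `L²(μ)`. -/
theorem spectralMap_spectralMap {μ : Measure ℝ} (hμ : μ ∈ classCarleson ∩ classBounded) :
    spectralMap (spectralMap μ) = μ := by
  have hfin : IsFiniteMeasure μ := hμ.2.1.2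
  have h : μ (Iic 0) = 0 := hμ.2.1.1.1
  obtain ⟨N, hN0, hN⟩ := (isBounded_support_iff h).1 hμ.2.2
  have hσc := spectralMap_carleson hμ
  have hσb := (mem_classCarleson_iff hμ.2.1).1 hμ.1
  generalize hσs : spectralMap μ = σ at hσc hσb
  have hσfin : IsFiniteMeasure σ := hσc.1.2
  have h0 : σ (Iic 0) = 0 := hσc.1.1.1
  have hτ := (spectralMap_mem_and_iff hσc.1).1
  generalize hτs : spectralMap σ = τ at hτ
  have hτfin : IsFiniteMeasure τ := hτ.2
  obtain ⟨M, G, W, hM0, hM, hG, hGk, hW, hW1, hGW⟩ := exists_transform hμ.1 hσs.symm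
  obtain ⟨M', G', W', -, hM', hG', hGk', hW', hW1', hGW'⟩ := exists_transform hσc hτs.symm
  have hiso : ∀ f g, inner ℂ (W f) (W g) = inner ℂ f g :=
    LinearIsometry.inner_map_map ⟨W.toLinearMap, hW⟩
  -- both Lyapunov equations make `X W - W G'` a solution of the homogeneous Sylvester equation
  have hY : mulOp μ (clipFun N) ∘L W - W ∘L G' = 0 := by
    refine eq_zero_of_sylvester hG (mulOp_clipFun_nonneg σ hM0.le) (fun f hf => ?_) fun f => ?_
    · ext1
      filter_upwards [coeFn_mulOp (clipFun M) f, clipFun_ae h0 hM, ae_pos h0,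
        Lp.coeFn_zero ℂ 2 σ] with s h1 h2 h3 h4
      rw [hf, h4, h2] at h1
      rw [h4]
      exact (mul_eq_zero.1 h1.symm).resolve_left (by exact_mod_cast h3.ne')
    · have h1 := hGk.lyapunov h hN (W f)
      have h2 := congrArg W (hGk'.lyapunov h0 hM f)
      rw [hGW, ← hW1, hiso] at h1
      rw [map_add, map_smul, ← hGW] at h2
      change G (mulOp μ (clipFun N) (W f) - W (G' f))
        + (mulOp μ (clipFun N) (W (mulOp σ (clipFun M) f)) - W (G' (mulOp σ (clipFun M) f))) = 0
      rw [map_sub, ← sub_eq_zero.2 (h1.trans h2.symm)]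
      abel
  have hXW : ∀ f, mulOp μ (clipFun N) (W f) = W (G' f) := fun f =>
    sub_eq_zero.1 (congrArg (fun T => T f) hY)
  refine measure_eq_of_intertwining (U := W ∘L W') (N := N) (M := M') (clipFun_ae h hN)
    (clipFun_ae hτ.1.1 hM') (fun f => ?_) ?_ fun f => ?_
  · rw [comp_apply, hW, hW']
  · rw [comp_apply, hW1', hW1]
  · rw [comp_apply, comp_apply, hXW, hGW']

end Involution

end

end Hankel

/-- The first clause says that `Ω` is well defined as a map from the finite measures to the finite
measures; the second is the equivalence of the Carleson condition for `μ` with boundedness of the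
support of `Ω(μ)`; the last two say that `Ω` restricts to an involution. -/
theorem corollary2p3 :
    (∀ μ ∈ Hankel.classFinite, Hankel.spectralMap μ ∈ Hankel.classFinite ∧
      ∀ σ : Measure ℝ, Hankel.IsSpectralImage μ σ ↔ σ = Hankel.spectralMap μ) ∧
    (∀ μ ∈ Hankel.classFinite,
      (μ ∈ Hankel.classCarleson ↔ Hankel.spectralMap μ ∈ Hankel.classBounded)) ∧
    MapsTo Hankel.spectralMap (Hankel.classCarleson ∩ Hankel.classBounded)
      (Hankel.classCarleson ∩ Hankel.classBounded) ∧
    (∀ μ ∈ Hankel.classCarleson ∩ Hankel.classBounded,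
      Hankel.spectralMap (Hankel.spectralMap μ) = μ) := by
  refine ⟨fun μ hμ => Hankel.spectralMap_mem_and_iff hμ,
    fun μ hμ => Hankel.mem_classCarleson_iff hμ,
    fun μ hμ => ⟨Hankel.spectralMap_carleson hμ, (Hankel.mem_classCarleson_iff hμ.2.1).1 hμ.1⟩,
    fun μ hμ => Hankel.spectralMap_spectralMap hμ⟩
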